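/- Let $\Omega\subset\mathbb R^2$ be a bounded, simply connected polygonal Lipschitz domain. Let $\mathcal T$ be a regular triangulation (without hanging nodes) of $\Omega$ into closed triangles with set of edges $\mathcal E$. The boundary $\partial\Omega$ is split into a closed part $\Gamma_D$ of positive length and $\Gamma_N:=\partial\Omega\setminus\Gamma_D$, in such a way that the Dirichlet edges $\mathcal E(\Gamma_D)$ (boundary edges $E\subseteq\Gamma_D$) and the Neumann edges $\mathcal E(\Gamma_N)$ (boundary edges $E\subseteq\overline{\Gamma_N}$) partition the set of boundary edges. Let $\mathcal E(\Omega)$ be the set of interior edges, $h_E$ the length of $E\in\mathcal E$, and $[v]_E$ the jump of the traces of $v$ across an interior edge $E$ with a fixed orientation, respectively the trace of $v$ on $E$ if $E$ is a boundary edge. Let $H^1(\mathcal T)$ be the space of all $v\in L^2(\Omega)$ with $v|_T\in H^1(\operatorname{int}T)$ for all $T\in\mathcal T$, and let $\nabla_{pw}$ be the piecewise gradient. Let $H^1_N(\Omega)$ be the space of all $w\in H^1(\Omega)$ with vanishing trace on $\Gamma_N$; if $\Gamma_N=\emptyset$, let it be the space of all $w\in H^1(\Omega)$ with $\int_\Omega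 w\,dx=0$ instead. For $v\in H^1(\mathcal T)$ define $$ j^2(v):=\sum_{E\in\mathcal E(\Omega)\cup\mathcal E(\Gamma_D)}h_E^{-1}\,\|[v]_E\|_{L^2(E)}^2,\qquad s_t(\nabla_{pw}v):=\sup_{w\in H^1_N(\Omega)\setminus\{0\}}\ \sum_{T\in\mathcal T}\frac{\langle\nabla_{pw}v|_T\cdot t_T,\,w\rangle_{\partial T}}{\|\nabla w\|_{L^2(\Omega)}}, $$ where $t_T$ is the counter-clockwise unit tangent of $\partial T$ and $\langle\beta\cdot t_T,w\rangle_{\partial T}:=\int_T w\,\operatorname{curl}\beta\,dx+\int_T\beta\cdot\operatorname{Curl}w\,dx$ is the duality pairing of $H^{-1/2}(\partial T)$ and $H^{1/2}(\partial T)$, with $\operatorname{curl}\beta=\partial_1\beta_2-\partial_2\beta_1$ and $\operatorname{Curl}w=(-\partial_2w,\partial_1w)$. Then for every $k\in\mathbb N_0$ and $\alpha>0$ there is a constant $C>0$, depending only on $k$ and $\alpha$ (and not on $\Omega$, $\Gamma_D$ or the mesh sizes), such that, whenever all interior angles of the triangles in $\mathcal T$ are at least $\alpha$, every $v_h\in H^1(\mathcal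 T)$ with $(v_h|_T)|_E\in P^{k+1}(E)$ (polynomials on $E$ of degree at most $k+1$) for all $T\in\mathcal T$ and all edges $E$ of $T$ satisfies $$ j^2(v_h)+s_t^2(\nabla_{pw}v_h)\le C\,j^2(v_h)\qquad\text{and}\qquad j^2(v_h)\le C\,\bigl(j^2(v_h)+s_t^2(\nabla_{pw}v_h)\bigr). $$ -/

import Mathlib

open MeasureTheory Set Filter Topology
open scoped ENNReal NNReal ContDiff

noncomputable section

namespace DLSFEM

/-- The Euclidean plane. -/
abbrev Plane : Type := EuclideanSpace ℝ (Fin 2)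

/-- Counter-clockwise rotation by `π / 2`, so that `Curl w = rot (∇ w)`. -/
def rot (x : Plane) : Plane := !₂[-x 1, x 0]

/-! ### Domains and triangulations -/

/-- A bounded, simply connected Lipschitz domain in the plane: open, connected, and near each
boundary point the set lies, in suitable Cartesian coordinates, strictly above the graph of a
Lipschitz function.  (That the domain is a polygon is part of the existence of a triangulation.) -/
structure IsLipschitzDomain (Ω : Set Plane) : Prop where
  isOpen : IsOpen Ω
  isConnected : IsConnected Ω
  isBounded : Bornology.IsBounded Ω
  simplyConnected : SimplyConnectedSpace Ω
  lipschitz : ∀ x ∈ frontier Ω, ∃ (R : Plane ≃ₗᵢ[ℝ] Plane) (γ : ℝ → ℝ) (L : ℝ≥0) (r : ℝ),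
    0 < r ∧ LipschitzWith L γ ∧ ∀ y ∈ Metric.ball x r, (y ∈ Ω ↔ γ (R y 0) < R y 1)

/-- The closed convex hull spanned by finitely many points; the closed triangle with vertex set
`s` if `s` has three points, the closed edge with vertex set `s` if `s` has two points. -/
def hull (s : Finset Plane) : Set Plane := convexHull ℝ (s : Set Plane)

/-- A regular triangulation of `Ω` into finitely many closed triangles.  A triangle is given by
the set of its three vertices.  Two triangles meet exactly in the convex hull of their common
vertices, i.e. in nothing, a common vertex, a common edge, or they coincide. -/
structure Triangulation (Ω : Set Plane) where
  cells : Finset (Finset Plane)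
  card_eq : ∀ s ∈ cells, s.card = 3
  nondegenerate : ∀ s ∈ cells, AffineIndependent ℝ ((↑) : s → Plane)
  covers : ⋃ s ∈ cells, hull s = closure Ω
  regular : ∀ s ∈ cells, ∀ t ∈ cells,
    hull s ∩ hull t = convexHull ℝ ((s : Set Plane) ∩ (t : Set Plane))

variable {Ω : Set Plane}

open scoped Classical in
/-- The set of all edges; an edge is given by the set of its two vertices. -/
def Triangulation.edges (𝒯 : Triangulation Ω) : Finset (Finset Plane) :=
  𝒯.cells.biUnion fun s => s.powersetCard 2

open scoped Classical in
/-- The triangles adjacent to the edge `e`. -/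
def Triangulation.adj (𝒯 : Triangulation Ω) (e : Finset Plane) : Finset (Finset Plane) :=
  𝒯.cells.filter fun s => e ⊆ s

/-- All interior angles of the triangulation are at least `α`. -/
def Triangulation.AnglesGE (𝒯 : Triangulation Ω) (α : ℝ) : Prop :=
  ∀ s ∈ 𝒯.cells, ∀ a ∈ s, ∀ b ∈ s, ∀ c ∈ s, a ≠ b → b ≠ c → a ≠ c →
    α ≤ EuclideanGeometry.angle a b c

/-- The Neumann part of the boundary for the Dirichlet part `ΓD`. -/
def neumannPart (Ω ΓD : Set Plane) : Set Plane := frontier Ω \ ΓD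

/-- Boundary edges, Dirichlet edges, Neumann edges and interior edges. -/
def Triangulation.IsBoundaryEdge (𝒯 : Triangulation Ω) (e : Finset Plane) : Prop :=
  e ∈ 𝒯.edges ∧ hull e ⊆ frontier Ω

def Triangulation.IsDirichletEdge (𝒯 : Triangulation Ω) (ΓD : Set Plane) (e : Finset Plane) :
    Prop :=
  𝒯.IsBoundaryEdge e ∧ hull e ⊆ ΓD

def Triangulation.IsNeumannEdge (𝒯 : Triangulation Ω) (ΓD : Set Plane) (e : Finset Plane) :
    Prop :=
  𝒯.IsBoundaryEdge e ∧ hull e ⊆ closure (neumannPart Ω ΓD)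

def Triangulation.IsInteriorEdge (𝒯 : Triangulation Ω) (e : Finset Plane) : Prop :=
  e ∈ 𝒯.edges ∧ ¬ 𝒯.IsBoundaryEdge e

/-- `ΓD` is an admissible Dirichlet boundary for `𝒯`: a closed part of the boundary of positive
length such that Dirichlet and Neumann edges partition the boundary edges. -/
structure Triangulation.IsDirichletPart (𝒯 : Triangulation Ω) (ΓD : Set Plane) : Prop where
  subset : ΓD ⊆ frontier Ω
  isClosed : IsClosed ΓD
  pos : 0 < μH[1] ΓD
  partition : ∀ e, 𝒯.IsBoundaryEdge e →
    Xor (𝒯.IsDirichletEdge ΓD e) (𝒯.IsNeumannEdge ΓD e)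

/-- `n` is the outward unit normal vector of the triangle `s` along its edge `e`. -/
def IsOuterNormal (n : Plane) (e s : Finset Plane) : Prop :=
  ‖n‖ = 1 ∧ ∀ x ∈ s, ∀ y ∈ e, inner ℝ n (x - y) ≤ 0

/-- A fixed orientation of the edges: `n e` is the outward unit normal of one of the adjacent
triangles (which is the triangle `T₊` of `e`; for a boundary edge it is the only one). -/
def Triangulation.IsOrientation (𝒯 : Triangulation Ω) (n : Finset Plane → Plane) : Prop :=
  ∀ e ∈ 𝒯.edges, ∃ s ∈ 𝒯.adj e, IsOuterNormal (n e) e s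

/-- Arc length measure on an edge. -/
def edgeMeasure (e : Finset Plane) : Measure Plane := (μH[1] : Measure Plane).restrict (hull e)

/-- The length `h_E` of an edge. -/
def edgeLength (e : Finset Plane) : ℝ := (edgeMeasure e).real univ

/-! ### Sobolev functions -/

/-- Smooth functions with compact support in the open set `U`. -/
def IsTest (U : Set Plane) (φ : Plane → ℝ) : Prop :=
  ContDiff ℝ ∞ φ ∧ HasCompactSupport φ ∧ tsupport φ ⊆ U

/-- `G` is a square-integrable weak gradient of `v` on the open set `U`. -/
def HasWeakGrad (U : Set Plane) (v : Plane → ℝ) (G : Plane → Plane) : Prop :=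
  MemLp G 2 (volume.restrict U) ∧
    ∀ φ, IsTest U φ → ∫ x in U, v x • gradient φ x = -∫ x in U, φ x • G x

/-- The Sobolev space `H¹(U)`. -/
def MemH1 (U : Set Plane) (v : Plane → ℝ) : Prop :=
  MemLp v 2 (volume.restrict U) ∧ ∃ G, HasWeakGrad U v G

open scoped Classical in
/-- The weak gradient on `U` (unique almost everywhere on `U`). -/
def weakGrad (U : Set Plane) (v : Plane → ℝ) : Plane → Plane :=
  if h : ∃ G, HasWeakGrad U v G then h.choose else 0

/-- `c` is the square-integrable weak `curl β = ∂₁ β₂ - ∂₂ β₁` on `U`. -/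
def HasWeakCurl (U : Set Plane) (β : Plane → Plane) (c : Plane → ℝ) : Prop :=
  MemLp c 2 (volume.restrict U) ∧
    ∀ φ, IsTest U φ → ∫ x in U, c x * φ x = -∫ x in U, inner ℝ (β x) (rot (gradient φ x))

open scoped Classical in
/-- The weak curl on `U` (unique almost everywhere on `U`). -/
def weakCurl (U : Set Plane) (β : Plane → Plane) : Plane → ℝ :=
  if h : ∃ c, HasWeakCurl U β c then h.choose else 0

/-- `g ∈ L²(E)` is the trace on the edge `e` of the `H¹` function `v` on the triangle `s`: smooth
functions converge to `v` in `H¹(int T)` while their restrictions converge to `g` in `L²(E)`. -/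
def HasTrace (s e : Finset Plane) (v g : Plane → ℝ) : Prop :=
  MemLp g 2 (edgeMeasure e) ∧ ∃ φ : ℕ → Plane → ℝ, (∀ m, ContDiff ℝ ∞ (φ m)) ∧
    Tendsto (fun m => eLpNorm (fun x => φ m x - v x) 2 (volume.restrict (interior (hull s))))
      atTop (𝓝 0) ∧
    Tendsto (fun m => eLpNorm (fun x => gradient (φ m) x - weakGrad (interior (hull s)) v x) 2
      (volume.restrict (interior (hull s)))) atTop (𝓝 0) ∧
    Tendsto (fun m => eLpNorm (fun x => φ m x - g x) 2 (edgeMeasure e)) atTop (𝓝 0)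

open scoped Classical in
/-- The trace `(v|_T)|_E` (unique almost everywhere on the edge). -/
def edgeTrace (s e : Finset Plane) (v : Plane → ℝ) : Plane → ℝ :=
  if h : ∃ g, HasTrace s e v g then h.choose else 0

/-- The piecewise Sobolev space `H¹(𝒯)`. -/
def Triangulation.MemPwH1 (𝒯 : Triangulation Ω) (v : Plane → ℝ) : Prop :=
  MemLp v 2 (volume.restrict Ω) ∧ ∀ s ∈ 𝒯.cells, MemH1 (interior (hull s)) v

/-- The piecewise gradient. -/
def Triangulation.pwGrad (𝒯 : Triangulation Ω) (v : Plane → ℝ) : Plane → Plane := fun x =>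
  ∑ s ∈ 𝒯.cells, (interior (hull s)).indicator (weakGrad (interior (hull s)) v) x

/-- The functions in `H¹(𝒯)` all of whose traces `(v|_T)|_E` are polynomials of degree at most
`m` on the edge. -/
def Triangulation.MemPolyTrace (𝒯 : Triangulation Ω) (m : ℕ) (v : Plane → ℝ) : Prop :=
  𝒯.MemPwH1 v ∧ ∀ s ∈ 𝒯.cells, ∀ e ∈ s.powersetCard 2, ∃ p : MvPolynomial (Fin 2) ℝ,
    p.totalDegree ≤ m ∧ HasTrace s e v (fun x => MvPolynomial.eval (fun i => x i) p)

/-! ### Jump terms -/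

open scoped Classical in
/-- The jump `[v]_E`: the trace from `T₊` minus the trace from `T₋` on interior edges, the trace
from `T₊` on boundary edges. -/
def Triangulation.jump (𝒯 : Triangulation Ω) (n : Finset Plane → Plane) (v : Plane → ℝ)
    (e : Finset Plane) : Plane → ℝ := fun x =>
  ∑ s ∈ 𝒯.adj e, (if IsOuterNormal (n e) e s then 1 else -1) * edgeTrace s e v x

open scoped Classical in
/-- `j²(v)`, the sum over the interior and Dirichlet edges of `h_E⁻¹ ‖[v]_E‖²` in `L²(E)`. -/
def Triangulation.jSq (𝒯 : Triangulation Ω) (ΓD : Set Plane) (n : Finset Plane → Plane)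
    (v : Plane → ℝ) : ℝ≥0∞ :=
  ∑ e ∈ 𝒯.edges.filter (fun e => 𝒯.IsInteriorEdge e ∨ 𝒯.IsDirichletEdge ΓD e),
    ENNReal.ofReal (edgeLength e)⁻¹ * eLpNorm (𝒯.jump n v e) 2 (edgeMeasure e) ^ 2

/-- The duality pairing `⟨β · t_T, w⟩` on the boundary of the triangle `s` for `β` in `H(curl)`
and `w` in `H¹`, i.e. the tangential trace of `β` applied to the trace of `w`. -/
def tangentialPairing (s : Finset Plane) (β : Plane → Plane) (w : Plane → ℝ) : ℝ :=
  (∫ x in interior (hull s), weakCurl (interior (hull s)) β x * w x) +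
    ∫ x in interior (hull s), inner ℝ (β x) (rot (weakGrad (interior (hull s)) w x))

/-- The space `H¹_N(Ω)` of functions with vanishing trace on the Neumann boundary; in the case of
pure Dirichlet conditions it is the space of `H¹` functions with integral mean zero. -/
def Triangulation.MemH1N (𝒯 : Triangulation Ω) (ΓD : Set Plane) (w : Plane → ℝ) : Prop :=
  MemH1 Ω w ∧
    (∀ e, 𝒯.IsNeumannEdge ΓD e → ∀ s ∈ 𝒯.adj e, HasTrace s e w 0) ∧
    (neumannPart Ω ΓD = ∅ → ∫ x in Ω, w x = 0)

/-- `s_t(β)`, the supremum over the nonzero `w` in `H¹_N(Ω)` of the sum over all triangles of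
`⟨β · t_T, w⟩ / ‖∇ w‖`.  The test space is symmetric under `w ↦ -w`, so passing to positive parts
by `ENNReal.ofReal` does not change the supremum. -/
def Triangulation.st (𝒯 : Triangulation Ω) (ΓD : Set Plane) (β : Plane → Plane) : ℝ≥0∞ :=
  ⨆ (w : Plane → ℝ) (_ : 𝒯.MemH1N ΓD w ∧ ¬ w =ᵐ[volume.restrict Ω] 0),
    ENNReal.ofReal (∑ s ∈ 𝒯.cells,
      tangentialPairing s β w / (eLpNorm (weakGrad Ω w) 2 (volume.restrict Ω)).toReal)

end DLSFEM

end

/-!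
The second inequality is trivial with any constant at least one; the content is that the
tangential traces of the piecewise gradient are controlled by the jumps.

Let `w` be a test function. On a triangle `T`, the weak curl of `∇ v` vanishes and the pairing
`⟨∇ v · t, w⟩` is the line integral of `w` against the differential of the polynomial trace of `v`
around `∂T` (`HasTrace.green_weakGrad`). This is Green's formula for smooth functions, extended by
density (`exists_smooth_approx`) and integration by parts along the edges; the end point terms drop
out because polynomial traces on two edges agree at the common vertex (`HasTrace.vertex_eq`).
The trace `g` of `w ∈ H¹(Ω)` on an edge is the same from both sides (`Triangulation.hasTrace_ae_eq`)
and vanishes on Neumann edges. The sum over all triangles is therefore the sum of `∫ g d[v]` over the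
interior and the Dirichlet edges.

On one edge with end points `x` and `y`, split the polynomial `[v]` into an affine function and a
bubble that vanishes at `x` and `y`. The bubble extends to an adjacent triangle by a function that
vanishes on the other two edges, with a gradient controlled by `[v]`. The affine part contributes
`([v](y) - [v](x))` times the average of `g` over the edge (`exists_edge_estimate`; all norms are
equivalent on polynomials of bounded degree, and everything is invariant under scaling).

It remains to bound the sum of `([v](y) - [v](x))` times the averages. Rearrange it by vertices. At a
vertex `z`, the jumps `[v](z)` of the edges at `z` are differences of the corner values of the adjacent
triangles, so that they form the divergence of a flow on the graph whose nodes are the edges at `z`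
and whose links are the triangles at `z`. The total divergence of each component of this graph is
zero, so a constant may be subtracted from the averages on each component; where the component has a
Neumann edge, the average on that edge is zero (`abs_sum_divergence_mul_le`). What is left are
differences of averages over two edges of the same triangle, which are bounded by the energy of `w`
on that triangle (`HasTrace.abs_integral_sub_le`). The number of triangles at a vertex is bounded in
terms of the minimal angle (`AnglesGE.card_le`), so the Cauchy–Schwarz inequality gives
`EdgeEnds.abs_sum_le` and then `exists_abs_sum_tangentialPairing_le`.
-/

namespace DLSFEM

/-! ### Barycentric coordinates of a triangle -/

/-- The determinant of two plane vectors. -/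
def cross (u v : Plane) : ℝ := u 0 * v 1 - u 1 * v 0

theorem cross_swap (u v : Plane) : cross v u = -cross u v := by
  simp only [cross]; ring

@[simp] theorem cross_self (u : Plane) : cross u u = 0 := by
  simp only [cross]; ring

theorem continuous_cross {X : Type*} [TopologicalSpace X] {f g : X → Plane}
    (hf : Continuous f) (hg : Continuous g) : Continuous fun x => cross (f x) (g x) := by
  unfold cross; fun_prop

theorem cross_rotate (a b c : Plane) : cross (c - b) (a - b) = cross (b - a) (c - a) := by
  simp only [cross, PiLp.sub_apply]; ring

theorem cross_reverse (a b c : Plane) : cross (a - b) (c - b) = -cross (b - a) (c - a) := by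
  simp only [cross, PiLp.sub_apply]; ring

theorem inner_rot (u v : Plane) : inner ℝ u (rot v) = -cross u v := by
  simp [rot, cross, PiLp.inner_apply, Fin.sum_univ_two]; ring

/-- The linear map with columns `u` and `v`. -/
noncomputable def columnMap (u v : Plane) : Plane →L[ℝ] Plane :=
  (PiLp.proj 2 (fun _ : Fin 2 => ℝ) 0 : Plane →L[ℝ] ℝ).smulRight u +
    (PiLp.proj 2 (fun _ : Fin 2 => ℝ) 1 : Plane →L[ℝ] ℝ).smulRight v

theorem columnMap_apply (u v x : Plane) : columnMap u v x = x 0 • u + x 1 • v := by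
  simp [columnMap]

theorem det_columnMap (u v : Plane) : (columnMap u v).det = cross u v := by
  have h := LinearMap.det_toLin (EuclideanSpace.basisFun (Fin 2) ℝ).toBasis
    (!![u 0, v 0; u 1, v 1] : Matrix (Fin 2) (Fin 2) ℝ)
  rw [Matrix.det_fin_two_of] at h
  have h2 : ((columnMap u v : Plane →L[ℝ] Plane) : Plane →ₗ[ℝ] Plane) =
      Matrix.toLin (EuclideanSpace.basisFun (Fin 2) ℝ).toBasis
        (EuclideanSpace.basisFun (Fin 2) ℝ).toBasis !![u 0, v 0; u 1, v 1] := by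
    refine (EuclideanSpace.basisFun (Fin 2) ℝ).toBasis.ext fun i => ?_
    rw [Matrix.toLin_self]
    ext j
    fin_cases i <;> fin_cases j <;> simp [columnMap_apply]
  rw [ContinuousLinearMap.det, h2, h, cross]
  ring

/-- The barycentric coordinate belonging to the vertex `a` of the triangle with vertices
`a`, `b`, `c`. -/
noncomputable def bary (a b c x : Plane) : ℝ := cross (b - x) (c - x) / cross (b - a) (c - a)

theorem continuous_bary (a b c : Plane) : Continuous (bary a b c) := by
  unfold bary
  exact (continuous_cross (by fun_prop) (by fun_prop)).div_const _

section

variable {a b c : Plane}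

theorem bary_sum (h : cross (b - a) (c - a) ≠ 0) (x : Plane) :
    bary a b c x + bary b c a x + bary c a b x = 1 := by
  have h1 : cross (c - b) (a - b) = cross (b - a) (c - a) := cross_rotate a b c
  have h2 : cross (a - c) (b - c) = cross (b - a) (c - a) := by rw [cross_rotate b c a, h1]
  rw [bary, bary, bary, h1, h2, ← add_div, ← add_div, div_eq_one_iff_eq h]
  simp only [cross, PiLp.sub_apply]; ring

theorem bary_combo (h : cross (b - a) (c - a) ≠ 0) (x : Plane) :
    bary a b c x • a + bary b c a x • b + bary c a b x • c = x := by
  have h1 : cross (c - b) (a - b) = cross (b - a) (c - a) := cross_rotate a b c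
  have h2 : cross (a - c) (b - c) = cross (b - a) (c - a) := by rw [cross_rotate b c a, h1]
  rw [bary, bary, bary, h1, h2]
  ext i
  fin_cases i <;>
  · simp only [PiLp.add_apply, PiLp.smul_apply, smul_eq_mul]
    rw [div_mul_eq_mul_div, div_mul_eq_mul_div, div_mul_eq_mul_div, ← add_div, ← add_div,
      div_eq_iff h]
    simp [cross]
    ring

/-- Barycentric coordinates are affine along lines. -/
theorem bary_add_smul (x d : Plane) (t : ℝ) :
    bary a b c (x + t • d) = bary a b c x + t * (cross d (b - c) / cross (b - a) (c - a)) := by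
  rw [bary, bary, mul_div_assoc', ← add_div]
  congr 1
  simp [cross]; ring

theorem bary_lineMap (x y : Plane) (t : ℝ) :
    bary a b c (AffineMap.lineMap x y t) = (1 - t) * bary a b c x + t * bary a b c y := by
  have := bary_add_smul (a := a) (b := b) (c := c) x (y - x) 1
  rw [AffineMap.lineMap_apply, vsub_eq_sub, vadd_eq_add, add_comm, bary_add_smul]
  rw [one_smul, add_sub_cancel] at this
  rw [this]; ring

theorem bary_self (h : cross (b - a) (c - a) ≠ 0) : bary a b c a = 1 := div_self h

@[simp] theorem bary_left : bary a b c b = 0 := by simp [bary, cross]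

@[simp] theorem bary_right : bary a b c c = 0 := by simp [bary, cross]

theorem convex_bary_nonneg (a b c : Plane) : Convex ℝ {x | 0 ≤ bary a b c x} := by
  intro x hx y hy s t hs ht hst
  have : s • x + t • y = AffineMap.lineMap x y t := by
    rw [AffineMap.lineMap_apply_module, ← hst]; simp
  rw [mem_ofPred_eq, this, bary_lineMap, ← hst]
  simp only [mem_ofPred_eq] at hx hy
  simp only [add_sub_cancel_right]
  positivity

theorem convexHull_triangle (h : cross (b - a) (c - a) ≠ 0) :
    convexHull ℝ {a, b, c} = {x | 0 ≤ bary a b c x ∧ 0 ≤ bary b c a x ∧ 0 ≤ bary c a b x} := by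
  have hb : cross (c - b) (a - b) ≠ 0 := by rwa [cross_rotate a b c]
  have hc : cross (a - c) (b - c) ≠ 0 := by rwa [cross_rotate b c a]
  apply Subset.antisymm
  · refine convexHull_min ?_ ((convex_bary_nonneg a b c).inter
      ((convex_bary_nonneg b c a).inter (convex_bary_nonneg c a b)))
    rintro x (rfl | rfl | rfl) <;> simp [bary_self, h, hb, hc]
  · rintro x ⟨h0, h1, h2⟩
    have := (convex_convexHull ℝ {a, b, c}).sum_mem (t := Finset.univ)
      (w := ![bary a b c x, bary b c a x, bary c a b x]) (z := ![a, b, c]) (by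
        intro i _; fin_cases i <;> simp [*]) (by simpa [Fin.sum_univ_three] using bary_sum h x) (by
        intro i _; apply subset_convexHull; fin_cases i <;> simp)
    simpa [Fin.sum_univ_three, bary_combo h x] using this

theorem isOpen_bary_pos (a b c : Plane) : IsOpen {x | 0 < bary a b c x} :=
  isOpen_lt continuous_const (continuous_bary a b c)

theorem interior_bary_nonneg (h : cross (b - a) (c - a) ≠ 0) :
    interior {x | 0 ≤ bary a b c x} ⊆ {x | 0 < bary a b c x} := by
  intro x hx
  have hc : Tendsto (fun t : ℝ => x + t • (b - a)) (𝓝[>] 0) (𝓝 x) := by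
    have : Continuous fun t : ℝ => x + t • (b - a) := by fun_prop
    simpa using (this.tendsto 0).mono_left nhdsWithin_le_nhds
  have h1 := hc.eventually (mem_interior_iff_mem_nhds.1 hx)
  obtain ⟨t, ht, ht0⟩ := (h1.and self_mem_nhdsWithin).exists
  rw [bary_add_smul] at ht
  have : cross (b - a) (b - c) / cross (b - a) (c - a) = -1 := by
    rw [div_eq_iff h]; simp [cross]; ring
  rw [this] at ht
  simp only [mem_ofPred_eq]
  linarith

theorem interior_triangle (h : cross (b - a) (c - a) ≠ 0) :
    interior (convexHull ℝ {a, b, c}) =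
      {x | 0 < bary a b c x ∧ 0 < bary b c a x ∧ 0 < bary c a b x} := by
  have hb : cross (c - b) (a - b) ≠ 0 := by rwa [cross_rotate a b c]
  have hc : cross (a - c) (b - c) ≠ 0 := by rwa [cross_rotate b c a]
  rw [convexHull_triangle h]
  apply Subset.antisymm
  · have : {x | 0 ≤ bary a b c x ∧ 0 ≤ bary b c a x ∧ 0 ≤ bary c a b x} =
      {x | 0 ≤ bary a b c x} ∩ ({x | 0 ≤ bary b c a x} ∩ {x | 0 ≤ bary c a b x}) := rfl
    rw [this, interior_inter, interior_inter]
    exact fun x hx => ⟨interior_bary_nonneg h hx.1, interior_bary_nonneg hb hx.2.1,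
      interior_bary_nonneg hc hx.2.2⟩
  · refine interior_maximal (fun x hx => ⟨hx.1.le, hx.2.1.le, hx.2.2.le⟩) ?_
    exact (isOpen_bary_pos a b c).inter ((isOpen_bary_pos b c a).inter (isOpen_bary_pos c a b))

theorem interior_triangle_eq_image (h : cross (b - a) (c - a) ≠ 0) :
    interior (convexHull ℝ {a, b, c}) = (fun x => columnMap (b - a) (c - a) x + a) ''
      {x : Plane | 0 < x 0 ∧ 0 < x 1 ∧ x 0 + x 1 < 1} := by
  have hb : cross (c - b) (a - b) ≠ 0 := by rwa [cross_rotate a b c]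
  have hc : cross (a - c) (b - c) ≠ 0 := by rwa [cross_rotate b c a]
  rw [interior_triangle h]
  ext x
  constructor
  · rintro ⟨h0, h1, h2⟩
    have hs := bary_sum h x
    refine ⟨!₂[bary b c a x, bary c a b x], ⟨by simpa, by simpa, by simp; linarith⟩, ?_⟩
    have := bary_combo h x
    have h3 : bary a b c x = 1 - bary b c a x - bary c a b x := by linarith
    simp only [columnMap_apply, Matrix.cons_val_zero, Matrix.cons_val_one]
    conv_rhs => rw [← this, h3]
    module
  · rintro ⟨y, ⟨h0, h1, h2⟩, rfl⟩
    have e : columnMap (b - a) (c - a) y + a = a + y 0 • (b - a) + y 1 • (c - a) := by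
      rw [columnMap_apply]; abel
    have k1 : cross (b - a) (b - c) / cross (b - a) (c - a) = -1 := by
      rw [div_eq_iff h]; simp [cross]; ring
    have k2 : cross (c - a) (b - c) / cross (b - a) (c - a) = -1 := by
      rw [div_eq_iff h]; simp [cross]; ring
    have k3 : cross (b - a) (c - a) / cross (c - b) (a - b) = 1 := by
      rw [cross_rotate a b c, div_self h]
    have k4 : cross (c - a) (c - a) / cross (c - b) (a - b) = 0 := by simp
    have k5 : cross (b - a) (a - b) / cross (a - c) (b - c) = 0 := by
      rw [div_eq_zero_iff]; left; simp [cross]; ring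
    have k6 : cross (c - a) (a - b) / cross (a - c) (b - c) = 1 := by
      rw [cross_rotate b c a, cross_rotate a b c, div_eq_iff h]; simp [cross]; ring
    simp only [e, mem_ofPred_eq, bary_add_smul, k1, k2, k3, k4, k5, k6, bary_self h, bary_left,
      bary_right]
    refine ⟨by linarith, by linarith, by linarith⟩

/-- The vertices of a nondegenerate triangle in some order; the sign of the cross product is the
orientation of that order. -/
theorem exists_triangle {s : Finset Plane} (hs : s.card = 3)
    (hi : AffineIndependent ℝ ((↑) : s → Plane)) :
    ∃ a b c, s = {a, b, c} ∧ cross (b - a) (c - a) ≠ 0 := by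
  obtain ⟨a, b, c, hab, hac, hbc, he⟩ := Finset.card_eq_three.1 hs
  refine ⟨a, b, c, he, fun h => ?_⟩
  have hi' : AffineIndependent ℝ ![a, b, c] := by
    have hinj : Function.Injective ![a, b, c] := by
      clear hi he hs h
      intro i j hij
      fin_cases i <;> fin_cases j <;> simp at hij ⊢ <;> tauto
    have hmem : ∀ i, ![a, b, c] i ∈ s := by
      intro i; rw [he]; fin_cases i <;> simp
    let f : Fin 3 ↪ s := ⟨fun i => ⟨![a, b, c] i, hmem i⟩, fun i j hij =>
      hinj (congrArg Subtype.val hij)⟩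
    exact hi.comp_embedding f
  rw [affineIndependent_iff_not_collinear_set] at hi'
  apply hi'
  rw [collinear_iff_of_mem (p₀ := a) (by simp)]
  have hn : (b 0 - a 0) ^ 2 + (b 1 - a 1) ^ 2 ≠ 0 := by
    intro h0
    have h1 : b 0 - a 0 = 0 := by nlinarith [sq_nonneg (b 0 - a 0), sq_nonneg (b 1 - a 1)]
    have h2 : b 1 - a 1 = 0 := by nlinarith [sq_nonneg (b 0 - a 0), sq_nonneg (b 1 - a 1)]
    apply hab
    ext i; fin_cases i <;> simp <;> linarith
  simp only [cross, PiLp.sub_apply] at h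
  refine ⟨b - a, ?_⟩
  rintro p (rfl | rfl | rfl)
  · exact ⟨0, by simp⟩
  · exact ⟨1, by simp⟩
  · refine ⟨((b 0 - a 0) * (p 0 - a 0) + (b 1 - a 1) * (p 1 - a 1)) /
      ((b 0 - a 0) ^ 2 + (b 1 - a 1) ^ 2), ?_⟩
    ext i; fin_cases i
    · simp; field_simp
      linear_combination (-(b 1 - a 1)) * h
    · simp; field_simp
      linear_combination ((b 0 - a 0)) * h

end

/-! ### Green's formula on a triangle -/

/-- Fubini on the reference triangle. -/
theorem integral_refTriangle {h : Plane → ℝ} (hh : Continuous h) :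
    ∫ x in {x : Plane | 0 < x 0 ∧ 0 < x 1 ∧ x 0 + x 1 < 1}, h x =
      ∫ s in (0 : ℝ)..1, ∫ t in (0 : ℝ)..(1 - s), h !₂[s, t] := by
  set A : Set (ℝ × ℝ) := {p | 0 < p.1 ∧ 0 < p.2 ∧ p.1 + p.2 < 1} with hA
  have hAm : MeasurableSet A :=
    ((isOpen_lt continuous_const continuous_fst).inter
      ((isOpen_lt continuous_const continuous_snd).inter
        (isOpen_lt (continuous_fst.add continuous_snd) continuous_const))).measurableSet
  let e : Plane ≃ᵐ ℝ × ℝ :=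
    (MeasurableEquiv.toLp 2 (Fin 2 → ℝ)).symm.trans MeasurableEquiv.finTwoArrow
  have he : MeasurePreserving e :=
    (volume_preserving_finTwoArrow ℝ).comp (PiLp.volume_preserving_ofLp (Fin 2))
  let k : ℝ × ℝ → ℝ := fun p => h !₂[p.1, p.2]
  have hk : Continuous k := by
    refine hh.comp ?_
    refine (PiLp.continuous_toLp 2 _).comp (continuous_pi fun i => ?_)
    fin_cases i <;> simp <;> fun_prop
  have hke : ∀ x, k (e x) = h x := by
    intro x
    have : (!₂[(e x).1, (e x).2] : Plane) = x := by
      ext i; fin_cases i <;> rfl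
    simp only [k, this]
  have h1 := he.setIntegral_preimage_emb e.measurableEmbedding k A
  simp only [hke] at h1
  have h2 : e ⁻¹' A = {x : Plane | 0 < x 0 ∧ 0 < x 1 ∧ x 0 + x 1 < 1} := rfl
  rw [← h2, h1]
  have hint : IntegrableOn k A := by
    refine (hk.continuousOn.integrableOn_compact
      (isCompact_Icc (a := ((0 : ℝ), (0 : ℝ))) (b := (1, 1)))).mono_set ?_
    rintro ⟨x, y⟩ ⟨hx, hy, hxy⟩
    simp only at hx hy hxy
    exact ⟨⟨hx.le, hy.le⟩, ⟨by simp only; linarith, by simp only; linarith⟩⟩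
  rw [← integral_indicator hAm, Measure.volume_eq_prod, integral_prod _ (by
    rw [← Measure.volume_eq_prod]; exact (integrable_indicator_iff hAm).2 hint),
    intervalIntegral.integral_of_le zero_le_one, integral_Ioc_eq_integral_Ioo,
    ← integral_indicator measurableSet_Ioo]
  congr 1
  ext s
  by_cases hs : s ∈ Ioo (0 : ℝ) 1
  · rw [indicator_of_mem hs, intervalIntegral.integral_of_le (by linarith [hs.2]),
      integral_Ioc_eq_integral_Ioo, ← integral_indicator measurableSet_Ioo]
    congr 1
    ext t
    by_cases ht : t ∈ Ioo 0 (1 - s)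
    · rw [indicator_of_mem ht, indicator_of_mem]
      exact ⟨hs.1, ht.1, by simp only; linarith [ht.2]⟩
    · rw [indicator_of_notMem ht, indicator_of_notMem]
      rintro ⟨_, h4, h5⟩
      exact ht ⟨h4, by simp only at h5; linarith⟩
  · rw [indicator_of_notMem hs]
    convert integral_zero ℝ ℝ with t
    rw [indicator_of_notMem]
    rintro ⟨h3, h4, h5⟩
    exact hs ⟨h3, by simp only at h4 h5; linarith⟩

/-- Change of variables from the reference triangle with the affine map
`s, t ↦ a + s (b - a) + t (c - a)`. -/
theorem integral_triangle {a b c : Plane} (hD : cross (b - a) (c - a) ≠ 0) {h : Plane → ℝ}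
    (hh : Continuous h) :
    ∫ x in interior (convexHull ℝ {a, b, c}), h x = |cross (b - a) (c - a)| *
      ∫ s in (0 : ℝ)..1, ∫ t in (0 : ℝ)..(1 - s), h (s • (b - a) + t • (c - a) + a) := by
  have hinj : Function.Injective (columnMap (b - a) (c - a)) := by
    rw [← ContinuousLinearMap.coe_coe, ← LinearMap.ker_eq_bot]
    by_contra hne
    have := LinearMap.bot_lt_ker_of_det_eq_zero
      (f := ((columnMap (b - a) (c - a) : Plane →L[ℝ] Plane) : Plane →ₗ[ℝ] Plane))
    refine hD ?_
    rw [← det_columnMap, ContinuousLinearMap.det]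
    by_contra h0
    exact hne (LinearMap.ker_eq_bot.2 ((LinearMap.equivOfDetNeZero _ h0).injective))
  rw [interior_triangle_eq_image hD, integral_image_eq_integral_abs_det_fderiv_smul volume
    (f' := fun _ => columnMap (b - a) (c - a)) _ _ _]
  · simp only [det_columnMap, smul_eq_mul]
    rw [integral_const_mul, integral_refTriangle (by fun_prop)]
    simp only [columnMap_apply]
    rfl
  · have h0 : Continuous fun x : Plane => x 0 := by fun_prop
    have h1 : Continuous fun x : Plane => x 1 := by fun_prop
    exact ((isOpen_lt continuous_const h0).inter ((isOpen_lt continuous_const h1).inter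
      (isOpen_lt (h0.add h1) continuous_const))).measurableSet
  · intro x _
    exact ((columnMap (b - a) (c - a)).hasFDerivAt.add_const a).hasFDerivWithinAt
  · intro x _ y _ hxy
    exact hinj (add_right_cancel hxy)

theorem volume_real_triangle {a b c : Plane} (hD : cross (b - a) (c - a) ≠ 0) :
    volume.real (interior (convexHull ℝ {a, b, c})) = |cross (b - a) (c - a)| / 2 := by
  have := integral_triangle hD (h := fun _ => 1) continuous_const
  simp only [setIntegral_const, smul_eq_mul, mul_one, intervalIntegral.integral_const,
    sub_zero] at this
  rw [this, intervalIntegral.integral_sub (by simp) (by simp)]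
  norm_num
  ring

/-- The divergence theorem for the constant direction `c - a`; the edge parallel to that direction
does not contribute. -/
theorem integral_fderiv_triangle {a b c : Plane} (hD : cross (b - a) (c - a) ≠ 0)
    {f : Plane → ℝ} (hf : ContDiff ℝ 1 f) :
    ∫ x in interior (convexHull ℝ {a, b, c}), fderiv ℝ f x (c - a) =
      |cross (b - a) (c - a)| * ((∫ s in (0 : ℝ)..1, f (AffineMap.lineMap c b s)) -
        ∫ s in (0 : ℝ)..1, f (AffineMap.lineMap a b s)) := by
  have hc : Continuous fun x => fderiv ℝ f x (c - a) :=
    (hf.continuous_fderiv (by simp)).clm_apply continuous_const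
  have hfc := hf.continuous
  have hl : ∀ x y : Plane, Continuous fun s : ℝ => AffineMap.lineMap (k := ℝ) x y s := fun x y =>
    AffineMap.lineMap_continuous
  rw [integral_triangle hD hc, ← intervalIntegral.integral_sub
    (f := fun s => f (AffineMap.lineMap c b s)) (g := fun s => f (AffineMap.lineMap a b s))
    ((hfc.comp (hl c b)).intervalIntegrable _ _) ((hfc.comp (hl a b)).intervalIntegrable _ _)]
  congr 1
  refine intervalIntegral.integral_congr fun s _ => ?_
  have hd : ∀ t : ℝ, HasDerivAt (fun t : ℝ => f (s • (b - a) + t • (c - a) + a))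
      (fderiv ℝ f (s • (b - a) + t • (c - a) + a) (c - a)) t := by
    intro t
    refine ((hf.differentiable (by simp)) _).hasFDerivAt.comp_hasDerivAt t ?_
    simpa using (((hasDerivAt_id t).smul_const (c - a)).const_add (s • (b - a))).add_const a
  rw [intervalIntegral.integral_eq_sub_of_hasDerivAt (fun t _ => hd t)
    ((hc.comp (by fun_prop)).intervalIntegrable _ _)]
  congr 2 <;> simp only [AffineMap.lineMap_apply_module] <;> module

/-- The line integral `∫ f dh` along the segment from `a` to `b`. -/
noncomputable def lineInt (a b : Plane) (f h : Plane → ℝ) : ℝ :=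
  ∫ s in (0 : ℝ)..1, f (AffineMap.lineMap a b s) * fderiv ℝ h (AffineMap.lineMap a b s) (b - a)

theorem lineInt_swap (a b : Plane) (f h : Plane → ℝ) : lineInt b a f h = -lineInt a b f h := by
  have := intervalIntegral.integral_comp_sub_left (a := 0) (b := 1) (fun s : ℝ =>
    f (AffineMap.lineMap a b s) * fderiv ℝ h (AffineMap.lineMap a b s) (b - a)) 1
  rw [lineInt, lineInt, ← intervalIntegral.integral_neg]
  simp only [sub_self, sub_zero] at this
  rw [intervalIntegral.integral_neg, ← this, ← intervalIntegral.integral_neg]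
  refine intervalIntegral.integral_congr fun s _ => ?_
  simp only [AffineMap.lineMap_apply_one_sub]
  rw [← neg_sub b a, map_neg]
  ring

/-- The Jacobian determinant of `(v, w)` in terms of the directional derivatives along `p` and `q`. -/
theorem cross_gradient {v w : Plane → ℝ} {x : Plane} (p q : Plane) :
    cross p q * cross (gradient v x) (gradient w x) =
      fderiv ℝ v x p * fderiv ℝ w x q - fderiv ℝ v x q * fderiv ℝ w x p := by
  have e : ∀ {f : Plane → ℝ} (y : Plane), fderiv ℝ f x y = inner ℝ (gradient f x) y := by
    intro f y; simp [gradient]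
  simp only [e, PiLp.inner_apply, Fin.sum_univ_two, cross]
  simp
  ring

/-- Green's formula for smooth functions: the tangential pairing of `∇ v` with `w` is the line
integral of `v` against the differential of `w` along the clockwise boundary. -/
theorem integral_inner_gradient_rot_gradient {a b c : Plane} (hD : cross (b - a) (c - a) ≠ 0)
    {v w : Plane → ℝ} (hv : ContDiff ℝ ∞ v) (hw : ContDiff ℝ ∞ w) :
    ∫ x in interior (convexHull ℝ {a, b, c}), inner ℝ (gradient v x) (rot (gradient w x)) =
      -SignType.sign (cross (b - a) (c - a)) *
        (lineInt a b v w + lineInt b c v w + lineInt c a v w) := by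
  set T := interior (convexHull ℝ {a, b, c})
  set D := cross (b - a) (c - a) with hDdef
  have hbdd : Bornology.IsBounded (convexHull ℝ {a, b, c}) :=
    (isBounded_convexHull).2 (Set.toFinite _).isBounded
  have hint : ∀ {g : Plane → ℝ}, Continuous g → IntegrableOn g T := fun hg =>
    (hg.continuousOn.integrableOn_compact (hbdd.isCompact_closure)).mono_set
      (interior_subset.trans subset_closure)
  have hdw : ∀ d, ContDiff ℝ ∞ fun x => fderiv ℝ w x d := fun d =>
    (hw.fderiv_right (m := ∞) (by simp)).clm_apply contDiff_const
  have hl : ∀ x y : Plane, Continuous fun s : ℝ => AffineMap.lineMap (k := ℝ) x y s := fun x y =>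
    AffineMap.lineMap_continuous
  have hii : ∀ {g : Plane → ℝ}, Continuous g → ∀ x y : Plane, IntervalIntegrable
      (fun s : ℝ => g (AffineMap.lineMap x y s)) volume 0 1 := fun hg x y =>
    (hg.comp (hl x y)).intervalIntegrable _ _
  have hf : ∀ d, ContDiff ℝ ∞ fun x => v x * fderiv ℝ w x d := fun d => hv.mul (hdw d)
  have h1 : ∀ x, inner ℝ (gradient v x) (rot (gradient w x)) =
      -D⁻¹ * (fderiv ℝ (fun x => v x * fderiv ℝ w x (c - a)) x (b - a) -
        fderiv ℝ (fun x => v x * fderiv ℝ w x (b - a)) x (c - a)) := by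
    intro x
    have hvd : DifferentiableAt ℝ v x := (hv.differentiable (by simp)) x
    have hwd : DifferentiableAt ℝ w x := (hw.differentiable (by simp)) x
    have hsym : ∀ p q, fderiv ℝ (fun x => fderiv ℝ w x p) x q =
        fderiv ℝ (fun x => fderiv ℝ w x q) x p := by
      intro p q
      have hd : DifferentiableAt ℝ (fderiv ℝ w) x :=
        ((hw.fderiv_right (m := ∞) (by simp)).differentiable (by simp)) x
      have h2 := (hw.contDiffAt (x := x)).isSymmSndFDerivAt (by
        rw [minSmoothness_of_isRCLikeNormedField]; exact WithTop.coe_le_coe.2 (le_top : (2 : ℕ∞) ≤ ⊤))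
      rw [fderiv_clm_apply hd (by fun_prop), fderiv_clm_apply hd (by fun_prop)]
      simpa using h2 q p
    rw [fderiv_fun_mul hvd ((hdw _).differentiable (by simp) x),
      fderiv_fun_mul hvd ((hdw _).differentiable (by simp) x)]
    have := cross_gradient (v := v) (w := w) (x := x) (b - a) (c - a)
    simp only [add_apply, smul_apply, smul_eq_mul, inner_rot,
      hsym (c - a) (b - a)]
    rw [← hDdef] at this
    field_simp
    linarith
  simp only [h1]
  rw [integral_const_mul, integral_sub
    (hint (((hf _).continuous_fderiv (by simp)).clm_apply continuous_const))
    (hint (((hf _).continuous_fderiv (by simp)).clm_apply continuous_const)),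
    integral_fderiv_triangle hD ((hf _).of_le (by exact_mod_cast le_top))]
  have hD' : cross (c - a) (b - a) ≠ 0 := by
    rw [cross_swap]; exact neg_ne_zero.2 hD
  have hset : ({a, b, c} : Set Plane) = {a, c, b} := by rw [pair_comm b c]
  have h2 := integral_fderiv_triangle hD' ((hf (c - a)).of_le (m := 1) (by exact_mod_cast le_top))
  rw [← hset] at h2
  rw [h2, cross_swap, abs_neg, ← hDdef]
  have hsg : (SignType.sign D : ℝ) = D⁻¹ * |D| := by
    rcases lt_or_gt_of_ne hD with h | h
    · rw [sign_neg h, abs_of_neg h]; simp [h.ne]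
    · rw [sign_pos h, abs_of_pos h]; simp [h.ne']
  rw [hsg, lineInt_swap c b]
  have hbc : lineInt c b v w = (∫ s in (0 : ℝ)..1, v (AffineMap.lineMap c b s) *
      fderiv ℝ w (AffineMap.lineMap c b s) (b - a)) - ∫ s in (0 : ℝ)..1,
        v (AffineMap.lineMap c b s) * fderiv ℝ w (AffineMap.lineMap c b s) (c - a) := by
    rw [lineInt, ← intervalIntegral.integral_sub (hii (hf (b - a)).continuous c b)
      (hii (hf (c - a)).continuous c b)]
    refine intervalIntegral.integral_congr fun s _ => ?_
    rw [← sub_sub_sub_cancel_right b c a, map_sub]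
    ring
  have hrev : (∫ s in (0 : ℝ)..1, v (AffineMap.lineMap b c s) *
      fderiv ℝ w (AffineMap.lineMap b c s) (c - a)) = ∫ s in (0 : ℝ)..1,
        v (AffineMap.lineMap c b s) * fderiv ℝ w (AffineMap.lineMap c b s) (c - a) := by
    have := intervalIntegral.integral_comp_sub_left (a := 0) (b := 1) (fun s : ℝ =>
      v (AffineMap.lineMap b c s) * fderiv ℝ w (AffineMap.lineMap b c s) (c - a)) 1
    simp only [sub_self, sub_zero, AffineMap.lineMap_apply_one_sub] at this
    exact this.symm
  rw [hbc, hrev, lineInt_swap a c, lineInt, lineInt]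
  ring

/-! ### Square-integrable functions -/

section L2

variable {X E : Type*} [MeasurableSpace X] {μ : Measure X} [NormedAddCommGroup E]


theorem tendsto_eLpNorm_sub {ι : Type*} {l : Filter ι} {f g : ι → X → E} {v : X → E}
    (hf : Tendsto (fun m => eLpNorm (fun x => f m x - v x) 2 μ) l (𝓝 0))
    (hg : Tendsto (fun m => eLpNorm (fun x => g m x - v x) 2 μ) l (𝓝 0))
    (hfm : ∀ m, AEStronglyMeasurable (f m) μ) (hgm : ∀ m, AEStronglyMeasurable (g m) μ)
    (hv : AEStronglyMeasurable v μ) :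
    Tendsto (fun m => eLpNorm (fun x => f m x - g m x) 2 μ) l (𝓝 0) := by
  have h0 := hf.add hg
  rw [add_zero] at h0
  refine tendsto_of_tendsto_of_tendsto_of_le_of_le tendsto_const_nhds h0 (fun _ => zero_le)
    fun m => ?_
  have : (fun x => f m x - g m x) = (fun x => f m x - v x) - fun x => g m x - v x := by
    ext x; simp
  rw [this]
  exact eLpNorm_sub_le ((hfm m).sub hv) ((hgm m).sub hv) (by norm_num)

theorem eLpNorm_two_sq (f : X → E) : eLpNorm f 2 μ ^ 2 = ∫⁻ x, ‖f x‖ₑ ^ 2 ∂μ := by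
  have := eLpNorm_nnreal_pow_eq_lintegral (f := f) (p := 2) (μ := μ) (by norm_num)
  simpa using this

theorem eLpNorm_two_sq_toReal {f : X → E} (hf : MemLp f 2 μ) :
    (eLpNorm f 2 μ).toReal ^ 2 = ∫ x, ‖f x‖ ^ 2 ∂μ := by
  rw [← ENNReal.toReal_pow, eLpNorm_two_sq, integral_eq_lintegral_of_nonneg_ae
    (ae_of_all _ fun x => by positivity)
    (by exact hf.1.norm.pow 2)]
  congr 2 with x
  rw [ENNReal.ofReal_pow (norm_nonneg _), ofReal_norm]

variable [InnerProductSpace ℝ E]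

theorem abs_integral_inner_le {f h : X → E} (hf : MemLp f 2 μ) (hh : MemLp h 2 μ) :
    |∫ x, inner ℝ (f x) (h x) ∂μ| ≤ (eLpNorm f 2 μ).toReal * (eLpNorm h 2 μ).toReal := by
  have h1 := abs_real_inner_le_norm (hf.toLp f) (hh.toLp h)
  rw [L2.inner_def, Lp.norm_toLp, Lp.norm_toLp] at h1
  convert h1 using 2
  refine integral_congr_ae ?_
  filter_upwards [hf.coeFn_toLp, hh.coeFn_toLp] with x hx hx'
  rw [hx, hx']

theorem integrable_inner {f h : X → E} (hf : MemLp f 2 μ) (hh : MemLp h 2 μ) :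
    Integrable (fun x => inner ℝ (f x) (h x)) μ := by
  refine (L2.integrable_inner (𝕜 := ℝ) (hf.toLp f) (hh.toLp h)).congr ?_
  filter_upwards [hf.coeFn_toLp, hh.coeFn_toLp] with x hx hx'
  rw [hx, hx']

/-- `L²` convergence of one factor carries over to the integral of the inner product. -/
theorem tendsto_integral_inner {f : ℕ → X → E} {g h : X → E} (hg : MemLp g 2 μ)
    (hf : ∀ m, MemLp (f m) 2 μ) (hh : MemLp h 2 μ)
    (ht : Tendsto (fun m => eLpNorm (fun x => f m x - g x) 2 μ) atTop (𝓝 0)) :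
    Tendsto (fun m => ∫ x, inner ℝ (f m x) (h x) ∂μ) atTop (𝓝 (∫ x, inner ℝ (g x) (h x) ∂μ)) := by
  rw [tendsto_iff_norm_sub_tendsto_zero]
  have h0 : Tendsto (fun m => (eLpNorm (fun x => f m x - g x) 2 μ).toReal *
      (eLpNorm h 2 μ).toReal) atTop (𝓝 0) := by
    simpa using ((ENNReal.tendsto_toReal ENNReal.zero_ne_top).comp ht).mul_const
      ((eLpNorm h 2 μ).toReal)
  refine squeeze_zero (fun m => norm_nonneg _) (fun m => ?_) h0
  rw [← integral_sub (integrable_inner (hf m) hh) (integrable_inner hg hh), Real.norm_eq_abs]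
  simp only [← inner_sub_left]
  exact abs_integral_inner_le ((hf m).sub hg) hh

end L2

/-! ### Arc length on edges -/

section Edge

variable {a b : Plane} {e : Finset Plane}

theorem hull_pair (he : (e : Set Plane) = {a, b}) : hull e = segment ℝ a b := by
  rw [hull, he, convexHull_pair]

/-- Lebesgue measure on the unit interval. -/
noncomputable abbrev unitMeasure : Measure ℝ := volume.restrict (Ioc 0 1)

theorem measurableEmbedding_lineMap (hab : a ≠ b) :
    MeasurableEmbedding fun s : ℝ => AffineMap.lineMap (k := ℝ) a b s :=
  (AffineMap.lineMap_continuous.measurableEmbedding (AffineMap.lineMap_injective ℝ hab))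

/-- Arc length on an edge is the push-forward of Lebesgue measure on the unit interval under the affine
parametrization, scaled by the length. -/
theorem edgeMeasure_eq (hab : a ≠ b) (he : (e : Set Plane) = {a, b}) :
    edgeMeasure e = ENNReal.ofReal (dist a b) •
      unitMeasure.map fun s : ℝ => AffineMap.lineMap (k := ℝ) a b s := by
  have hL : 0 < dist a b := dist_pos.2 hab
  set L := dist a b with hLdef
  set g : ℝ → Plane := fun r => AffineMap.lineMap (k := ℝ) a b (L⁻¹ * r) with hg
  have hgi : Isometry g := by
    refine Isometry.of_dist_eq fun x y => ?_
    rw [hg, dist_lineMap_lineMap, Real.dist_eq, Real.dist_eq, ← mul_sub, abs_mul,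
      abs_of_pos (inv_pos.2 hL), ← hLdef]
    field_simp
  have h1 := hgi.map_hausdorffMeasure (d := 1) (Or.inl zero_le_one)
  rw [hausdorffMeasure_real] at h1
  have hseg : segment ℝ a b ⊆ range g := by
    rw [segment_eq_image_lineMap]
    rintro _ ⟨t, _, rfl⟩
    exact ⟨L * t, by simp [hg, inv_mul_cancel_left₀ hL.ne']⟩
  have hge : MeasurableEmbedding g := hgi.isClosedEmbedding.measurableEmbedding
  have hpre : g ⁻¹' segment ℝ a b = Icc 0 L := by
    ext r
    rw [mem_preimage, segment_eq_image_lineMap, hg]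
    simp only [(AffineMap.lineMap_injective ℝ hab).mem_set_image, mem_Icc]
    rw [inv_mul_le_one₀ hL]
    constructor
    · rintro ⟨h, h'⟩; exact ⟨by have := mul_nonneg hL.le h; rwa [mul_inv_cancel_left₀ hL.ne'] at this, h'⟩
    · rintro ⟨h, h'⟩; exact ⟨by positivity, h'⟩
  rw [edgeMeasure, hull_pair he, ← inter_eq_self_of_subset_left hseg,
    ← Measure.restrict_restrict (by
      rw [segment_eq_image_lineMap]
      exact (isCompact_Icc.image AffineMap.lineMap_continuous).measurableSet), ← h1,
    hge.restrict_map, hpre]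
  have h2 : (volume.restrict (Icc 0 L)) =
      ENNReal.ofReal L • unitMeasure.map (fun s => L * s) := by
    have hme : MeasurableEmbedding fun s : ℝ => L * s :=
      (Homeomorph.mulLeft₀ L hL.ne').isClosedEmbedding.measurableEmbedding
    have h3 : unitMeasure = volume.restrict ((fun s => L * s) ⁻¹' Icc 0 L) := by
      rw [unitMeasure, restrict_Ioc_eq_restrict_Icc]
      congr 1
      ext s
      simp only [mem_Icc, mem_preimage, mul_nonneg_iff_of_pos_left hL, mul_le_iff_le_one_right hL]
    rw [h3, ← hme.restrict_map, Real.map_volume_mul_left hL.ne', Measure.restrict_smul, smul_smul,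
      ← ENNReal.ofReal_mul hL.le, abs_of_pos (inv_pos.2 hL), mul_inv_cancel₀ hL.ne']
    simp
  rw [h2, Measure.map_smul, Measure.map_map hge.measurable (by fun_prop)]
  congr 2
  ext s : 1
  simp [hg, inv_mul_cancel_left₀ hL.ne']

theorem edgeLength_eq (hab : a ≠ b) (he : (e : Set Plane) = {a, b}) :
    edgeLength e = dist a b := by
  rw [edgeLength, edgeMeasure_eq hab he, Measure.real, Measure.smul_apply,
    (measurableEmbedding_lineMap hab).map_apply]
  simp

theorem integral_edgeMeasure (hab : a ≠ b) (he : (e : Set Plane) = {a, b}) (f : Plane → ℝ) :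
    ∫ x, f x ∂edgeMeasure e = dist a b * ∫ s in (0 : ℝ)..1, f (AffineMap.lineMap a b s) := by
  rw [edgeMeasure_eq hab he, integral_smul_measure, (measurableEmbedding_lineMap hab).integral_map,
    intervalIntegral.integral_of_le zero_le_one, ENNReal.toReal_ofReal dist_nonneg, smul_eq_mul]

theorem ae_edgeMeasure_iff (hab : a ≠ b) (he : (e : Set Plane) = {a, b}) {p : Plane → Prop} :
    (∀ᵐ x ∂edgeMeasure e, p x) ↔ ∀ᵐ s ∂unitMeasure, p (AffineMap.lineMap a b s) := by
  rw [edgeMeasure_eq hab he, Measure.ae_ennreal_smul_measure_iff (by simpa using hab),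
    (measurableEmbedding_lineMap hab).ae_map_iff]

theorem eLpNorm_edgeMeasure (hab : a ≠ b) (he : (e : Set Plane) = {a, b}) (f : Plane → ℝ) :
    eLpNorm f 2 (edgeMeasure e) = ENNReal.ofReal (dist a b) ^ (2⁻¹ : ℝ) *
      eLpNorm (fun s : ℝ => f (AffineMap.lineMap a b s)) 2 unitMeasure := by
  rw [edgeMeasure_eq hab he, eLpNorm_smul_measure_of_ne_top (by norm_num),
    (measurableEmbedding_lineMap hab).eLpNorm_map_measure]
  simp [Function.comp_def]

theorem aestronglyMeasurable_edgeMeasure_iff (hab : a ≠ b) (he : (e : Set Plane) = {a, b})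
    {f : Plane → ℝ} : AEStronglyMeasurable f (edgeMeasure e) ↔
      AEStronglyMeasurable (fun s : ℝ => f (AffineMap.lineMap a b s)) unitMeasure := by
  have h0 : ENNReal.ofReal (dist a b) ≠ 0 := by simpa using hab
  have h1 : AEStronglyMeasurable f (edgeMeasure e) ↔ AEStronglyMeasurable f
      (unitMeasure.map fun s : ℝ => AffineMap.lineMap (k := ℝ) a b s) := by
    rw [edgeMeasure_eq hab he]
    refine ⟨fun h => h.mono_ac ?_, fun h => h.smul_measure _⟩
    exact Measure.absolutelyContinuous_smul h0
  rw [h1, (measurableEmbedding_lineMap hab).aestronglyMeasurable_map_iff]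
  rfl

theorem memLp_edgeMeasure_iff (hab : a ≠ b) (he : (e : Set Plane) = {a, b}) {f : Plane → ℝ} :
    MemLp f 2 (edgeMeasure e) ↔
      MemLp (fun s : ℝ => f (AffineMap.lineMap a b s)) 2 unitMeasure := by
  have h0 : ENNReal.ofReal (dist a b) ^ (2⁻¹ : ℝ) ≠ 0 := by
    rw [Ne, ENNReal.rpow_eq_zero_iff]; simpa using hab
  have h1 : ENNReal.ofReal (dist a b) ^ (2⁻¹ : ℝ) ≠ ⊤ :=
    ENNReal.rpow_ne_top_of_nonneg (by norm_num) ENNReal.ofReal_ne_top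
  rw [MemLp, MemLp, eLpNorm_edgeMeasure hab he, aestronglyMeasurable_edgeMeasure_iff hab he,
    ENNReal.mul_lt_top_iff]
  have h2 : ENNReal.ofReal (dist a b) ^ (2⁻¹ : ℝ) < ⊤ := h1.lt_top
  constructor
  · rintro ⟨h, h' | h' | h'⟩
    exacts [⟨h, h'.2⟩, absurd h' h0, ⟨h, by simp [h']⟩]
  · rintro ⟨h, h'⟩; exact ⟨h, Or.inl ⟨h2, h'⟩⟩

theorem tendsto_eLpNorm_edgeMeasure_iff (hab : a ≠ b) (he : (e : Set Plane) = {a, b})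
    {f : ℕ → Plane → ℝ} :
    Tendsto (fun m => eLpNorm (f m) 2 (edgeMeasure e)) atTop (𝓝 0) ↔
      Tendsto (fun m => eLpNorm (fun s : ℝ => f m (AffineMap.lineMap a b s)) 2 unitMeasure)
        atTop (𝓝 0) := by
  have h0 : ENNReal.ofReal (dist a b) ^ (2⁻¹ : ℝ) ≠ 0 := by
    rw [Ne, ENNReal.rpow_eq_zero_iff]; simpa using hab
  have h1 : ENNReal.ofReal (dist a b) ^ (2⁻¹ : ℝ) ≠ ⊤ :=
    ENNReal.rpow_ne_top_of_nonneg (by norm_num) ENNReal.ofReal_ne_top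
  simp only [eLpNorm_edgeMeasure hab he]
  constructor
  · intro h
    have := ENNReal.Tendsto.const_mul h (Or.inr (ENNReal.inv_ne_top.2 h0))
    simpa [← mul_assoc, ENNReal.inv_mul_cancel h0 h1] using this
  · intro h
    simpa using ENNReal.Tendsto.const_mul h (Or.inr h1)

end Edge

/-! ### The trace inequality -/

theorem hasFDerivAt_bary (a b c x : Plane) : HasFDerivAt (bary a b c)
    (((cross (b - a) (c - a))⁻¹ * (b - c) 1) • (PiLp.proj 2 (fun _ : Fin 2 => ℝ) 0 : Plane →L[ℝ] ℝ) -
    ((cross (b - a) (c - a))⁻¹ * (b - c) 0) • (PiLp.proj 2 (fun _ : Fin 2 => ℝ) 1 : Plane →L[ℝ] ℝ))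
    x := by
  have : bary a b c = fun y => bary a b c 0 +
      (((cross (b - a) (c - a))⁻¹ * (b - c) 1) • (PiLp.proj 2 (fun _ : Fin 2 => ℝ) 0 : Plane →L[ℝ] ℝ) -
    ((cross (b - a) (c - a))⁻¹ * (b - c) 0) • (PiLp.proj 2 (fun _ : Fin 2 => ℝ) 1 : Plane →L[ℝ] ℝ)) y := by
    ext y
    have := bary_add_smul (a := a) (b := b) (c := c) 0 y 1
    rw [zero_add, one_smul, one_mul] at this
    rw [this]
    simp [cross]
    ring
  rw [this]
  exact (ContinuousLinearMap.hasFDerivAt _).const_add _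

theorem fderiv_bary (a b c x d : Plane) :
    fderiv ℝ (bary a b c) x d = cross d (b - c) / cross (b - a) (c - a) := by
  rw [(hasFDerivAt_bary a b c x).fderiv]
  simp [cross]
  ring

theorem contDiff_bary (a b c : Plane) : ContDiff ℝ ∞ (bary a b c) := by
  unfold bary cross
  fun_prop

theorem integrableOn_triangle {a b c : Plane} {E : Type*} [NormedAddCommGroup E] {f : Plane → E}
    (hf : Continuous f) : IntegrableOn f (interior (convexHull ℝ {a, b, c})) := by
  have hbdd : Bornology.IsBounded (convexHull ℝ {a, b, c}) :=
    (isBounded_convexHull).2 (Set.toFinite _).isBounded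
  exact (hf.continuousOn.integrableOn_compact (hbdd.isCompact_closure)).mono_set
      (interior_subset.trans subset_closure)

theorem memLp_triangle {a b c : Plane} {E : Type*} [NormedAddCommGroup E] {f : Plane → E}
    (hf : Continuous f) : MemLp f 2 (volume.restrict (interior (convexHull ℝ {a, b, c}))) :=
  (memLp_two_iff_integrable_sq_norm (integrableOn_triangle hf).1).2
    (integrableOn_triangle (hf.norm.pow 2))

theorem memLp_unit {E : Type*} [NormedAddCommGroup E] {f : ℝ → E} (hf : Continuous f) :
    MemLp f 2 unitMeasure :=
  (memLp_two_iff_integrable_sq_norm hf.aestronglyMeasurable.restrict).2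
    ((hf.norm.pow 2).integrableOn_Ioc)

theorem continuous_gradient {f : Plane → ℝ} (hf : ContDiff ℝ ∞ f) : Continuous (gradient f) := by
  unfold gradient
  exact (LinearIsometryEquiv.continuous _).comp (hf.continuous_fderiv (by simp))

theorem fderiv_eq_inner_gradient (f : Plane → ℝ) (x d : Plane) :
    fderiv ℝ f x d = inner ℝ (gradient f x) d := by
  simp [gradient]

/-- The trace inequality for smooth functions; the constant may depend on the triangle. -/
theorem exists_trace_le {a b c : Plane} (hD : cross (b - a) (c - a) ≠ 0) :
    ∃ C : ℝ, 0 ≤ C ∧ ∀ φ : Plane → ℝ, ContDiff ℝ ∞ φ →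
      ∫ s in (0 : ℝ)..1, φ (AffineMap.lineMap a b s) ^ 2 ≤
        C * ((∫ x in interior (convexHull ℝ {a, b, c}), φ x ^ 2) +
          ∫ x in interior (convexHull ℝ {a, b, c}), ‖gradient φ x‖ ^ 2) := by
  set T := interior (convexHull ℝ {a, b, c}) with hT
  set D := cross (b - a) (c - a) with hDdef
  have hb : cross (c - b) (a - b) ≠ 0 := by rwa [cross_rotate a b c]
  have hD' : cross (a - b) (c - b) ≠ 0 := by rw [cross_reverse]; exact neg_ne_zero.2 hD
  refine ⟨|D|⁻¹ * (4 + ‖c - a‖ ^ 2 + ‖c - b‖ ^ 2), by positivity, fun φ hφ => ?_⟩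
  have hφc := hφ.continuous
  have hgc := continuous_gradient hφ
  -- the two bubble-like weights vanish on one of the other two edges and sum to one on `[a, b]`
  have ha := integral_fderiv_triangle hD (f := fun x => φ x ^ 2 * bary a b c x)
    (((hφ.pow 2).mul (contDiff_bary a b c)).of_le (by exact_mod_cast le_top))
  have hbb := integral_fderiv_triangle hD' (f := fun x => φ x ^ 2 * bary b c a x)
    (((hφ.pow 2).mul (contDiff_bary b c a)).of_le (by exact_mod_cast le_top))
  have hset : ({b, a, c} : Set Plane) = {a, b, c} := Set.insert_comm b a {c}
  rw [hset, ← hT, cross_reverse, abs_neg, ← hDdef] at hbb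
  rw [← hT, ← hDdef] at ha
  simp only [bary_lineMap, bary_left, bary_right, bary_self hD, bary_self hb, mul_zero, mul_one,
    add_zero, intervalIntegral.integral_zero, zero_sub] at ha hbb
  have hl : ∀ x y : Plane, Continuous fun s : ℝ => AffineMap.lineMap (k := ℝ) x y s := fun x y =>
    AffineMap.lineMap_continuous
  have hrev : (∫ s in (0 : ℝ)..1, φ (AffineMap.lineMap b a s) ^ 2 * (1 - s)) =
      ∫ s in (0 : ℝ)..1, φ (AffineMap.lineMap a b s) ^ 2 * s := by
    have := intervalIntegral.integral_comp_sub_left (a := 0) (b := 1) (fun s : ℝ =>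
      φ (AffineMap.lineMap a b s) ^ 2 * s) 1
    simp only [sub_self, sub_zero, AffineMap.lineMap_apply_one_sub] at this
    exact this
  rw [hrev] at hbb
  have hsum : (∫ s in (0 : ℝ)..1, φ (AffineMap.lineMap a b s) ^ 2) =
      (∫ s in (0 : ℝ)..1, φ (AffineMap.lineMap a b s) ^ 2 * (1 - s)) +
        ∫ s in (0 : ℝ)..1, φ (AffineMap.lineMap a b s) ^ 2 * s := by
    have h1 := hφc.comp (hl a b)
    simp only [Function.comp_def] at h1
    rw [← intervalIntegral.integral_add
      (Continuous.intervalIntegrable (by fun_prop) _ _)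
      (Continuous.intervalIntegrable (by fun_prop) _ _)]
    refine intervalIntegral.integral_congr fun s _ => ?_
    ring
  have hbound : ∀ (p q r d : Plane) (x : Plane), 0 ≤ bary p q r x → bary p q r x ≤ 1 →
      fderiv ℝ (bary p q r) x d = -1 →
      -fderiv ℝ (fun x => φ x ^ 2 * bary p q r x) x d ≤
        φ x ^ 2 + (φ x ^ 2 + ‖d‖ ^ 2 * ‖gradient φ x‖ ^ 2) := by
    intro p q r d x h0 h1 h2
    have hd : DifferentiableAt ℝ φ x := hφ.differentiable (by simp) x
    have e1 : fderiv ℝ (fun x => φ x ^ 2) x d = 2 * φ x * fderiv ℝ φ x d := by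
      rw [fderiv_fun_pow _ hd]; simp [mul_assoc]
    rw [fderiv_fun_mul (by fun_prop) ((contDiff_bary p q r).differentiable (by simp) x)]
    simp only [add_apply, smul_apply, smul_eq_mul]
    rw [h2, e1, fderiv_eq_inner_gradient]
    have h3 := abs_le.1 (abs_real_inner_le_norm (gradient φ x) d)
    set t := bary p q r x
    set y := inner ℝ (gradient φ x) d
    have h4 : y ^ 2 ≤ ‖d‖ ^ 2 * ‖gradient φ x‖ ^ 2 := by
      rw [← mul_pow, mul_comm]; exact sq_le_sq' h3.1 h3.2
    have h5 : 0 ≤ (φ x + y) ^ 2 := sq_nonneg _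
    have h6 : -(t * (2 * φ x * y)) ≤ φ x ^ 2 + y ^ 2 := by
      nlinarith [mul_nonneg h0 (sq_nonneg (φ x + y)),
        mul_nonneg (sub_nonneg.2 h1) (add_nonneg (sq_nonneg (φ x)) (sq_nonneg y))]
    linarith
  have hk1 : ∀ x, fderiv ℝ (bary a b c) x (c - a) = -1 := fun x => by
    rw [fderiv_bary, div_eq_iff hD, hDdef]; simp [cross]; ring
  have hk2 : ∀ x, fderiv ℝ (bary b c a) x (c - b) = -1 := fun x => by
    rw [fderiv_bary, cross_rotate a b c, div_eq_iff hD, hDdef]; simp [cross]; ring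
  have hint1 : IntegrableOn (fun x => φ x ^ 2) T := integrableOn_triangle (hφc.pow 2)
  have hint2 : IntegrableOn (fun x => ‖gradient φ x‖ ^ 2) T :=
    integrableOn_triangle (hgc.norm.pow 2)
  have hmono : ∀ (p q r d : Plane), (∀ x ∈ T, 0 ≤ bary p q r x ∧ bary p q r x ≤ 1) →
      (∀ x, fderiv ℝ (bary p q r) x d = -1) →
      -∫ x in T, fderiv ℝ (fun x => φ x ^ 2 * bary p q r x) x d ≤
        (∫ x in T, φ x ^ 2) + ((∫ x in T, φ x ^ 2) + ‖d‖ ^ 2 * ∫ x in T, ‖gradient φ x‖ ^ 2) := by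
    intro p q r d h0 h1
    have hint3 : Integrable (fun x => φ x ^ 2 + ‖d‖ ^ 2 * ‖gradient φ x‖ ^ 2)
        (volume.restrict T) := Integrable.add hint1 (hint2.const_mul _)
    rw [← integral_neg, ← integral_const_mul, ← integral_add hint1 (hint2.const_mul _),
      ← integral_add (f := fun x => φ x ^ 2) (g := fun x => φ x ^ 2 + ‖d‖ ^ 2 * ‖gradient φ x‖ ^ 2)
        hint1 hint3]
    refine setIntegral_mono_on ?_ (Integrable.add hint1 hint3)
      isOpen_interior.measurableSet fun x hx => hbound p q r d x (h0 x hx).1 (h0 x hx).2 (h1 x)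
    refine (integrableOn_triangle ?_).neg
    exact ((((hφ.pow 2).mul (contDiff_bary p q r)).continuous_fderiv (by simp))).clm_apply
      continuous_const
  have hpos : ∀ x ∈ T, 0 < bary a b c x ∧ 0 < bary b c a x ∧ 0 < bary c a b x := by
    intro x hx
    rw [hT, interior_triangle hD] at hx
    exact hx
  have m1 := hmono a b c (c - a) (fun x hx => ⟨(hpos x hx).1.le, by
    have := bary_sum hD x; have := hpos x hx; linarith⟩) hk1
  have m2 := hmono b c a (c - b) (fun x hx => ⟨(hpos x hx).2.1.le, by
    have := bary_sum hD x; have := hpos x hx; linarith⟩) hk2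
  have hA : 0 ≤ ∫ x in T, φ x ^ 2 := integral_nonneg fun x => sq_nonneg _
  have hB : 0 ≤ ∫ x in T, ‖gradient φ x‖ ^ 2 := integral_nonneg fun x => sq_nonneg _
  rw [ha] at m1
  rw [hbb] at m2
  rw [hsum, mul_assoc, ← div_eq_inv_mul, le_div_iff₀ (abs_pos.2 hD)]
  have h7 := mul_nonneg (sq_nonneg ‖c - a‖) hA
  have h8 := mul_nonneg (sq_nonneg ‖c - b‖) hA
  nlinarith

/-! ### Density of smooth functions -/

section Mollify

variable {E : Type*} [NormedAddCommGroup E]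

theorem lintegral_comp_affine {δ : ℝ} (hδ : 0 < δ) (c : Plane) {h : Plane → ℝ≥0∞}
    (hh : Measurable h) : ∫⁻ x, h (δ • x + c) = ENNReal.ofReal (δ ^ 2)⁻¹ * ∫⁻ x, h x := by
  have h1 : ∫⁻ x, h (δ • x + c) = ∫⁻ x, h (x + c) ∂(Measure.map (δ • · : Plane → Plane) volume) :=
    (lintegral_map (hh.comp (measurable_add_const c)) (measurable_const_smul δ)).symm
  rw [h1, Measure.map_addHaar_smul volume hδ.ne', lintegral_smul_measure,
    lintegral_add_right_eq_self h c, smul_eq_mul, finrank_euclideanSpace_fin,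
    abs_of_nonneg (by positivity)]

theorem lintegral_comp_affine_le {δ : ℝ} (hδ : 1 / 2 ≤ δ) (c : Plane) {h : Plane → ℝ≥0∞}
    (hh : Measurable h) : ∫⁻ x, h (δ • x + c) ≤ 4 * ∫⁻ x, h x := by
  rw [lintegral_comp_affine (by linarith) c hh]
  gcongr
  rw [show (4 : ℝ≥0∞) = ENNReal.ofReal 4 by simp]
  refine ENNReal.ofReal_le_ofReal ?_
  rw [inv_le_comm₀ (by positivity) (by norm_num)]
  nlinarith

/-- Composition with affine maps close to the identity is close to the identity in `L²`. -/
theorem exists_eLpNorm_comp_affine_sub_le [NormedSpace ℝ E] {F : Plane → E}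
    (hFm : StronglyMeasurable F)
    (hF : MemLp F 2 volume) {T : Set Plane} (hTm : MeasurableSet T) (hT : volume T ≠ ⊤)
    {η : ℝ≥0∞} (hη : η ≠ 0) :
    ∃ τ > 0, ∀ δ : ℝ, 1 / 2 ≤ δ → ∀ c : Plane, (∀ x ∈ T, dist (δ • x + c) x < τ) →
      eLpNorm (fun x => F (δ • x + c) - F x) 2 (volume.restrict T) ≤ η := by
  rcases eq_or_ne η ⊤ with rfl | hη'
  · exact ⟨1, one_pos, fun _ _ _ _ => le_top⟩
  have h4 : η / 4 ≠ 0 := by simp [ENNReal.div_eq_zero_iff, hη]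
  have h4' : η / 4 ≠ ⊤ := ENNReal.div_ne_top hη' (by norm_num)
  -- for a compactly supported continuous function the claim is uniform continuity; the factor `2`
  -- in `n1` is the square root of the Jacobian bound `δ⁻² ≤ 4`
  obtain ⟨g, hgs, hFg, hgc, hg⟩ := hF.exists_hasCompactSupport_eLpNorm_sub_le (by norm_num) h4
  set K : ℝ := (volume T ^ (2⁻¹ : ℝ)).toReal with hK
  have hKtop : volume T ^ (2⁻¹ : ℝ) ≠ ⊤ := ENNReal.rpow_ne_top_of_nonneg (by norm_num) hT
  set ε : ℝ := (η / 4).toReal / (K + 1) with hε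
  have hK0 : 0 ≤ K := ENNReal.toReal_nonneg
  have hε0 : 0 < ε := div_pos (ENNReal.toReal_pos h4 h4') (by linarith)
  obtain ⟨τ, hτ, hu⟩ := Metric.uniformContinuous_iff.1
    (hgs.uniformContinuous_of_continuous hgc) ε hε0
  refine ⟨τ, hτ, fun δ hδ c hd => ?_⟩
  have e : (fun x => F (δ • x + c) - F x) = (fun x => F (δ • x + c) - g (δ • x + c)) +
      ((fun x => g (δ • x + c) - g x) + fun x => g x - F x) := by
    ext x; simp
  have hgm : StronglyMeasurable g := hgc.stronglyMeasurable
  have haff : Measurable fun x : Plane => δ • x + c := by fun_prop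
  have n1 : eLpNorm (fun x => F (δ • x + c) - g (δ • x + c)) 2 (volume.restrict T) ≤
      2 * (η / 4) := by
    refine (eLpNorm_mono_measure _ Measure.restrict_le_self).trans ?_
    refine (ENNReal.pow_le_pow_left_iff (n := 2) (by norm_num)).1 ?_
    rw [eLpNorm_two_sq]
    refine (lintegral_comp_affine_le hδ c
      (h := fun x => ‖F x - g x‖ₑ ^ 2) ((hFm.sub hgm).enorm.pow_const 2)).trans ?_
    rw [← eLpNorm_two_sq, mul_pow]
    have : (2 : ℝ≥0∞) ^ 2 = 4 := by norm_num
    rw [this]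
    gcongr
    exact hFg
  have n2 : eLpNorm (fun x => g (δ • x + c) - g x) 2 (volume.restrict T) ≤ η / 4 := by
    have := eLpNorm_le_of_ae_bound (p := 2) (μ := volume.restrict T)
      (f := fun x => g (δ • x + c) - g x) (C := ε) (by
        refine (ae_restrict_iff' hTm).2 (ae_of_all _ fun x hx => ?_)
        rw [← dist_eq_norm]
        exact (hu (hd x hx)).le)
    refine this.trans ?_
    rw [Measure.restrict_apply_univ]
    simp only [ENNReal.toReal_ofNat]
    rw [← ENNReal.ofReal_toReal hKtop, ← hK, ← ENNReal.ofReal_mul hK0,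
      ← ENNReal.ofReal_toReal h4']
    refine ENNReal.ofReal_le_ofReal ?_
    rw [hε, mul_div_assoc', div_le_iff₀ (by linarith)]
    nlinarith [ENNReal.toReal_nonneg (a := η / 4)]
  have n3 : eLpNorm (fun x => g x - F x) 2 (volume.restrict T) ≤ η / 4 := by
    refine (eLpNorm_mono_measure _ Measure.restrict_le_self).trans ?_
    rw [← eLpNorm_neg]
    have : (-fun x => g x - F x) = F - g := by funext x; simp
    rwa [this]
  rw [e]
  refine (eLpNorm_add_le (((hFm.sub hgm).comp_measurable haff).aestronglyMeasurable)
    (((hgm.comp_measurable haff).sub hgm).add (hgm.sub hFm)).aestronglyMeasurable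
    (by norm_num)).trans ?_
  refine (add_le_add n1 ((eLpNorm_add_le ((hgm.comp_measurable haff).sub hgm).aestronglyMeasurable
    (hgm.sub hFm).aestronglyMeasurable (by norm_num)).trans (add_le_add n2 n3))).trans ?_
  have : 2 * (η / 4) + (η / 4 + η / 4) = 4 * (η / 4) := by ring
  rw [this, ENNReal.mul_div_cancel (by norm_num) (by norm_num)]

/-- Jensen's inequality: an average of functions that are close to `F` in `L²` is close to `F`. -/
theorem eLpNorm_integral_sub_le [NormedSpace ℝ E] [CompleteSpace E] {F : Plane → E}
    (hFm : StronglyMeasurable F)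
    {μ ν : Measure Plane} [IsProbabilityMeasure ν] [SFinite μ] {S : Plane → Plane}
    (hS : Measurable S)
    (hint : ∀ x, Integrable (fun y => F (S x - y)) ν) {η : ℝ≥0∞}
    (h : ∀ᵐ y ∂ν, eLpNorm (fun x => F (S x - y) - F x) 2 μ ≤ η) :
    eLpNorm (fun x => (∫ y, F (S x - y) ∂ν) - F x) 2 μ ≤ η := by
  have key : eLpNorm (fun x => (∫ y, F (S x - y) ∂ν) - F x) 2 μ ^ 2 ≤ η ^ 2 := by
    have hm : StronglyMeasurable fun p : Plane × Plane => F (S p.1 - p.2) - F p.1 :=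
      (hFm.comp_measurable ((hS.comp measurable_fst).sub measurable_snd)).sub
        (hFm.comp_measurable measurable_fst)
    rw [eLpNorm_two_sq]
    calc ∫⁻ x, ‖(∫ y, F (S x - y) ∂ν) - F x‖ₑ ^ 2 ∂μ
        ≤ ∫⁻ x, ∫⁻ y, ‖F (S x - y) - F x‖ₑ ^ 2 ∂ν ∂μ := by
          refine lintegral_mono fun x => ?_
          have e1 : (∫ y, F (S x - y) ∂ν) - F x = ∫ y, (F (S x - y) - F x) ∂ν := by
            rw [integral_sub (hint x) (integrable_const _)]; simp
          rw [e1, ← eLpNorm_two_sq]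
          gcongr
          refine (enorm_integral_le_lintegral_enorm _).trans ?_
          rw [← eLpNorm_one_eq_lintegral_enorm]
          refine eLpNorm_le_eLpNorm_of_exponent_le (by norm_num) ?_
          exact (hm.comp_measurable (measurable_prodMk_left (x := x))).aestronglyMeasurable
      _ = ∫⁻ y, ∫⁻ x, ‖F (S x - y) - F x‖ₑ ^ 2 ∂μ ∂ν := by
          refine lintegral_lintegral_swap ?_
          exact (hm.enorm.pow_const 2).aemeasurable
      _ ≤ ∫⁻ y, η ^ 2 ∂ν := by
          refine lintegral_mono_ae ?_
          filter_upwards [h] with y hy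
          rw [← eLpNorm_two_sq]
          gcongr
      _ = η ^ 2 := by simp
  exact (ENNReal.pow_le_pow_left_iff (by norm_num)).1 key

end Mollify

theorem HasWeakGrad.congr {U : Set Plane} {v v' : Plane → ℝ} {G G' : Plane → Plane}
    (h : HasWeakGrad U v G) (hv : v =ᵐ[volume.restrict U] v') (hG : G =ᵐ[volume.restrict U] G') :
    HasWeakGrad U v' G' := by
  refine ⟨h.1.ae_eq hG, fun φ hφ => ?_⟩
  have h1 : ∫ x in U, v' x • gradient φ x = ∫ x in U, v x • gradient φ x :=
    integral_congr_ae (by filter_upwards [hv] with x hx; rw [hx])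
  have h2 : ∫ x in U, φ x • G' x = ∫ x in U, φ x • G x :=
    integral_congr_ae (by filter_upwards [hG] with x hx; rw [hx])
  rw [h1, h2, h.2 φ hφ]

/-- Mollification commutes with the weak gradient away from the boundary. -/
theorem fderiv_mollify {U : Set Plane} (hU : MeasurableSet U) {v : Plane → ℝ} {G : Plane → Plane}
    (hv : MemLp v 2 (volume.restrict U)) (h : HasWeakGrad U v G) (β : ContDiffBump (0 : Plane))
    {z : Plane} (hz : Metric.closedBall z β.rOut ⊆ U) (d : Plane) :
    fderiv ℝ (fun z => ∫ y, β.normed volume y • U.indicator v (z - y)) z d =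
      inner ℝ (∫ y, β.normed volume y • U.indicator G (z - y)) d := by
  set ρ := β.normed (volume : Measure Plane) with hρ
  have hρs : HasCompactSupport ρ := β.hasCompactSupport_normed
  have hρc : ContDiff ℝ ∞ ρ := β.contDiff_normed
  have hvi : MemLp (U.indicator v) 2 volume := (memLp_indicator_iff_restrict hU).2 hv
  have hGi : MemLp (U.indicator G) 2 volume := (memLp_indicator_iff_restrict hU).2 h.1
  have hvl : LocallyIntegrable (U.indicator v) volume := hvi.locallyIntegrable (by norm_num)
  have hd := hρs.hasFDerivAt_convolution_left (ContinuousLinearMap.lsmul ℝ ℝ)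
    (hρc.of_le (by exact_mod_cast le_top)) hvl z
  have hfun : (fun z => ∫ y, ρ y • U.indicator v (z - y)) =
    convolution ρ (U.indicator v) (ContinuousLinearMap.lsmul ℝ ℝ) volume := rfl
  rw [hfun, hd.fderiv]
  have hex := ((hρs.fderiv (𝕜 := ℝ)).convolutionExists_left
    ((ContinuousLinearMap.lsmul ℝ ℝ).precompL Plane) (hρc.continuous_fderiv (by simp)) hvl) z
  rw [convolution_eq_swap, ContinuousLinearMap.integral_apply (by
    exact hex.integrable_swap)]
  -- translates of the reflected kernel are test functions in `U`
  set τ : Plane → ℝ := fun u => ρ (z - u) with hτ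
  have hτc : ContDiff ℝ ∞ τ := hρc.comp (contDiff_const.sub contDiff_id)
  have hτs : Function.support τ ⊆ Metric.closedBall z β.rOut := by
    intro u hu
    have : z - u ∈ Function.support ρ := hu
    rw [hρ, β.support_normed_eq, Metric.mem_ball, dist_zero_right, ← dist_eq_norm, dist_comm] at this
    exact this.le
  have hτt : IsTest U τ :=
    ⟨hτc, HasCompactSupport.of_support_subset_isCompact (isCompact_closedBall _ _) hτs,
      (closure_minimal hτs Metric.isClosed_closedBall).trans hz⟩
  have hτd : ∀ u, fderiv ℝ ρ (z - u) d = -inner ℝ d (gradient τ u) := by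
    intro u
    have h1 : HasFDerivAt τ ((fderiv ℝ ρ (z - u)).comp (-ContinuousLinearMap.id ℝ Plane)) u :=
      (hρc.differentiable (by simp) (z - u)).hasFDerivAt.comp u
        ((hasFDerivAt_id u).const_sub z)
    rw [real_inner_comm, ← fderiv_eq_inner_gradient, h1.fderiv]
    simp
  have hτm : MemLp τ 2 (volume.restrict U) :=
    (hτc.continuous.memLp_of_hasCompactSupport hτt.2.1).restrict U
  have hτg : MemLp (gradient τ) 2 (volume.restrict U) := by
    have hs : HasCompactSupport (gradient τ) :=
      (hτt.2.1.fderiv (𝕜 := ℝ)).comp_left (g := fun L => (InnerProductSpace.toDual ℝ Plane).symm L)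
        (by simp)
    exact ((continuous_gradient hτc).memLp_of_hasCompactSupport hs).restrict U
  have e1 : ∀ t, (((ContinuousLinearMap.lsmul ℝ ℝ).precompL Plane) (fderiv ℝ ρ (z - t))
      (U.indicator v t)) d = U.indicator (fun t => -inner ℝ d (v t • gradient τ t)) t := by
    intro t
    rw [ContinuousLinearMap.precompL_apply, ContinuousLinearMap.lsmul_apply, hτd]
    by_cases ht : t ∈ U
    · simp [ht, inner_smul_right, mul_comm]
    · simp [ht]
  have e2 : (∫ y, ρ y • U.indicator G (z - y)) = ∫ u in U, τ u • G u := by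
    rw [← integral_sub_left_eq_self (fun y => ρ y • U.indicator G (z - y)) volume z,
      ← integral_indicator hU]
    congr 1
    ext1 t
    by_cases ht : t ∈ U <;> simp [ht, hτ]
  have hi1 : Integrable (fun t => v t • gradient τ t) (volume.restrict U) :=
    memLp_one_iff_integrable.1 (hτg.smul hv)
  simp only [e1]
  rw [e2, integral_indicator hU, integral_neg, integral_inner hi1, h.2 τ hτt, inner_neg_right,
    neg_neg, real_inner_comm]

theorem contDiff_mollify {V : Plane → ℝ} (hV : MemLp V 2 volume) (β : ContDiffBump (0 : Plane)) :
    ContDiff ℝ ∞ fun z => ∫ y, β.normed volume y • V (z - y) :=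
  β.hasCompactSupport_normed.contDiff_convolution_left (ContinuousLinearMap.lsmul ℝ ℝ)
    (n := ⊤) β.contDiff_normed (hV.locallyIntegrable (by norm_num))

/-- Averages of dilated functions converge in `L²` on bounded sets. -/
theorem tendsto_eLpNorm_mollify {E : Type*} [NormedAddCommGroup E] [NormedSpace ℝ E]
    [CompleteSpace E] {F : Plane → E} (hFm : StronglyMeasurable F)
    (hF : MemLp F 2 volume) {T : Set Plane} (hTm : MeasurableSet T) (hT : Bornology.IsBounded T)
    (p : Plane) {t : ℕ → ℝ} (ht0 : ∀ m, 0 < t m) (ht1 : ∀ m, t m ≤ 1 / 2)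
    (ht : Tendsto t atTop (𝓝 0)) {r : ℝ} (β : ℕ → ContDiffBump (0 : Plane))
    (hβ : ∀ m, (β m).rOut = t m * r) :
    Tendsto (fun m => eLpNorm (fun x => (∫ y, (β m).normed volume y •
      F ((1 - t m) • x + t m • p - y)) - F x) 2 (volume.restrict T)) atTop (𝓝 0) := by
  rw [ENNReal.tendsto_nhds_zero]
  intro η hη
  obtain ⟨τ, hτ, h⟩ := exists_eLpNorm_comp_affine_sub_le hFm hF hTm hT.measure_lt_top.ne hη.ne'
  obtain ⟨R, hR⟩ := hT.subset_ball p
  have h0 : Tendsto (fun m => t m * (R + r)) atTop (𝓝 0) := by simpa using ht.mul_const (R + r)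
  filter_upwards [h0.eventually_lt_const hτ] with m hm
  let ν : Measure Plane := volume.withDensity fun y => ENNReal.ofReal ((β m).normed volume y)
  have hρm : Measurable ((β m).normed (volume : Measure Plane)) := (β m).continuous_normed.measurable
  have hν : IsProbabilityMeasure ν := by
    constructor
    rw [withDensity_apply _ MeasurableSet.univ, Measure.restrict_univ,
      ← ofReal_integral_eq_lintegral_ofReal (β m).integrable_normed
        (ae_of_all _ fun x => (β m).nonneg_normed x), (β m).integral_normed]
    simp
  have hν' : ν = volume.withDensity fun y => ((Real.toNNReal ((β m).normed volume y) : ℝ≥0) : ℝ≥0∞) :=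
    rfl
  have hsm : ∀ y, Real.toNNReal ((β m).normed volume y) • (1 : ℝ) = (β m).normed volume y := by
    intro y; simp [NNReal.smul_def, (β m).nonneg_normed y]
  have hsm' : ∀ y (v : E), Real.toNNReal ((β m).normed volume y) • v = (β m).normed volume y • v := by
    intro y v; simp [NNReal.smul_def, (β m).nonneg_normed y]
  have hex : ∀ z, Integrable (fun y => (β m).normed volume y • F (z - y)) volume := fun z =>
    (β m).hasCompactSupport_normed.convolutionExists_left (ContinuousLinearMap.lsmul ℝ ℝ)
      (β m).continuous_normed (hF.locallyIntegrable (by norm_num)) z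
  have key := eLpNorm_integral_sub_le (ν := ν) (μ := volume.restrict T) (η := η) hFm
    (S := fun x => (1 - t m) • x + t m • p) (by fun_prop) (fun x => by
      rw [hν', integrable_withDensity_iff_integrable_smul hρm.real_toNNReal]
      simp only [hsm']
      exact hex _) (by
      rw [hν', ae_withDensity_iff hρm.real_toNNReal.coe_nnreal_ennreal]
      refine ae_of_all _ fun y hy => ?_
      have hy' : y ∈ Function.support ((β m).normed (volume : Measure Plane)) := by
        intro h0; simp [h0] at hy
      rw [(β m).support_normed_eq, Metric.mem_ball, dist_zero_right, hβ] at hy'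
      have := h (1 - t m) (by linarith [ht1 m]) (t m • p - y) (fun x hx => by
        have e : (1 - t m) • x + (t m • p - y) - x = -(t m • (x - p)) - y := by module
        rw [dist_eq_norm, e]
        have h1 : ‖x - p‖ < R := by rw [← dist_eq_norm]; exact hR hx
        calc ‖-(t m • (x - p)) - y‖ ≤ ‖-(t m • (x - p))‖ + ‖y‖ := norm_sub_le _ _
          _ ≤ t m * R + t m * r := by
              rw [norm_neg, norm_smul, Real.norm_of_nonneg (ht0 m).le]
              gcongr
              exact (ht0 m).le
          _ < τ := by rwa [← mul_add])
      simpa only [add_sub_assoc] using this)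
  refine le_trans (le_of_eq ?_) key
  congr 1
  ext1 x
  rw [hν', integral_withDensity_eq_integral_smul hρm.real_toNNReal]
  simp only [hsm']

/-- Functions in `H¹` of a bounded convex open set are limits of functions that are smooth on the
whole plane: contract towards an interior point, then mollify. -/
theorem exists_smooth_approx {T : Set Plane} (hTo : IsOpen T) (hTc : Convex ℝ T)
    (hTb : Bornology.IsBounded T) (hTn : T.Nonempty) {w : Plane → ℝ} {G : Plane → Plane}
    (hw : MemLp w 2 (volume.restrict T)) (hG : HasWeakGrad T w G) :
    ∃ φ : ℕ → Plane → ℝ, (∀ m, ContDiff ℝ ∞ (φ m)) ∧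
      Tendsto (fun m => eLpNorm (fun x => φ m x - w x) 2 (volume.restrict T)) atTop (𝓝 0) ∧
      Tendsto (fun m => eLpNorm (fun x => gradient (φ m) x - G x) 2 (volume.restrict T))
        atTop (𝓝 0) := by
  have hTm := hTo.measurableSet
  obtain ⟨p, hp⟩ := hTn
  obtain ⟨r, hr, hrT⟩ := Metric.nhds_basis_closedBall.mem_iff.1 (hTo.mem_nhds hp)
  let t : ℕ → ℝ := fun m => 1 / ((m : ℝ) + 2)
  have ht0 : ∀ m, 0 < t m := fun m => by positivity
  have ht1 : ∀ m, t m ≤ 1 / 2 := fun m => by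
    simp only [t]; gcongr; linarith [Nat.cast_nonneg (α := ℝ) m]
  have ht : Tendsto t atTop (𝓝 0) := by
    have := (tendsto_one_div_add_atTop_nhds_zero_nat (𝕜 := ℝ)).comp (tendsto_add_atTop_nat 1)
    refine this.congr fun m => ?_
    simp only [Function.comp, t]; push_cast; ring_nf
  let β : ℕ → ContDiffBump (0 : Plane) := fun m =>
    ⟨t m * r / 2, t m * r, by have := ht0 m; positivity, by
      have := mul_pos (ht0 m) hr; linarith⟩
  set w0 := hw.1.mk w with hw0
  set G0 := hG.1.1.mk G with hG0
  have hww : w =ᵐ[volume.restrict T] w0 := hw.1.ae_eq_mk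
  have hGG : G =ᵐ[volume.restrict T] G0 := hG.1.1.ae_eq_mk
  have hg0 := hG.congr hww hGG
  have hW : MemLp (T.indicator w0) 2 volume :=
    (memLp_indicator_iff_restrict hTm).2 (hw.ae_eq hww)
  have hΓ : MemLp (T.indicator G0) 2 volume := (memLp_indicator_iff_restrict hTm).2 hg0.1
  have hWm : StronglyMeasurable (T.indicator w0) := hw.1.stronglyMeasurable_mk.indicator hTm
  have hΓm : StronglyMeasurable (T.indicator G0) := hG.1.1.stronglyMeasurable_mk.indicator hTm
  have c1 := tendsto_eLpNorm_mollify hWm hW hTm hTb p ht0 ht1 ht β (fun m => rfl)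
  have c2 := tendsto_eLpNorm_mollify hΓm hΓ hTm hTb p ht0 ht1 ht β (fun m => rfl)
  let ψ : ℕ → Plane → ℝ := fun m z => ∫ y, (β m).normed volume y • T.indicator w0 (z - y)
  have hψ : ∀ m, ContDiff ℝ ∞ (ψ m) := fun m => contDiff_mollify hW (β m)
  -- the homothety with centre `p` and ratio `1 - t m` moves `T` away from its boundary by the
  -- mollification radius `t m * r`: a point `y` of the ball is a convex combination of `x` and a point
  -- at distance at most `r` from `p`
  have hcl : ∀ m, ∀ x ∈ T, Metric.closedBall ((1 - t m) • x + t m • p) (β m).rOut ⊆ T := by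
    intro m x hx y hy
    have hy' : ‖y - ((1 - t m) • x + t m • p)‖ ≤ t m * r := by
      rw [← dist_eq_norm]; exact hy
    have hq : p + (t m)⁻¹ • (y - ((1 - t m) • x + t m • p)) ∈ T := by
      apply hrT
      rw [Metric.mem_closedBall, dist_self_add_left, norm_smul, norm_inv,
        Real.norm_of_nonneg (ht0 m).le, inv_mul_le_iff₀ (ht0 m)]
      exact hy'
    have := hTc hx hq (by linarith [ht1 m] : 0 ≤ 1 - t m) (ht0 m).le (by ring)
    convert this using 1
    rw [smul_add, smul_smul, mul_inv_cancel₀ (ht0 m).ne']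
    module
  have hgrad : ∀ m, ∀ x ∈ T, gradient (fun x => ψ m ((1 - t m) • x + t m • p)) x =
      (1 - t m) • ∫ y, (β m).normed volume y • T.indicator G0 ((1 - t m) • x + t m • p - y) := by
    intro m x hx
    refine ext_inner_right ℝ fun d => ?_
    rw [← fderiv_eq_inner_gradient, inner_smul_left,
      ← fderiv_mollify hTm (hw.ae_eq hww) hg0 (β m) (hcl m x hx) d]
    have h1 : HasFDerivAt (fun x : Plane => (1 - t m) • x + t m • p)
        ((1 - t m) • ContinuousLinearMap.id ℝ Plane) x :=
      ((hasFDerivAt_id x).const_smul (1 - t m)).add_const _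
    have h2 : HasFDerivAt (fun x => ψ m ((1 - t m) • x + t m • p)) _ x :=
      HasFDerivAt.comp (g := ψ m) (f := fun x : Plane => (1 - t m) • x + t m • p) x
        ((hψ m).differentiable (by simp) ((1 - t m) • x + t m • p)).hasFDerivAt h1
    rw [h2.fderiv]
    simp [ψ]
  refine ⟨fun m x => ψ m ((1 - t m) • x + t m • p), fun m => (hψ m).comp (by fun_prop), ?_, ?_⟩
  · refine c1.congr fun m => eLpNorm_congr_ae ?_
    filter_upwards [hww, self_mem_ae_restrict hTm] with x hx hxT
    rw [hx, indicator_of_mem hxT]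
  · have c3 : Tendsto (fun m => eLpNorm (fun x => t m • T.indicator G0 x) 2 (volume.restrict T))
        atTop (𝓝 0) := by
      have h1 : ∀ m, eLpNorm (fun x => t m • T.indicator G0 x) 2 (volume.restrict T) =
          ENNReal.ofReal (t m) * eLpNorm (T.indicator G0) 2 (volume.restrict T) := by
        intro m
        have := eLpNorm_const_smul (t m) (T.indicator G0) 2 (volume.restrict T)
        rw [← ofReal_norm, Real.norm_of_nonneg (ht0 m).le] at this
        exact this
      simp only [h1]
      have h2 := ENNReal.Tendsto.mul_const (ENNReal.tendsto_ofReal ht)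
        (Or.inr (hΓ.restrict T).2.ne)
      simpa using h2
    have c4 := c2.add c3
    rw [add_zero] at c4
    refine tendsto_of_tendsto_of_tendsto_of_le_of_le tendsto_const_nhds c4 (fun _ => zero_le)
      fun m => ?_
    set A : Plane → Plane := fun x => ∫ y, (β m).normed volume y •
      T.indicator G0 ((1 - t m) • x + t m • p - y) with hA
    have hAc : Continuous A := by
      have h1 : Continuous fun z : Plane => ∫ y, (β m).normed volume y • T.indicator G0 (z - y) :=
        HasCompactSupport.continuous_convolution_left (μ := volume)
          (ContinuousLinearMap.lsmul ℝ ℝ) (β m).hasCompactSupport_normed (β m).continuous_normed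
          (hΓ.locallyIntegrable (by norm_num))
      exact h1.comp (by fun_prop : Continuous fun x : Plane =>
        (1 - t m) • x + t m • p)
    have e : (fun x => gradient (fun x => ψ m ((1 - t m) • x + t m • p)) x - G x)
        =ᵐ[volume.restrict T] (fun x => (1 - t m) • (A x - T.indicator G0 x)) -
          fun x => t m • T.indicator G0 x := by
      filter_upwards [hGG, self_mem_ae_restrict hTm] with x hx hxT
      rw [hgrad m x hxT, hx, Pi.sub_apply, indicator_of_mem hxT]
      module
    have hsm : AEStronglyMeasurable (fun x => A x - T.indicator G0 x) (volume.restrict T) :=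
      hAc.aestronglyMeasurable.sub hΓm.aestronglyMeasurable
    have hsm1 : AEStronglyMeasurable (fun x => (1 - t m) • (A x - T.indicator G0 x))
        (volume.restrict T) := hsm.const_smul (1 - t m)
    have hsm2 : AEStronglyMeasurable (fun x => t m • T.indicator G0 x) (volume.restrict T) :=
      (hΓm.const_smul (t m)).aestronglyMeasurable
    rw [eLpNorm_congr_ae e]
    refine (eLpNorm_sub_le hsm1 hsm2 (by norm_num)).trans ?_
    gcongr
    refine eLpNorm_mono fun x => ?_
    rw [norm_smul, Real.norm_of_nonneg (by linarith [ht1 m])]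
    exact mul_le_of_le_one_left (norm_nonneg _) (by linarith [ht0 m])

/-! ### Weak gradients -/

theorem hasWeakGrad_weakGrad {U : Set Plane} {v : Plane → ℝ} (h : ∃ G, HasWeakGrad U v G) :
    HasWeakGrad U v (weakGrad U v) := by
  rw [weakGrad, dif_pos h]; exact h.choose_spec

theorem setIntegral_eq_of_tsupport {E : Type*} [NormedAddCommGroup E] [NormedSpace ℝ E]
    {U : Set Plane} {g : Plane → ℝ} {f : Plane → E} (hg : tsupport g ⊆ U) :
    ∫ x in U, g x • f x = ∫ x, g x • f x :=
  setIntegral_eq_integral_of_forall_compl_eq_zero fun x hx => by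
    rw [image_eq_zero_of_notMem_tsupport fun h => hx (hg h), zero_smul]

theorem ae_eq_zero_of_forall_test {E : Type*} [NormedAddCommGroup E] [NormedSpace ℝ E]
    [CompleteSpace E] {U : Set Plane} (hU : IsOpen U) {f : Plane → E}
    (hf : MemLp f 2 (volume.restrict U))
    (h : ∀ φ, IsTest U φ → ∫ x in U, φ x • f x = 0) : f =ᵐ[volume.restrict U] 0 := by
  have := hU.ae_eq_zero_of_integral_contDiff_smul_eq_zero (μ := volume.restrict U) (f := f)
    ((hf.locallyIntegrable (by norm_num)).locallyIntegrableOn U)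
    (fun g h1 h2 h3 => h g ⟨h1, h2, h3⟩)
  filter_upwards [this, self_mem_ae_restrict hU.measurableSet] with x hx hxU using hx hxU

theorem IsTest.memLp {U : Set Plane} {φ : Plane → ℝ} (h : IsTest U φ) (μ : Measure Plane)
    [IsLocallyFiniteMeasure μ] : MemLp φ 2 μ :=
  h.1.continuous.memLp_of_hasCompactSupport h.2.1

theorem HasWeakGrad.unique {U : Set Plane} (hU : IsOpen U) {v : Plane → ℝ} {G G' : Plane → Plane}
    (h : HasWeakGrad U v G) (h' : HasWeakGrad U v G') : G =ᵐ[volume.restrict U] G' := by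
  have := ae_eq_zero_of_forall_test hU (h.1.sub h'.1) fun φ hφ => by
    have hi : ∀ {G : Plane → Plane}, MemLp G 2 (volume.restrict U) →
        Integrable (fun x => φ x • G x) (volume.restrict U) := fun hG =>
      memLp_one_iff_integrable.1 (hG.smul (hφ.memLp _))
    simp only [Pi.sub_apply, smul_sub]
    rw [integral_sub (hi h.1) (hi h'.1), sub_eq_zero, ← neg_inj, ← h.2 φ hφ, h'.2 φ hφ]
  filter_upwards [this] with x hx
  exact sub_eq_zero.1 hx

theorem IsTest.mono {U V : Set Plane} (hUV : U ⊆ V) {φ : Plane → ℝ} (h : IsTest U φ) :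
    IsTest V φ := ⟨h.1, h.2.1, h.2.2.trans hUV⟩

theorem tsupport_gradient_subset (φ : Plane → ℝ) : tsupport (gradient φ) ⊆ tsupport φ := by
  refine closure_minimal (fun x hx => ?_) (isClosed_tsupport φ)
  refine support_fderiv_subset ℝ (f := φ) ?_
  intro h
  apply hx
  simp [gradient, h]

theorem HasWeakGrad.mono {U V : Set Plane} (hUV : U ⊆ V) {v : Plane → ℝ} {G : Plane → Plane}
    (h : HasWeakGrad V v G) : HasWeakGrad U v G := by
  refine ⟨h.1.mono_measure (Measure.restrict_mono hUV le_rfl), fun φ hφ => ?_⟩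
  have := h.2 φ (hφ.mono hUV)
  have e1 : ∀ {W : Set Plane}, tsupport φ ⊆ W →
      ∫ x in W, v x • gradient φ x = ∫ x, v x • gradient φ x := fun {W} hW =>
    setIntegral_eq_integral_of_forall_compl_eq_zero fun x hx => by
      rw [image_eq_zero_of_notMem_tsupport (f := gradient φ)
        fun h => hx (hW (tsupport_gradient_subset φ h)), smul_zero]
  rw [e1 (hφ.2.2.trans hUV), setIntegral_eq_of_tsupport (hφ.2.2.trans hUV)] at this
  rw [e1 hφ.2.2, setIntegral_eq_of_tsupport hφ.2.2, this]

theorem MemH1.mono {U V : Set Plane} (hUV : U ⊆ V) {v : Plane → ℝ} (h : MemH1 V v) :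
    MemH1 U v := by
  obtain ⟨h1, G, hG⟩ := h
  exact ⟨h1.mono_measure (Measure.restrict_mono hUV le_rfl), G, hG.mono hUV⟩

/-- The weak gradient on a smaller open set is the restriction of the weak gradient. -/
theorem weakGrad_ae_eq {U V : Set Plane} (hU : IsOpen U) (hUV : U ⊆ V) {v : Plane → ℝ}
    (h : MemH1 V v) : weakGrad U v =ᵐ[volume.restrict U] weakGrad V v :=
  (hasWeakGrad_weakGrad (h.mono hUV).2).unique hU ((hasWeakGrad_weakGrad h.2).mono hUV)

theorem continuous_rot : Continuous rot := by
  unfold rot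
  refine (PiLp.continuous_toLp 2 _).comp (continuous_pi fun i => ?_)
  fin_cases i <;> simp <;> fun_prop

theorem norm_rot (x : Plane) : ‖rot x‖ = ‖x‖ := by
  rw [EuclideanSpace.norm_eq, EuclideanSpace.norm_eq]
  simp [rot, Fin.sum_univ_two, add_comm]

theorem memLp_rot {μ : Measure Plane} {G : Plane → Plane} (hG : MemLp G 2 μ) :
    MemLp (fun x => rot (G x)) 2 μ :=
  hG.mono (continuous_rot.comp_aestronglyMeasurable hG.1) (ae_of_all _ fun _ => (norm_rot _).le)

theorem inner_rot_antisymm (u v : Plane) : inner ℝ u (rot v) = -inner ℝ v (rot u) := by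
  rw [inner_rot, inner_rot, cross_swap]

/-! ### Traces on the edges of a triangle -/

/-- The smooth functions `φ m` converge to `v` in `H¹(U)`. -/
def H1Limit (U : Set Plane) (φ : ℕ → Plane → ℝ) (v : Plane → ℝ) : Prop :=
  (∀ m, ContDiff ℝ ∞ (φ m)) ∧
    Tendsto (fun m => eLpNorm (fun x => φ m x - v x) 2 (volume.restrict U)) atTop (𝓝 0) ∧
    Tendsto (fun m => eLpNorm (fun x => gradient (φ m) x - weakGrad U v x) 2
      (volume.restrict U)) atTop (𝓝 0)

theorem HasTrace.exists_h1Limit {s e : Finset Plane} {v g : Plane → ℝ} (h : HasTrace s e v g) :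
    ∃ φ, H1Limit (interior (hull s)) φ v ∧
      Tendsto (fun m => eLpNorm (fun x => φ m x - g x) 2 (edgeMeasure e)) atTop (𝓝 0) := by
  obtain ⟨_, φ, h1, h2, h3, h4⟩ := h
  exact ⟨φ, ⟨h1, h2, h3⟩, h4⟩

theorem hasTrace_iff {s e : Finset Plane} {v g : Plane → ℝ} : HasTrace s e v g ↔
    MemLp g 2 (edgeMeasure e) ∧ ∃ φ, H1Limit (interior (hull s)) φ v ∧
      Tendsto (fun m => eLpNorm (fun x => φ m x - g x) 2 (edgeMeasure e)) atTop (𝓝 0) :=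
  ⟨fun h => ⟨h.1, h.exists_h1Limit⟩, fun ⟨h, φ, ⟨h1, h2, h3⟩, h4⟩ => ⟨h, φ, h1, h2, h3, h4⟩⟩

theorem hull_triple {s : Finset Plane} {a b c : Plane} (hs : (s : Set Plane) = {a, b, c}) :
    hull s = convexHull ℝ {a, b, c} := by rw [hull, hs]

theorem ne_of_cross_ne {a b c : Plane} (hD : cross (b - a) (c - a) ≠ 0) : a ≠ b := by
  rintro rfl; simp [cross] at hD

theorem gradient_sub {φ ψ : Plane → ℝ} (hφ : ContDiff ℝ ∞ φ) (hψ : ContDiff ℝ ∞ ψ) (x : Plane) :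
    gradient (fun x => φ x - ψ x) x = gradient φ x - gradient ψ x := by
  rw [gradient, fderiv_fun_sub (hφ.differentiable (by simp) x) (hψ.differentiable (by simp) x),
    map_sub]
  rfl

section Triangle

variable {a b c : Plane} (hD : cross (b - a) (c - a) ≠ 0)

include hD

/-- Continuity of the trace on smooth functions, from the trace inequality. -/
theorem tendsto_trace_zero {ι : Type*} {l : Filter ι} {φ : ι → Plane → ℝ}
    (hφ : ∀ m, ContDiff ℝ ∞ (φ m))
    (h0 : Tendsto (fun m => eLpNorm (φ m) 2
      (volume.restrict (interior (convexHull ℝ {a, b, c})))) l (𝓝 0))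
    (h1 : Tendsto (fun m => eLpNorm (gradient (φ m)) 2
      (volume.restrict (interior (convexHull ℝ {a, b, c})))) l (𝓝 0)) :
    Tendsto (fun m => eLpNorm (fun s : ℝ => φ m (AffineMap.lineMap a b s)) 2 unitMeasure)
      l (𝓝 0) := by
  obtain ⟨C, hC, hCφ⟩ := exists_trace_le hD
  have hm : ∀ m, MemLp (fun s : ℝ => φ m (AffineMap.lineMap a b s)) 2 unitMeasure := fun m =>
    memLp_unit ((hφ m).continuous.comp AffineMap.lineMap_continuous)
  have e : ∀ m, eLpNorm (fun s : ℝ => φ m (AffineMap.lineMap a b s)) 2 unitMeasure ^ 2 ≤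
      ENNReal.ofReal C * (eLpNorm (φ m) 2 (volume.restrict (interior (convexHull ℝ {a, b, c}))) ^ 2 +
      eLpNorm (gradient (φ m)) 2 (volume.restrict (interior (convexHull ℝ {a, b, c}))) ^ 2) := by
    intro m
    have m0 := memLp_triangle (a := a) (b := b) (c := c) (hφ m).continuous
    have m1 := memLp_triangle (a := a) (b := b) (c := c) (continuous_gradient (hφ m))
    rw [← ENNReal.ofReal_toReal (hm m).2.ne, ← ENNReal.ofReal_toReal m0.2.ne,
      ← ENNReal.ofReal_toReal m1.2.ne, ← ENNReal.ofReal_pow ENNReal.toReal_nonneg,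
      ← ENNReal.ofReal_pow ENNReal.toReal_nonneg, ← ENNReal.ofReal_pow ENNReal.toReal_nonneg,
      eLpNorm_two_sq_toReal (hm m), eLpNorm_two_sq_toReal m0, eLpNorm_two_sq_toReal m1,
      ← ENNReal.ofReal_add (integral_nonneg fun _ => by positivity)
        (integral_nonneg fun _ => by positivity), ← ENNReal.ofReal_mul hC]
    refine ENNReal.ofReal_le_ofReal ?_
    have := hCφ (φ m) (hφ m)
    rw [intervalIntegral.integral_of_le zero_le_one] at this
    simpa only [Real.norm_eq_abs, sq_abs] using this
  have h2 : Tendsto (fun m => ENNReal.ofReal C *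
      (eLpNorm (φ m) 2 (volume.restrict (interior (convexHull ℝ {a, b, c}))) ^ 2 +
      eLpNorm (gradient (φ m)) 2 (volume.restrict (interior (convexHull ℝ {a, b, c}))) ^ 2))
      l (𝓝 0) := by
    have := ENNReal.Tendsto.const_mul (a := ENNReal.ofReal C)
      ((ENNReal.Tendsto.pow (n := 2) h0).add (ENNReal.Tendsto.pow (n := 2) h1))
      (Or.inr ENNReal.ofReal_ne_top)
    simpa using this
  have h3 := tendsto_of_tendsto_of_tendsto_of_le_of_le tendsto_const_nhds h2 (fun _ => zero_le) e
  have h4 := (ENNReal.continuous_rpow_const (y := 2⁻¹)).tendsto 0 |>.comp h3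
  simp only [Function.comp_def] at h4
  rw [ENNReal.zero_rpow_of_pos (by norm_num)] at h4
  refine h4.congr fun m => ?_
  rw [← ENNReal.rpow_natCast, ← ENNReal.rpow_mul]
  simp

/-- Two smooth approximations of the same `H¹` function have the same limit on the edge. -/
theorem H1Limit.sub {φ ψ : ℕ → Plane → ℝ} {v : Plane → ℝ}
    (hv : MemH1 (interior (convexHull ℝ {a, b, c})) v)
    (hφ : H1Limit (interior (convexHull ℝ {a, b, c})) φ v)
    (hψ : H1Limit (interior (convexHull ℝ {a, b, c})) ψ v) :
    Tendsto (fun m => eLpNorm (fun s : ℝ => φ m (AffineMap.lineMap a b s) -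
      ψ m (AffineMap.lineMap a b s)) 2 unitMeasure) atTop (𝓝 0) := by
  refine tendsto_trace_zero hD (φ := fun m x => φ m x - ψ m x) (fun m => (hφ.1 m).sub (hψ.1 m)) ?_ ?_
  · exact tendsto_eLpNorm_sub hφ.2.1 hψ.2.1 (fun m => (hφ.1 m).continuous.aestronglyMeasurable)
      (fun m => (hψ.1 m).continuous.aestronglyMeasurable) hv.1.1
  · have := tendsto_eLpNorm_sub hφ.2.2 hψ.2.2
      (fun m => (continuous_gradient (hφ.1 m)).aestronglyMeasurable)
      (fun m => (continuous_gradient (hψ.1 m)).aestronglyMeasurable) (hasWeakGrad_weakGrad hv.2).1.1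
    refine this.congr fun m => ?_
    congr 1
    ext1 x
    rw [gradient_sub (hφ.1 m) (hψ.1 m)]

/-- The trace does not depend on the approximating sequence in its definition. -/
theorem HasTrace.tendsto {s e : Finset Plane} (hs : (s : Set Plane) = {a, b, c})
    (he : (e : Set Plane) = {a, b}) {v g : Plane → ℝ} (hv : MemH1 (interior (hull s)) v)
    (hg : HasTrace s e v g) {φ : ℕ → Plane → ℝ} (hφ : H1Limit (interior (hull s)) φ v) :
    Tendsto (fun m => eLpNorm (fun s : ℝ => φ m (AffineMap.lineMap a b s) -
      g (AffineMap.lineMap a b s)) 2 unitMeasure) atTop (𝓝 0) := by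
  obtain ⟨ψ, hψ, hψg⟩ := hg.exists_h1Limit
  have hab := ne_of_cross_ne hD
  rw [tendsto_eLpNorm_edgeMeasure_iff hab he] at hψg
  rw [hull_triple hs] at hφ hψ hv
  have h1 := H1Limit.sub hD hv hφ hψ
  have h2 := h1.add hψg
  rw [add_zero] at h2
  refine tendsto_of_tendsto_of_tendsto_of_le_of_le tendsto_const_nhds h2 (fun _ => zero_le)
    fun m => ?_
  have hgm := (aestronglyMeasurable_edgeMeasure_iff hab he).1 hg.1.1
  have hl : Continuous fun s : ℝ => AffineMap.lineMap (k := ℝ) a b s :=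
    AffineMap.lineMap_continuous
  have hc1 := ((hφ.1 m).continuous.comp hl).aestronglyMeasurable (μ := unitMeasure)
  have hc2 := ((hψ.1 m).continuous.comp hl).aestronglyMeasurable (μ := unitMeasure)
  have e1 : (fun s : ℝ => φ m (AffineMap.lineMap a b s) - g (AffineMap.lineMap a b s)) =
      (fun s : ℝ => φ m (AffineMap.lineMap a b s) - ψ m (AffineMap.lineMap a b s)) +
      fun s : ℝ => ψ m (AffineMap.lineMap a b s) - g (AffineMap.lineMap a b s) := by
    ext s; simp
  rw [e1]
  exact eLpNorm_add_le (hc1.sub hc2) (hc2.sub hgm) (by norm_num)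

theorem interior_triangle_nonempty : (interior (convexHull ℝ {a, b, c})).Nonempty := by
  rw [interior_triangle_eq_image hD]
  exact ⟨_, !₂[1 / 4, 1 / 4], by norm_num, rfl⟩

theorem exists_h1Limit {v : Plane → ℝ} (hv : MemH1 (interior (convexHull ℝ {a, b, c})) v) :
    ∃ φ, H1Limit (interior (convexHull ℝ {a, b, c})) φ v :=
  exists_smooth_approx isOpen_interior (convex_convexHull ℝ _).interior
    (((isBounded_convexHull).2 (Set.toFinite {a, b, c}).isBounded).subset interior_subset)
    (interior_triangle_nonempty hD) hv.1 (hasWeakGrad_weakGrad hv.2)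

/-- Every `H¹` function on a triangle has a trace on each edge: the restrictions of a smooth
approximation form a Cauchy sequence in `L²` of the edge. -/
theorem exists_hasTrace {s e : Finset Plane} (hs : (s : Set Plane) = {a, b, c})
    (he : (e : Set Plane) = {a, b}) {v : Plane → ℝ} (hv : MemH1 (interior (hull s)) v) :
    ∃ g, HasTrace s e v g := by
  have hab := ne_of_cross_ne hD
  rw [hull_triple hs] at hv
  obtain ⟨φ, hφ⟩ := exists_h1Limit hD hv
  have hm : ∀ m, MemLp (φ m) 2 (edgeMeasure e) := fun m =>
    (memLp_edgeMeasure_iff hab he).2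
      (memLp_unit ((hφ.1 m).continuous.comp AffineMap.lineMap_continuous))
  have hc : Tendsto (fun p : ℕ × ℕ => eLpNorm (φ p.1 - φ p.2) 2 (edgeMeasure e)) atTop (𝓝 0) := by
    have t1 : Tendsto (fun p : ℕ × ℕ => p.1) atTop atTop := by
      rw [← prod_atTop_atTop_eq]; exact tendsto_fst
    have t2 : Tendsto (fun p : ℕ × ℕ => p.2) atTop atTop := by
      rw [← prod_atTop_atTop_eq]; exact tendsto_snd
    have h1 := tendsto_trace_zero hD (φ := fun (p : ℕ × ℕ) x => φ p.1 x - φ p.2 x)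
      (l := atTop) (fun p => (hφ.1 p.1).sub (hφ.1 p.2))
      (tendsto_eLpNorm_sub (hφ.2.1.comp t1) (hφ.2.1.comp t2)
        (fun p => (hφ.1 p.1).continuous.aestronglyMeasurable)
        (fun p => (hφ.1 p.2).continuous.aestronglyMeasurable) hv.1.1) (by
      have := tendsto_eLpNorm_sub (hφ.2.2.comp t1) (hφ.2.2.comp t2)
        (fun p => (continuous_gradient (hφ.1 p.1)).aestronglyMeasurable)
        (fun p => (continuous_gradient (hφ.1 p.2)).aestronglyMeasurable)
        (hasWeakGrad_weakGrad hv.2).1.1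
      refine this.congr fun p => ?_
      congr 1
      ext1 x
      rw [gradient_sub (hφ.1 p.1) (hφ.1 p.2)])
    have h2 := ENNReal.Tendsto.const_mul (a := ENNReal.ofReal (dist a b) ^ (2⁻¹ : ℝ)) h1
      (Or.inr (ENNReal.rpow_ne_top_of_nonneg (by norm_num) ENNReal.ofReal_ne_top))
    rw [mul_zero] at h2
    refine h2.congr fun p => ?_
    rw [eLpNorm_edgeMeasure hab he]
    rfl
  have hcs : CauchySeq fun m => (hm m).toLp := by
    rw [cauchySeq_iff_tendsto_dist_atTop_0]
    have := (ENNReal.tendsto_toReal ENNReal.zero_ne_top).comp hc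
    refine this.congr fun p => ?_
    rw [dist_edist, Lp.edist_toLp_toLp]
    rfl
  obtain ⟨L, hL⟩ := cauchySeq_tendsto_of_complete hcs
  refine ⟨L, hasTrace_iff.2 ⟨Lp.memLp L, φ, by rwa [hull_triple hs], ?_⟩⟩
  rw [← Lp.toLp_coeFn L (Lp.memLp L), Lp.tendsto_Lp_iff_tendsto_eLpNorm''] at hL
  exact hL

end Triangle

/-! ### Green's formula for Sobolev functions with traces -/

theorem continuous_fderiv_lineMap {h : Plane → ℝ} (hh : ContDiff ℝ ∞ h) (a b : Plane) :
    Continuous fun s : ℝ => fderiv ℝ h (AffineMap.lineMap a b s) (b - a) :=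
  ((hh.continuous_fderiv (by simp)).comp AffineMap.lineMap_continuous).clm_apply continuous_const

theorem lineInt_eq_inner (a b : Plane) (f h : Plane → ℝ) : lineInt a b f h =
    ∫ s, inner ℝ (f (AffineMap.lineMap a b s)) (fderiv ℝ h (AffineMap.lineMap a b s) (b - a))
      ∂unitMeasure := by
  rw [lineInt, intervalIntegral.integral_of_le zero_le_one]
  simp [mul_comm]

/-- The line integral is continuous in its first argument with respect to `L²` convergence. -/
theorem tendsto_lineInt {a b : Plane} {f : ℕ → Plane → ℝ} {g h : Plane → ℝ}
    (hf : ∀ m, Continuous (f m)) (hh : ContDiff ℝ ∞ h)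
    (hg : MemLp (fun s : ℝ => g (AffineMap.lineMap a b s)) 2 unitMeasure)
    (ht : Tendsto (fun m => eLpNorm (fun s : ℝ => f m (AffineMap.lineMap a b s) -
      g (AffineMap.lineMap a b s)) 2 unitMeasure) atTop (𝓝 0)) :
    Tendsto (fun m => lineInt a b (f m) h) atTop (𝓝 (lineInt a b g h)) := by
  simp only [lineInt_eq_inner]
  exact tendsto_integral_inner hg (fun m => memLp_unit ((hf m).comp AffineMap.lineMap_continuous))
    (memLp_unit (continuous_fderiv_lineMap hh a b)) ht

theorem hasDerivAt_lineMap {h : Plane → ℝ} (hh : ContDiff ℝ ∞ h) (a b : Plane) (s : ℝ) :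
    HasDerivAt (fun s : ℝ => h (AffineMap.lineMap a b s))
      (fderiv ℝ h (AffineMap.lineMap a b s) (b - a)) s :=
  (hh.differentiable (by simp) _).hasFDerivAt.comp_hasDerivAt s AffineMap.hasDerivAt_lineMap

/-- Integration by parts along a segment. -/
theorem lineInt_add_lineInt {f h : Plane → ℝ} (hf : ContDiff ℝ ∞ f) (hh : ContDiff ℝ ∞ h)
    (a b : Plane) : lineInt a b f h + lineInt a b h f = f b * h b - f a * h a := by
  have hl : Continuous fun s : ℝ => AffineMap.lineMap (k := ℝ) a b s :=
    AffineMap.lineMap_continuous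
  have hd : ∀ s : ℝ, HasDerivAt (fun s : ℝ => f (AffineMap.lineMap a b s) *
      h (AffineMap.lineMap a b s)) (fderiv ℝ f (AffineMap.lineMap a b s) (b - a) *
        h (AffineMap.lineMap a b s) + f (AffineMap.lineMap a b s) *
          fderiv ℝ h (AffineMap.lineMap a b s) (b - a)) s := fun s =>
    (hasDerivAt_lineMap hf a b s).mul (hasDerivAt_lineMap hh a b s)
  have c1 : Continuous fun s : ℝ => fderiv ℝ f (AffineMap.lineMap a b s) (b - a) *
      h (AffineMap.lineMap a b s) := (continuous_fderiv_lineMap hf a b).mul (hh.continuous.comp hl)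
  have c2 : Continuous fun s : ℝ => f (AffineMap.lineMap a b s) *
      fderiv ℝ h (AffineMap.lineMap a b s) (b - a) :=
    (hf.continuous.comp hl).mul (continuous_fderiv_lineMap hh a b)
  have := intervalIntegral.integral_eq_sub_of_hasDerivAt (a := 0) (b := 1) (fun s _ => hd s)
    ((c1.add c2).intervalIntegrable _ _)
  rw [AffineMap.lineMap_apply_one, AffineMap.lineMap_apply_zero] at this
  rw [← this, intervalIntegral.integral_add (c1.intervalIntegrable _ _) (c2.intervalIntegrable _ _),
    add_comm]
  simp only [lineInt, mul_comm (h _)]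

theorem triple_rotate (a b c : Plane) : ({a, b, c} : Set Plane) = {b, c, a} := by
  ext x; simp only [mem_insert_iff, mem_singleton_iff]; tauto

/-- Smooth bumps concentrating at `z`, scaled so that their Dirichlet energy stays bounded. -/
noncomputable def peak (z : Plane) (m : ℕ) (x : Plane) : ℝ :=
  (⟨1, 2, one_pos, one_lt_two⟩ : ContDiffBump (0 : Plane)) (((m : ℝ) + 1) • (x - z))

theorem contDiff_peak (z : Plane) (m : ℕ) : ContDiff ℝ ∞ (peak z m) :=
  (ContDiffBump.contDiff _).comp (by fun_prop)

theorem peak_self (z : Plane) (m : ℕ) : peak z m z = 1 := by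
  rw [peak, sub_self, smul_zero]
  exact ContDiffBump.one_of_mem_closedBall _ (Metric.mem_closedBall_self zero_le_one)

theorem abs_peak_le (z : Plane) (m : ℕ) (x : Plane) : |peak z m x| ≤ 1 := by
  rw [peak, abs_of_nonneg (ContDiffBump.nonneg _)]
  exact ContDiffBump.le_one _

theorem peak_eq_zero {z x : Plane} {m : ℕ} (h : 2 ≤ ((m : ℝ) + 1) * ‖x - z‖) :
    peak z m x = 0 := by
  refine ContDiffBump.zero_of_le_dist _ ?_
  rwa [dist_zero_right, norm_smul, Real.norm_of_nonneg (by positivity)]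

theorem eventually_le_mul_norm {z x : Plane} (h : x ≠ z) :
    ∀ᶠ m : ℕ in atTop, 2 < ((m : ℝ) + 1) * ‖x - z‖ := by
  have h0 : 0 < ‖x - z‖ := norm_pos_iff.2 (sub_ne_zero.2 h)
  filter_upwards [(tendsto_natCast_atTop_atTop (R := ℝ)).eventually_gt_atTop (2 / ‖x - z‖)] with m hm
  rw [div_lt_iff₀ h0] at hm
  linarith

theorem eventually_peak_eq_zero {z x : Plane} (h : x ≠ z) : ∀ᶠ m in atTop, peak z m x = 0 := by
  filter_upwards [eventually_le_mul_norm h] with m hm using peak_eq_zero hm.le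

theorem gradient_peak (z : Plane) (m : ℕ) (x : Plane) : gradient (peak z m) x = ((m : ℝ) + 1) •
    gradient (⟨1, 2, one_pos, one_lt_two⟩ : ContDiffBump (0 : Plane))
      (((m : ℝ) + 1) • x + -(((m : ℝ) + 1) • z)) := by
  refine ext_inner_right ℝ fun d => ?_
  rw [← fderiv_eq_inner_gradient, inner_smul_left, ← fderiv_eq_inner_gradient]
  have h1 : HasFDerivAt (fun x : Plane => ((m : ℝ) + 1) • (x - z))
      (((m : ℝ) + 1) • ContinuousLinearMap.id ℝ Plane) x :=
    ((hasFDerivAt_id x).sub_const z).const_smul ((m : ℝ) + 1)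
  set β := (⟨1, 2, one_pos, one_lt_two⟩ : ContDiffBump (0 : Plane)) with hβ
  have h2 : HasFDerivAt (peak z m) _ x :=
    HasFDerivAt.comp (g := β) (f := fun x : Plane => ((m : ℝ) + 1) • (x - z)) x
      ((β.contDiff (n := 1)).differentiable (by simp) _).hasFDerivAt h1
  rw [h2.fderiv, ← sub_eq_add_neg, ← smul_sub]
  simp

/-- The Dirichlet energy in the plane is invariant under scaling, hence uniformly bounded for peaks. -/
theorem exists_eLpNorm_gradient_peak_le : ∃ K : ℝ≥0∞, K ≠ ⊤ ∧ ∀ z m,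
    eLpNorm (gradient (peak z m)) 2 volume ≤ K := by
  set β := (⟨1, 2, one_pos, one_lt_two⟩ : ContDiffBump (0 : Plane)) with hβ
  have hβc : Continuous (gradient β) := continuous_gradient β.contDiff
  have hs : HasCompactSupport (gradient β) :=
    (β.hasCompactSupport.fderiv (𝕜 := ℝ)).comp_left
      (g := fun L => (InnerProductSpace.toDual ℝ Plane).symm L) (by simp)
  refine ⟨eLpNorm (gradient β) 2 volume, (hβc.memLp_of_hasCompactSupport hs).2.ne, fun z m => ?_⟩
  refine (ENNReal.pow_le_pow_left_iff (n := 2) (by norm_num)).1 (le_of_eq ?_)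
  rw [eLpNorm_two_sq, eLpNorm_two_sq]
  have hm : (0 : ℝ) < (m : ℝ) + 1 := by positivity
  have e : ∀ x, ‖gradient (peak z m) x‖ₑ ^ 2 = ENNReal.ofReal (((m : ℝ) + 1) ^ 2) *
      ‖gradient β (((m : ℝ) + 1) • x + -(((m : ℝ) + 1) • z))‖ₑ ^ 2 := by
    intro x
    rw [gradient_peak, enorm_smul, mul_pow, ← ofReal_norm (((m : ℝ) + 1)),
      Real.norm_of_nonneg hm.le, ENNReal.ofReal_pow hm.le]
  simp only [e]
  rw [lintegral_const_mul' _ _ ENNReal.ofReal_ne_top,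
    lintegral_comp_affine hm _ (h := fun x => ‖gradient β x‖ₑ ^ 2) (by fun_prop), ← mul_assoc,
    ← ENNReal.ofReal_mul (by positivity), mul_inv_cancel₀ (by positivity)]
  simp

theorem tendsto_lineInt_peak {x y : Plane} (hxy : x ≠ y) (z : Plane) {p : Plane → ℝ}
    (hp : ContDiff ℝ ∞ p) : Tendsto (fun m => lineInt x y (peak z m) p) atTop (𝓝 0) := by
  simp only [lineInt, intervalIntegral.integral_of_le zero_le_one]
  have hl : Continuous fun s : ℝ => AffineMap.lineMap (k := ℝ) x y s :=
    AffineMap.lineMap_continuous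
  have := tendsto_integral_of_dominated_convergence (μ := unitMeasure)
    (F := fun m s => peak z m (AffineMap.lineMap x y s) *
      fderiv ℝ p (AffineMap.lineMap x y s) (y - x)) (f := fun _ => (0 : ℝ))
    (fun s => |fderiv ℝ p (AffineMap.lineMap x y s) (y - x)|)
    (fun m => (((contDiff_peak z m).continuous.comp hl).mul
      (continuous_fderiv_lineMap hp x y)).aestronglyMeasurable)
    (continuous_fderiv_lineMap hp x y).abs.integrableOn_Ioc
    (fun m => ae_of_all _ fun s => by
      rw [Real.norm_eq_abs, abs_mul]
      exact mul_le_of_le_one_left (abs_nonneg _) (abs_peak_le _ _ _)) ?_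
  · simpa using this
  · have h0 : unitMeasure {s : ℝ | AffineMap.lineMap x y s = z} = 0 := by
      refine Set.Subsingleton.measure_zero ?_ _
      intro s hs t ht
      exact AffineMap.lineMap_injective ℝ hxy (hs.trans ht.symm)
    filter_upwards [compl_mem_ae_iff.2 h0] with s hs
    refine tendsto_const_nhds.congr' ?_
    filter_upwards [eventually_peak_eq_zero (z := z) hs] with m hm
    rw [hm, zero_mul]

theorem tendsto_eLpNorm_indicator_zero {μ : Measure Plane} [NullSingletonClass μ]
    {G : Plane → Plane} (hG : MemLp G 2 μ) {B : ℕ → Set Plane} (hB : ∀ m, MeasurableSet (B m))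
    {z : Plane} (hz : ∀ x, x ≠ z → ∀ᶠ m in atTop, x ∉ B m) :
    Tendsto (fun m => eLpNorm ((B m).indicator G) 2 μ) atTop (𝓝 0) := by
  have h1 : Tendsto (fun m => ∫⁻ x, ‖(B m).indicator G x‖ₑ ^ 2 ∂μ) atTop (𝓝 0) := by
    have h2 := tendsto_lintegral_of_dominated_convergence' (μ := μ)
      (F := fun m x => ‖(B m).indicator G x‖ₑ ^ 2) (f := fun _ => 0) (fun x => ‖G x‖ₑ ^ 2)
      (fun m => ((hG.1.indicator (hB m)).enorm.pow_const 2))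
      (fun m => ae_of_all _ fun x => pow_le_pow_left' (enorm_indicator_le_enorm_self _ _) 2) (by
        rw [← eLpNorm_two_sq]; exact ENNReal.pow_ne_top hG.2.ne) ?_
    · simpa only [lintegral_zero] using h2
    · filter_upwards [compl_mem_ae_iff.2 (measure_singleton (μ := μ) z)] with x hx
      refine tendsto_const_nhds.congr' ?_
      filter_upwards [hz x hx] with m hm
      rw [indicator_of_notMem hm]
      simp
  have h4 := (ENNReal.continuous_rpow_const (y := 2⁻¹)).tendsto 0 |>.comp h1
  simp only [Function.comp_def] at h4
  rw [ENNReal.zero_rpow_of_pos (by norm_num)] at h4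
  refine h4.congr fun m => ?_
  rw [← eLpNorm_two_sq, ← ENNReal.rpow_natCast, ← ENNReal.rpow_mul]
  simp

/-- A square-integrable field does not see the peaks: their energy is bounded and their supports
shrink to a point. -/
theorem tendsto_integral_peak {μ : Measure Plane} [NullSingletonClass μ] (hμ : μ ≤ volume)
    {G : Plane → Plane} (hG : MemLp G 2 μ) (z : Plane) :
    Tendsto (fun m => ∫ x, inner ℝ (G x) (rot (gradient (peak z m) x)) ∂μ) atTop (𝓝 0) := by
  obtain ⟨K, hK, hKp⟩ := exists_eLpNorm_gradient_peak_le
  let B : ℕ → Set Plane := fun m => {x | ((m : ℝ) + 1) * ‖x - z‖ ≤ 2}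
  have hB : ∀ m, MeasurableSet (B m) := fun m =>
    (isClosed_le (by fun_prop) continuous_const).measurableSet
  have hgp : ∀ m x, x ∉ B m → gradient (peak z m) x = 0 := by
    intro m x hx
    have h1 : peak z m =ᶠ[𝓝 x] fun _ => 0 := by
      have ho : IsOpen (B m)ᶜ := (isClosed_le (by fun_prop) continuous_const).isOpen_compl
      filter_upwards [ho.mem_nhds hx] with y hy
      exact peak_eq_zero (le_of_lt (not_le.1 hy))
    rw [gradient, h1.fderiv_eq]
    simp
  have hc : ∀ m, Continuous (gradient (peak z m)) := fun m => continuous_gradient (contDiff_peak z m)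
  have hgm : ∀ m, MemLp (gradient (peak z m)) 2 μ := fun m =>
    ⟨(hc m).aestronglyMeasurable, ((eLpNorm_mono_measure _ hμ).trans (hKp z m)).trans_lt hK.lt_top⟩
  have hI : Tendsto (fun m => eLpNorm ((B m).indicator G) 2 μ) atTop (𝓝 0) :=
    tendsto_eLpNorm_indicator_zero hG hB fun x hx => by
    filter_upwards [eventually_le_mul_norm (z := z) hx] with m hm
    simpa [B] using hm
  have hb : Tendsto (fun m => (eLpNorm ((B m).indicator G) 2 μ).toReal * K.toReal) atTop (𝓝 0) := by
    have h1 := ((ENNReal.tendsto_toReal ENNReal.zero_ne_top).comp hI).mul_const K.toReal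
    rwa [ENNReal.toReal_zero, zero_mul] at h1
  have key : ∀ m, |∫ x, inner ℝ (G x) (rot (gradient (peak z m) x)) ∂μ| ≤
      (eLpNorm ((B m).indicator G) 2 μ).toReal * K.toReal := by
    intro m
    have e : ∀ x, inner ℝ (G x) (rot (gradient (peak z m) x)) =
        inner ℝ ((B m).indicator G x) (rot (gradient (peak z m) x)) := by
      intro x
      by_cases hx : x ∈ B m
      · rw [indicator_of_mem hx]
      · have h0 : rot (0 : Plane) = 0 := by rw [← norm_eq_zero, norm_rot, norm_zero]
        rw [hgp m x hx, h0, inner_zero_right, inner_zero_right]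
    have h1 : eLpNorm (fun x => rot (gradient (peak z m) x)) 2 μ ≤ K := by
      rw [eLpNorm_congr_norm_ae (g := gradient (peak z m)) (ae_of_all _ fun x => norm_rot _)]
      exact (eLpNorm_mono_measure _ hμ).trans (hKp z m)
    have m1 : MemLp ((B m).indicator G) 2 μ := hG.indicator (hB m)
    have m2 : MemLp (fun x => rot (gradient (peak z m) x)) 2 μ := memLp_rot (hgm m)
    have h2 := abs_integral_inner_le m1 m2
    rw [integral_congr_ae (ae_of_all _ e)]
    exact h2.trans (mul_le_mul_of_nonneg_left (ENNReal.toReal_mono hK h1) ENNReal.toReal_nonneg)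
  exact squeeze_zero_norm key hb

section Triangle

variable {a b c : Plane} (hD : cross (b - a) (c - a) ≠ 0) {s e₁ e₂ e₃ : Finset Plane}
  (hs : (s : Set Plane) = {a, b, c}) (he₁ : (e₁ : Set Plane) = {a, b})
  (he₂ : (e₂ : Set Plane) = {b, c}) (he₃ : (e₃ : Set Plane) = {c, a})

include hD hs he₁ he₂ he₃

/-- Green's formula for an `H¹` function and a smooth function. -/
theorem HasTrace.green {v w g₁ g₂ g₃ : Plane → ℝ} (hv : MemH1 (interior (hull s)) v)
    (h₁ : HasTrace s e₁ v g₁) (h₂ : HasTrace s e₂ v g₂) (h₃ : HasTrace s e₃ v g₃)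
    (hw : ContDiff ℝ ∞ w) :
    ∫ x in interior (hull s), inner ℝ (weakGrad (interior (hull s)) v x) (rot (gradient w x)) =
      -SignType.sign (cross (b - a) (c - a)) *
        (lineInt a b g₁ w + lineInt b c g₂ w + lineInt c a g₃ w) := by
  have hD₂ : cross (c - b) (a - b) ≠ 0 := by rwa [cross_rotate a b c]
  have hD₃ : cross (a - c) (b - c) ≠ 0 := by rwa [cross_rotate b c a]
  have hs₂ : (s : Set Plane) = {b, c, a} := by rw [hs, triple_rotate]
  have hs₃ : (s : Set Plane) = {c, a, b} := by rw [hs₂, triple_rotate]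
  obtain ⟨φ, hφ, -⟩ := h₁.exists_h1Limit
  have t₁ := tendsto_lineInt (fun m => (hφ.1 m).continuous) hw
    ((memLp_edgeMeasure_iff (ne_of_cross_ne hD) he₁).1 h₁.1) (h₁.tendsto hD hs he₁ hv hφ)
  have t₂ := tendsto_lineInt (fun m => (hφ.1 m).continuous) hw
    ((memLp_edgeMeasure_iff (ne_of_cross_ne hD₂) he₂).1 h₂.1) (h₂.tendsto hD₂ hs₂ he₂ hv hφ)
  have t₃ := tendsto_lineInt (fun m => (hφ.1 m).continuous) hw
    ((memLp_edgeMeasure_iff (ne_of_cross_ne hD₃) he₃).1 h₃.1) (h₃.tendsto hD₃ hs₃ he₃ hv hφ)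
  have hT : interior (hull s) = interior (convexHull ℝ {a, b, c}) := by rw [hull_triple hs]
  have hrw : MemLp (fun x => rot (gradient w x)) 2 (volume.restrict (interior (hull s))) := by
    rw [hT]; exact memLp_triangle (continuous_rot.comp (continuous_gradient hw))
  have l := tendsto_integral_inner (hasWeakGrad_weakGrad hv.2).1
    (fun m => by rw [hT]; exact memLp_triangle (continuous_gradient (hφ.1 m))) hrw hφ.2.2
  refine tendsto_nhds_unique l ((((t₁.add t₂).add t₃).const_mul _).congr fun m => ?_)
  rw [hT, integral_inner_gradient_rot_gradient hD (hφ.1 m) hw]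

/-- Smooth traces of an `H¹` function on two edges of a triangle agree at the common vertex: test
Green's formula with peaks at that vertex and integrate by parts along the edges. Point values of
`H¹` functions do not exist in general, so this does not follow from continuity. -/
theorem HasTrace.vertex_eq {v p₁ p₂ p₃ : Plane → ℝ} (hv : MemH1 (interior (hull s)) v)
    (h₁ : HasTrace s e₁ v p₁) (h₂ : HasTrace s e₂ v p₂) (h₃ : HasTrace s e₃ v p₃)
    (hp₁ : ContDiff ℝ ∞ p₁) (hp₂ : ContDiff ℝ ∞ p₂) (hp₃ : ContDiff ℝ ∞ p₃) : p₁ b = p₂ b := by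
  have hD₂ : cross (c - b) (a - b) ≠ 0 := by rwa [cross_rotate a b c]
  have hD₃ : cross (a - c) (b - c) ≠ 0 := by rwa [cross_rotate b c a]
  have hab := ne_of_cross_ne hD
  have hbc := ne_of_cross_ne hD₂
  have hca := ne_of_cross_ne hD₃
  have l := tendsto_integral_peak (μ := volume.restrict (interior (hull s)))
    Measure.restrict_le_self (hasWeakGrad_weakGrad hv.2).1 b
  have hk : ∀ᶠ m in atTop, ∫ x in interior (hull s), inner ℝ (weakGrad (interior (hull s)) v x)
      (rot (gradient (peak b m) x)) = -SignType.sign (cross (b - a) (c - a)) *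
        ((p₁ b - lineInt a b (peak b m) p₁) + (-p₂ b - lineInt b c (peak b m) p₂) +
          -lineInt c a (peak b m) p₃) := by
    filter_upwards [eventually_peak_eq_zero hab, eventually_peak_eq_zero hbc.symm] with m ha hc
    rw [HasTrace.green hD hs he₁ he₂ he₃ hv h₁ h₂ h₃ (contDiff_peak b m)]
    have k₁ := lineInt_add_lineInt hp₁ (contDiff_peak b m) a b
    have k₂ := lineInt_add_lineInt hp₂ (contDiff_peak b m) b c
    have k₃ := lineInt_add_lineInt hp₃ (contDiff_peak b m) c a
    rw [ha, peak_self] at k₁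
    rw [hc, peak_self] at k₂
    rw [ha, hc] at k₃
    congr 1
    linarith
  have r := (((((tendsto_lineInt_peak hab b hp₁).const_sub (p₁ b)).add
    ((tendsto_lineInt_peak hbc b hp₂).const_sub (-p₂ b))).add
      (tendsto_lineInt_peak hca b hp₃).neg).const_mul
        (-SignType.sign (cross (b - a) (c - a)) : ℝ))
  have := tendsto_nhds_unique l (r.congr' (hk.mono fun m hm => hm.symm))
  have hσ : (SignType.sign (cross (b - a) (c - a)) : ℝ) ≠ 0 := by
    rcases lt_or_gt_of_ne hD with h | h
    · rw [sign_neg h]; simp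
    · rw [sign_pos h]; simp
  have h0 := (mul_eq_zero.1 this.symm).resolve_left (neg_ne_zero.2 hσ)
  linarith

/-- Green's formula for two Sobolev functions, the first of which has smooth traces: the end point
terms of the partial integrations along the edges cancel since the traces agree at the vertices. -/
theorem HasTrace.green_weakGrad {v w p₁ p₂ p₃ g₁ g₂ g₃ : Plane → ℝ}
    (hv : MemH1 (interior (hull s)) v) (hw : MemH1 (interior (hull s)) w)
    (h₁ : HasTrace s e₁ v p₁) (h₂ : HasTrace s e₂ v p₂) (h₃ : HasTrace s e₃ v p₃)
    (hp₁ : ContDiff ℝ ∞ p₁) (hp₂ : ContDiff ℝ ∞ p₂) (hp₃ : ContDiff ℝ ∞ p₃)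
    (k₁ : HasTrace s e₁ w g₁) (k₂ : HasTrace s e₂ w g₂) (k₃ : HasTrace s e₃ w g₃) :
    ∫ x in interior (hull s), inner ℝ (weakGrad (interior (hull s)) v x)
        (rot (weakGrad (interior (hull s)) w x)) =
      SignType.sign (cross (b - a) (c - a)) *
        (lineInt a b g₁ p₁ + lineInt b c g₂ p₂ + lineInt c a g₃ p₃) := by
  have hD₂ : cross (c - b) (a - b) ≠ 0 := by rwa [cross_rotate a b c]
  have hD₃ : cross (a - c) (b - c) ≠ 0 := by rwa [cross_rotate b c a]
  have hs₂ : (s : Set Plane) = {b, c, a} := by rw [hs, triple_rotate]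
  have hs₃ : (s : Set Plane) = {c, a, b} := by rw [hs₂, triple_rotate]
  have eb := HasTrace.vertex_eq hD hs he₁ he₂ he₃ hv h₁ h₂ h₃ hp₁ hp₂ hp₃
  have ec := HasTrace.vertex_eq hD₂ hs₂ he₂ he₃ he₁ hv h₂ h₃ h₁ hp₂ hp₃ hp₁
  have ea := HasTrace.vertex_eq hD₃ hs₃ he₃ he₁ he₂ hv h₃ h₁ h₂ hp₃ hp₁ hp₂
  obtain ⟨φ, hφ, -⟩ := k₁.exists_h1Limit
  have t₁ := tendsto_lineInt (fun m => (hφ.1 m).continuous) hp₁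
    ((memLp_edgeMeasure_iff (ne_of_cross_ne hD) he₁).1 k₁.1) (k₁.tendsto hD hs he₁ hw hφ)
  have t₂ := tendsto_lineInt (fun m => (hφ.1 m).continuous) hp₂
    ((memLp_edgeMeasure_iff (ne_of_cross_ne hD₂) he₂).1 k₂.1) (k₂.tendsto hD₂ hs₂ he₂ hw hφ)
  have t₃ := tendsto_lineInt (fun m => (hφ.1 m).continuous) hp₃
    ((memLp_edgeMeasure_iff (ne_of_cross_ne hD₃) he₃).1 k₃.1) (k₃.tendsto hD₃ hs₃ he₃ hw hφ)
  have hT : interior (hull s) = interior (convexHull ℝ {a, b, c}) := by rw [hull_triple hs]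
  have l := (tendsto_integral_inner (hasWeakGrad_weakGrad hw.2).1
    (fun m => by rw [hT]; exact memLp_triangle (continuous_gradient (hφ.1 m)))
    (memLp_rot (hasWeakGrad_weakGrad hv.2).1) hφ.2.2).neg
  simp only [← integral_neg, ← inner_rot_antisymm] at l
  refine tendsto_nhds_unique l ((((t₁.add t₂).add t₃).const_mul _).congr fun m => ?_)
  rw [HasTrace.green hD hs he₁ he₂ he₃ hv h₁ h₂ h₃ (hφ.1 m)]
  have m₁ := lineInt_add_lineInt hp₁ (hφ.1 m) a b
  have m₂ := lineInt_add_lineInt hp₂ (hφ.1 m) b c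
  have m₃ := lineInt_add_lineInt hp₃ (hφ.1 m) c a
  rw [eb] at m₁
  rw [ec] at m₂
  rw [ea] at m₃
  rw [neg_mul, ← mul_neg]
  congr 1
  linarith

end Triangle

/-! ### Geometry of the triangulation -/

/-- A Lipschitz domain lies on one side of its boundary only. -/
theorem IsLipschitzDomain.interior_closure_subset {Ω : Set Plane} (h : IsLipschitzDomain Ω) :
    interior (closure Ω) ⊆ Ω := by
  intro x hx
  by_contra hxΩ
  have hfr : x ∈ frontier Ω := by
    rw [frontier, h.isOpen.interior_eq]
    exact ⟨interior_subset hx, hxΩ⟩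
  obtain ⟨R, γ, L, r, hr, hγ, hR⟩ := h.lipschitz x hfr
  -- points straight below `x` have a neighbourhood outside of `Ω`
  have hx0 : R x 1 ≤ γ (R x 0) := by
    by_contra hlt
    exact hxΩ ((hR x (Metric.mem_ball_self hr)).2 (not_le.1 hlt))
  let y : ℝ → Plane := fun t => R.symm (R x - t • !₂[0, 1])
  have hyc : Continuous y := by
    refine R.symm.continuous.comp ?_
    fun_prop
  have hy0 : y 0 = x := by simp [y]
  have ht : Tendsto y (𝓝[>] 0) (𝓝 x) := by
    rw [← hy0]; exact (hyc.tendsto 0).mono_left nhdsWithin_le_nhds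
  have hpos : ∀ᶠ t : ℝ in 𝓝[>] 0, 0 < t := self_mem_nhdsWithin
  obtain ⟨t, ⟨ht1, ht2⟩, ht0⟩ := ((ht.eventually (mem_interior_iff_mem_nhds.1 hx)).and
    (ht.eventually (Metric.ball_mem_nhds x hr)) |>.and hpos).exists
  have e0 : R (y t) 0 = R x 0 := by simp [y]
  have e1 : R (y t) 1 = R x 1 - t := by simp [y]
  have hRc : ∀ i, Continuous fun z => R z i := fun i =>
    (PiLp.continuous_apply 2 _ i).comp R.continuous
  have hopen : IsOpen {z | R z 1 < γ (R z 0)} :=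
    isOpen_lt (hRc 1) (hγ.continuous.comp (hRc 0))
  have hmem : y t ∈ {z | R z 1 < γ (R z 0)} := by
    change R (y t) 1 < γ (R (y t) 0)
    rw [e0, e1]; linarith
  obtain ⟨z, ⟨hz1, hz2⟩, hz3⟩ := mem_closure_iff.1 ht1 _ (hopen.inter Metric.isOpen_ball)
    ⟨hmem, ht2⟩
  exact absurd ((hR z hz2).1 hz3) (not_lt.2 (le_of_lt hz1))

namespace Triangulation

variable {Ω : Set Plane} (𝒯 : Triangulation Ω)

theorem exists_vertices {s : Finset Plane} (hs : s ∈ 𝒯.cells) :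
    ∃ a b c, s = {a, b, c} ∧ cross (b - a) (c - a) ≠ 0 :=
  exists_triangle (𝒯.card_eq s hs) (𝒯.nondegenerate s hs)

theorem cross_ne_zero {s : Finset Plane} (hs : s ∈ 𝒯.cells) {a b c : Plane}
    (h : (s : Set Plane) = {a, b, c}) : cross (b - a) (c - a) ≠ 0 := by
  have h' : s = {a, b, c} := by
    apply Finset.coe_injective; rw [h]; simp
  have hc := 𝒯.card_eq s hs
  obtain ⟨x, y, z, hxyz, hD⟩ := 𝒯.exists_vertices hs
  rw [h'] at hc
  have key : ∀ p q : Plane, ({a, b, c} : Finset Plane) ⊆ {p, q} → False := fun p q hpq => by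
    have h1 := Finset.card_le_card hpq
    have h2 := Finset.card_le_two (a := p) (b := q)
    omega
  have hab : a ≠ b := by rintro rfl; exact key a c (by simp)
  have hac : a ≠ c := by rintro rfl; exact key b a (by simp)
  have hbc : b ≠ c := by rintro rfl; exact key a b (by simp)
  have ha : a ∈ s := by rw [h']; simp
  have hb : b ∈ s := by rw [h']; simp
  have hc' : c ∈ s := by rw [h']; simp
  rw [hxyz] at ha hb hc'
  simp only [Finset.mem_insert, Finset.mem_singleton] at ha hb hc'
  have r1 := cross_rotate x y z
  have r2 := cross_rotate y z x
  have r3 := cross_reverse x y z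
  have r4 := cross_reverse y z x
  have r5 := cross_reverse z x y
  rcases ha with rfl | rfl | rfl <;> rcases hb with rfl | rfl | rfl <;>
    rcases hc' with rfl | rfl | rfl <;>
    first
    | exact absurd rfl hab
    | exact absurd rfl hac
    | exact absurd rfl hbc
    | (intro h0; apply hD; linarith)

/-- An open triangle is a subset of `closure Ω`, hence of `Ω`, which is on one side of its boundary. -/
theorem interior_hull_subset (hΩ : IsLipschitzDomain Ω) {s : Finset Plane} (hs : s ∈ 𝒯.cells) :
    interior (hull s) ⊆ Ω := by
  refine Subset.trans (interior_mono ?_) hΩ.interior_closure_subset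
  rw [← 𝒯.covers]
  exact subset_biUnion_of_mem (u := fun s => hull s) hs

/-- The intersection of two triangles is the convex hull of at most two points, which has empty
interior. -/
theorem disjoint_interior_hull {s t : Finset Plane} (hs : s ∈ 𝒯.cells) (ht : t ∈ 𝒯.cells)
    (hst : s ≠ t) : Disjoint (interior (hull s)) (interior (hull t)) := by
  classical
  rw [disjoint_iff_inter_eq_empty, ← interior_inter, 𝒯.regular s hs t ht, ← Finset.coe_inter]
  by_contra hne
  rw [← Ne, ← nonempty_iff_ne_empty, interior_convexHull_nonempty_iff_affineSpan_eq_top] at hne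
  have hcard : (s ∩ t).card ≤ 2 := by
    by_contra hlt
    have h3 : (s ∩ t).card = 3 :=
      le_antisymm ((Finset.card_le_card Finset.inter_subset_left).trans (𝒯.card_eq s hs).le)
        (by omega)
    have e1 := Finset.eq_of_subset_of_card_le (Finset.inter_subset_left (s₁ := s) (s₂ := t))
      (by rw [h3, 𝒯.card_eq s hs])
    have e2 := Finset.eq_of_subset_of_card_le (Finset.inter_subset_right (s₁ := s) (s₂ := t))
      (by rw [h3, 𝒯.card_eq t ht])
    exact hst (e1.symm.trans e2)
  have hv := AffineSubspace.vectorSpan_eq_top_of_affineSpan_eq_top ℝ Plane Plane hne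
  have h1 : Module.finrank ℝ (vectorSpan ℝ ((s ∩ t : Finset Plane) : Set Plane)) ≤ 1 := by
    have hcol : Collinear ℝ ((s ∩ t : Finset Plane) : Set Plane) := by
      rcases Nat.lt_or_ge (s ∩ t).card 2 with h2 | h2
      · have h3 : ((s ∩ t : Finset Plane) : Set Plane).Subsingleton := fun x hx y hy =>
          Finset.card_le_one.1 (by omega) x hx y hy
        rcases h3.eq_empty_or_singleton with h0 | ⟨p, h0⟩
        · rw [h0]; exact collinear_empty ℝ Plane
        · rw [h0]; exact collinear_singleton ℝ p
      · obtain ⟨p, q, -, hpq⟩ := Finset.card_eq_two.1 (le_antisymm hcard h2)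
        rw [hpq, Finset.coe_pair]
        exact collinear_pair ℝ p q
    exact hcol.finrank_le_one
  rw [hv, finrank_top, finrank_euclideanSpace_fin] at h1
  omega

/-- Two triangles with a common edge lie on opposite sides of it. -/
theorem cross_mul_cross_neg {s t : Finset Plane} (hs : s ∈ 𝒯.cells) (ht : t ∈ 𝒯.cells)
    (hst : s ≠ t) {a b c d : Plane} (hsc : (s : Set Plane) = {a, b, c})
    (htd : (t : Set Plane) = {a, b, d}) : cross (b - a) (c - a) * cross (b - a) (d - a) < 0 := by
  have hD := 𝒯.cross_ne_zero hs hsc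
  have hD' := 𝒯.cross_ne_zero ht htd
  by_contra hneg
  have hpos : 0 < cross (b - a) (c - a) * cross (b - a) (d - a) :=
    lt_of_le_of_ne (not_lt.1 hneg) (mul_ne_zero hD hD').symm
  have hdisj := 𝒯.disjoint_interior_hull hs ht hst
  rw [hull_triple hsc, hull_triple htd, interior_triangle hD, interior_triangle hD'] at hdisj
  -- a point slightly above the midpoint of the common edge lies in both triangles
  let m : Plane := AffineMap.lineMap a b (1 / 2 : ℝ)
  have hb : cross (c - b) (a - b) ≠ 0 := by rwa [cross_rotate a b c]
  have hb' : cross (d - b) (a - b) ≠ 0 := by rwa [cross_rotate a b d]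
  let y : ℝ → Plane := fun t => m + t • (c - a)
  have hyc : Continuous y := by fun_prop
  have hev : ∀ e : Plane, cross (b - a) (e - a) ≠ 0 →
      ∀ᶠ t in 𝓝[>] (0 : ℝ), 0 < bary a b e (y t) ∧ 0 < bary b e a (y t) := by
    intro e he
    have he' : cross (e - b) (a - b) ≠ 0 := by rwa [cross_rotate a b e]
    have ht : Tendsto y (𝓝[>] 0) (𝓝 m) := by
      have := (hyc.tendsto 0).mono_left (nhdsWithin_le_nhds (s := Ioi (0 : ℝ)))
      simpa [y] using this
    have h1 : 0 < bary a b e m := by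
      simp only [m, bary_lineMap, bary_self he, bary_left]; norm_num
    have h2 : 0 < bary b e a m := by
      simp only [m, bary_lineMap, bary_self he', bary_right]; norm_num
    exact (ht.eventually ((isOpen_bary_pos a b e).mem_nhds h1)).and
      (ht.eventually ((isOpen_bary_pos b e a).mem_nhds h2))
  have hpos0 : ∀ᶠ t : ℝ in 𝓝[>] 0, 0 < t := self_mem_nhdsWithin
  obtain ⟨t, ⟨h1, h2⟩, ht⟩ := ((hev c hD).and (hev d hD') |>.and hpos0).exists
  have h3 : ∀ e : Plane, cross (b - a) (e - a) ≠ 0 → bary e a b (y t) =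
      t * (cross (b - a) (c - a) / cross (b - a) (e - a)) := by
    intro e he
    have e1 : bary e a b m = 0 := by
      simp only [m, bary_lineMap, bary_left, bary_right]; norm_num
    have e2 : cross (c - a) (a - b) = cross (b - a) (c - a) := by simp [cross]; ring
    simp only [y]
    rw [bary_add_smul, e1, e2, cross_rotate b e a, cross_rotate a b e, zero_add]
  have hy : y t ∈ {x | 0 < bary a b c x ∧ 0 < bary b c a x ∧ 0 < bary c a b x} := by
    refine ⟨h1.1, h1.2, ?_⟩
    rw [h3 c hD, div_self hD]; simpa using ht
  refine Set.disjoint_left.1 hdisj hy ⟨h2.1, h2.2, ?_⟩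
  rw [h3 d hD']
  refine mul_pos ht ?_
  rw [← mul_div_mul_right _ _ hD']
  exact div_pos hpos (mul_self_pos.2 hD')

/-- A neighbourhood of the relative interior of the edge `a b` shared by the triangles `a b c` and
`a b d`. -/
def edgeNhd (a b c d : Plane) : Set Plane :=
  ({x | 0 < bary a b c x} ∩ {x | 0 < bary b c a x}) ∩
    ({x | 0 < bary a b d x} ∩ {x | 0 < bary b d a x})

theorem isOpen_edgeNhd (a b c d : Plane) : IsOpen (edgeNhd a b c d) :=
  ((isOpen_bary_pos a b c).inter (isOpen_bary_pos b c a)).inter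
    ((isOpen_bary_pos a b d).inter (isOpen_bary_pos b d a))

theorem lineMap_mem_edgeNhd {a b c d : Plane} (hD : cross (b - a) (c - a) ≠ 0)
    (hD' : cross (b - a) (d - a) ≠ 0) {r : ℝ} (hr : r ∈ Ioo (0 : ℝ) 1) :
    AffineMap.lineMap a b r ∈ edgeNhd a b c d := by
  have hmem : ∀ e : Plane, cross (b - a) (e - a) ≠ 0 →
      AffineMap.lineMap a b r ∈ {x | 0 < bary a b e x} ∩ {x | 0 < bary b e a x} := by
    intro e he
    have he' : cross (e - b) (a - b) ≠ 0 := by rwa [cross_rotate a b e]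
    constructor
    · change 0 < bary a b e _
      rw [bary_lineMap, bary_self he, bary_left]; linarith [hr.2]
    · change 0 < bary b e a _
      rw [bary_lineMap, bary_self he', bary_right]; linarith [hr.1]
  exact ⟨hmem c hD, hmem d hD'⟩

theorem edgeNhd_subset {s t : Finset Plane} (hs : s ∈ 𝒯.cells) (ht : t ∈ 𝒯.cells)
    (hst : s ≠ t) {a b c d : Plane} (hsc : (s : Set Plane) = {a, b, c})
    (htd : (t : Set Plane) = {a, b, d}) : edgeNhd a b c d ⊆ hull s ∪ hull t := by
  have hD := 𝒯.cross_ne_zero hs hsc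
  have hD' := 𝒯.cross_ne_zero ht htd
  have hneg := 𝒯.cross_mul_cross_neg hs ht hst hsc htd
  rw [hull_triple hsc, hull_triple htd, convexHull_triangle hD, convexHull_triangle hD']
  rintro x ⟨⟨h1, h2⟩, h3, h4⟩
  have e1 : bary c a b x = cross (a - x) (b - x) / cross (b - a) (c - a) := by
    rw [bary, cross_rotate b c a, cross_rotate a b c]
  have e2 : bary d a b x = cross (a - x) (b - x) / cross (b - a) (d - a) := by
    rw [bary, cross_rotate b d a, cross_rotate a b d]
  by_cases h5 : 0 ≤ bary c a b x
  · exact Or.inl ⟨le_of_lt h1, le_of_lt h2, h5⟩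
  · refine Or.inr ⟨le_of_lt h3, le_of_lt h4, ?_⟩
    rw [e1, not_le, div_neg_iff] at h5
    rw [e2]
    rcases h5 with ⟨h6, h7⟩ | ⟨h6, h7⟩
    · exact (div_pos h6 (by nlinarith)).le
    · exact (div_pos_of_neg_of_neg h6 (by nlinarith)).le

theorem edgeNhd_subset_domain (hΩ : IsLipschitzDomain Ω) {s t : Finset Plane} (hs : s ∈ 𝒯.cells)
    (ht : t ∈ 𝒯.cells) (hst : s ≠ t) {a b c d : Plane} (hsc : (s : Set Plane) = {a, b, c})
    (htd : (t : Set Plane) = {a, b, d}) : edgeNhd a b c d ⊆ Ω := by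
  refine Subset.trans (interior_maximal ?_ (isOpen_edgeNhd a b c d))
    hΩ.interior_closure_subset
  refine (𝒯.edgeNhd_subset hs ht hst hsc htd).trans (union_subset ?_ ?_) <;> rw [← 𝒯.covers]
  · exact subset_biUnion_of_mem (u := fun s => hull s) hs
  · exact subset_biUnion_of_mem (u := fun s => hull s) ht

end Triangulation

/-- Integration by parts on a triangle against a smooth function that vanishes on two edges. -/
theorem HasTrace.integral_mul_of_vanish {a b c : Plane} (hD : cross (b - a) (c - a) ≠ 0)
    {s e : Finset Plane} (hs : (s : Set Plane) = {a, b, c}) (he : (e : Set Plane) = {a, b})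
    {w g φ : Plane → ℝ} (hw : MemH1 (interior (hull s)) w) (hg : HasTrace s e w g)
    (hφ : ContDiff ℝ ∞ φ) (h₂ : ∀ x ∈ segment ℝ b c, φ x = 0) (h₃ : ∀ x ∈ segment ℝ c a, φ x = 0) :
    (∫ x in interior (hull s), inner ℝ (weakGrad (interior (hull s)) w x) (φ x • rot (b - a))) +
        ∫ x in interior (hull s), inner ℝ (w x) (inner ℝ (gradient φ x) (rot (b - a))) =
      -SignType.sign (cross (b - a) (c - a)) * ‖b - a‖ ^ 2 *
        ∫ r in (0 : ℝ)..1, g (AffineMap.lineMap a b r) * φ (AffineMap.lineMap a b r) := by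
  obtain ⟨ψ, hψ, -⟩ := hg.exists_h1Limit
  have hT : interior (hull s) = interior (convexHull ℝ {a, b, c}) := by rw [hull_triple hs]
  have hφc := hφ.continuous
  have hgc := continuous_gradient hφ
  have hl : Continuous fun s : ℝ => AffineMap.lineMap (k := ℝ) a b s :=
    AffineMap.lineMap_continuous
  have m1 : MemLp (fun x => φ x • rot (b - a)) 2 (volume.restrict (interior (hull s))) := by
    rw [hT]; exact memLp_triangle (by fun_prop)
  have m2 : MemLp (fun x => inner ℝ (gradient φ x) (rot (b - a))) 2
      (volume.restrict (interior (hull s))) := by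
    rw [hT]; exact memLp_triangle (by fun_prop)
  have t1 := tendsto_integral_inner (hasWeakGrad_weakGrad hw.2).1
    (fun m => by rw [hT]; exact memLp_triangle (continuous_gradient (hψ.1 m))) m1 hψ.2.2
  have t2 := tendsto_integral_inner hw.1
    (fun m => by rw [hT]; exact memLp_triangle (hψ.1 m).continuous) m2 hψ.2.1
  have t3 := tendsto_integral_inner ((memLp_edgeMeasure_iff (ne_of_cross_ne hD) he).1 hg.1)
    (fun m => memLp_unit ((hψ.1 m).continuous.comp hl)) (memLp_unit (hφc.comp hl))
    (hg.tendsto hD hs he hw hψ)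
  have e3 : ∀ f : Plane → ℝ, ∫ r, inner ℝ (f (AffineMap.lineMap a b r))
      ((φ ∘ fun s : ℝ => AffineMap.lineMap (k := ℝ) a b s) r) ∂unitMeasure =
        ∫ r in (0 : ℝ)..1, f (AffineMap.lineMap a b r) * φ (AffineMap.lineMap a b r) := by
    intro f
    rw [intervalIntegral.integral_of_le zero_le_one]
    simp [mul_comm]
  rw [e3] at t3
  refine tendsto_nhds_unique (t1.add t2) ((t3.const_mul _).congr fun m => ?_)
  have hψm := hψ.1 m
  -- apply Green's formula to `ψ m * φ` and a linear function
  have hlin : ContDiff ℝ ∞ fun x : Plane => inner ℝ (b - a) x :=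
    contDiff_const.inner ℝ contDiff_id
  have hlg : ∀ x : Plane, gradient (fun x : Plane => inner ℝ (b - a) x) x = b - a := by
    intro x
    refine ext_inner_right ℝ fun d => ?_
    rw [← fderiv_eq_inner_gradient]
    exact congrArg (fun L : Plane →L[ℝ] ℝ => L d) (innerSL ℝ (b - a)).hasFDerivAt.fderiv
  have hlf : ∀ x d : Plane, fderiv ℝ (fun x : Plane => inner ℝ (b - a) x) x d =
      inner ℝ (b - a) d := by
    intro x d; rw [fderiv_eq_inner_gradient, hlg]
  have G := integral_inner_gradient_rot_gradient hD (hψm.mul hφ) hlin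
  have hz : ∀ x y : Plane, (∀ z ∈ segment ℝ x y, φ z = 0) →
      lineInt x y (fun x => ψ m x * φ x) (fun x : Plane => inner ℝ (b - a) x) = 0 := by
    intro x y hxy
    refine (intervalIntegral.integral_congr fun r hr => ?_).trans
      intervalIntegral.integral_zero
    rw [uIcc_of_le zero_le_one] at hr
    have : (AffineMap.lineMap x y r : Plane) ∈ segment ℝ x y := by
      rw [segment_eq_image_lineMap]; exact mem_image_of_mem _ hr
    simp only [hxy _ this, mul_zero, zero_mul]
  have hi1 : IntegrableOn (fun x => inner ℝ (gradient (ψ m) x) (φ x • rot (b - a)))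
      (interior (convexHull ℝ {a, b, c})) :=
    integrableOn_triangle ((continuous_gradient hψm).inner (by fun_prop))
  have hi2 : IntegrableOn (fun x => inner ℝ (ψ m x) (inner ℝ (gradient φ x) (rot (b - a))))
      (interior (convexHull ℝ {a, b, c})) :=
    integrableOn_triangle (hψm.continuous.inner (by fun_prop))
  have e4 : ∀ x, inner ℝ (gradient (fun x => ψ m x * φ x) x)
      (rot (gradient (fun x : Plane => inner ℝ (b - a) x) x)) =
      inner ℝ (gradient (ψ m) x) (φ x • rot (b - a)) +
        inner ℝ (ψ m x) (inner ℝ (gradient φ x) (rot (b - a))) := by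
    intro x
    rw [hlg, ← fderiv_eq_inner_gradient, fderiv_fun_mul (hψm.differentiable (by simp) x)
      (hφ.differentiable (by simp) x), inner_smul_right, ← fderiv_eq_inner_gradient,
      ← fderiv_eq_inner_gradient]
    simp
    ring
  simp only [e4] at G
  rw [integral_add hi1 hi2, hz b c h₂, hz c a h₃] at G
  have e5 := e3 (ψ m)
  simp only [Function.comp_apply] at e5 ⊢
  rw [hT, G, e5, lineInt, mul_assoc]
  simp only [hlf, real_inner_self_eq_norm_sq, intervalIntegral.integral_mul_const, add_zero]
  ring

/-! ### Agreement of traces -/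

theorem HasTrace.ae_eq {a b c : Plane} (hD : cross (b - a) (c - a) ≠ 0)
    {s e : Finset Plane} (hs : (s : Set Plane) = {a, b, c}) (he : (e : Set Plane) = {a, b})
    {v g g' : Plane → ℝ} (hv : MemH1 (interior (hull s)) v) (hg : HasTrace s e v g)
    (hg' : HasTrace s e v g') : g =ᵐ[edgeMeasure e] g' := by
  obtain ⟨ψ, hψ, -⟩ := hg.exists_h1Limit
  have hab := ne_of_cross_ne hD
  have h1 := hg.tendsto hD hs he hv hψ
  have h2 := hg'.tendsto hD hs he hv hψ
  have m1 := (memLp_edgeMeasure_iff hab he).1 hg.1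
  have m2 := (memLp_edgeMeasure_iff hab he).1 hg'.1
  have hm : ∀ m, AEStronglyMeasurable (fun s : ℝ => ψ m (AffineMap.lineMap a b s))
      unitMeasure := fun m =>
    (memLp_unit ((hψ.1 m).continuous.comp AffineMap.lineMap_continuous)).1
  have h3 : ∀ {f : ℝ → ℝ} {p : ℕ → ℝ → ℝ},
      Tendsto (fun m => eLpNorm (fun s => p m s - f s) 2 unitMeasure) atTop (𝓝 0) →
      Tendsto (fun m => eLpNorm (fun s => f s - p m s) 2 unitMeasure) atTop (𝓝 0) := by
    intro f p h
    refine h.congr fun m => ?_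
    rw [← eLpNorm_neg]; congr 1; ext s; simp
  have h4 := tendsto_eLpNorm_sub (v := fun s : ℝ => (0 : ℝ))
    (f := fun m (s : ℝ) => g (AffineMap.lineMap a b s) - ψ m (AffineMap.lineMap a b s))
    (g := fun m (s : ℝ) => g' (AffineMap.lineMap a b s) - ψ m (AffineMap.lineMap a b s))
    (by simpa using h3 h1) (by simpa using h3 h2) (fun m => m1.1.sub (hm m))
    (fun m => m2.1.sub (hm m)) aestronglyMeasurable_const
  simp only [sub_sub_sub_cancel_right] at h4
  have h5 := tendsto_nhds_unique tendsto_const_nhds h4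
  have h6 : eLpNorm ((fun s : ℝ => g (AffineMap.lineMap a b s)) -
      fun s : ℝ => g' (AffineMap.lineMap a b s)) 2 unitMeasure = 0 := h5
  rw [eLpNorm_eq_zero_iff (m1.1.sub m2.1) (by norm_num)] at h6
  refine (ae_edgeMeasure_iff hab he).2 ?_
  filter_upwards [h6] with x hx
  exact sub_eq_zero.1 hx

theorem edgeTrace_ae_eq {a b c : Plane} (hD : cross (b - a) (c - a) ≠ 0)
    {s e : Finset Plane} (hs : (s : Set Plane) = {a, b, c}) (he : (e : Set Plane) = {a, b})
    {v g : Plane → ℝ} (hv : MemH1 (interior (hull s)) v) (hg : HasTrace s e v g) :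
    edgeTrace s e v =ᵐ[edgeMeasure e] g := by
  have h : ∃ g, HasTrace s e v g := ⟨g, hg⟩
  rw [edgeTrace, dif_pos h]
  exact h.choose_spec.ae_eq hD hs he hv hg

/-- The weak gradient annihilates constant vector fields times test functions. -/
theorem HasWeakGrad.integral_inner_add {U : Set Plane} {w : Plane → ℝ} {G : Plane → Plane}
    (hw : MemLp w 2 (volume.restrict U)) (hG : HasWeakGrad U w G) {φ : Plane → ℝ}
    (hφ : IsTest U φ) (d : Plane) :
    ∫ x in U, (inner ℝ (G x) (φ x • d) + inner ℝ (w x) (inner ℝ (gradient φ x) d)) = 0 := by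
  have h1 : Integrable (fun x => φ x • G x) (volume.restrict U) :=
    memLp_one_iff_integrable.1 (hG.1.smul (hφ.memLp _))
  have hg : MemLp (gradient φ) 2 (volume.restrict U) :=
    (continuous_gradient hφ.1).memLp_of_hasCompactSupport
      (hφ.2.1.of_isClosed_subset (isClosed_tsupport _) (tsupport_gradient_subset φ))
  have h2 : Integrable (fun x => w x • gradient φ x) (volume.restrict U) :=
    memLp_one_iff_integrable.1 (hg.smul hw)
  have h3 := hG.2 φ hφ
  have e : ∀ x, inner ℝ (G x) (φ x • d) + inner ℝ (w x) (inner ℝ (gradient φ x) d) =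
      inner ℝ d (φ x • G x + w x • gradient φ x) := by
    intro x
    rw [inner_add_right, inner_smul_right, inner_smul_right, inner_smul_right,
      real_inner_comm d (G x), real_inner_comm d (gradient φ x)]
    simp [mul_comm]
  have h4 : ∫ x in U, inner ℝ d (φ x • G x + w x • gradient φ x) =
      inner ℝ d (∫ x in U, (φ x • G x + w x • gradient φ x)) := integral_inner (h1.add h2) d
  simp only [e]
  rw [h4, integral_add h1 h2, h3, add_neg_cancel, inner_zero_right]

variable {Ω : Set Plane} (𝒯 : Triangulation Ω)

/-- An integrand that lives on two triangles; their boundaries are null sets. -/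
theorem Triangulation.setIntegral_eq_add {s t : Finset Plane} (hs : s ∈ 𝒯.cells)
    (ht : t ∈ 𝒯.cells) (hst : s ≠ t) (hΩ : IsLipschitzDomain Ω) {F : Plane → ℝ}
    (hF : IntegrableOn F Ω) (h0 : ∀ x, x ∉ hull s ∪ hull t → F x = 0) :
    ∫ x in Ω, F x = (∫ x in interior (hull s), F x) + ∫ x in interior (hull t), F x := by
  have hs' := 𝒯.interior_hull_subset hΩ hs
  have ht' := 𝒯.interior_hull_subset hΩ ht
  rw [← setIntegral_union (𝒯.disjoint_interior_hull hs ht hst) isOpen_interior.measurableSet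
    (hF.mono_set hs') (hF.mono_set ht')]
  refine setIntegral_eq_of_subset_of_ae_sdiff_eq_zero hΩ.isOpen.measurableSet.nullMeasurableSet
    (union_subset hs' ht') ?_
  have hn : ∀ u : Finset Plane, ∀ᵐ x : Plane, x ∉ frontier (hull u) := fun u =>
    measure_eq_zero_iff_ae_notMem.1 ((convex_convexHull ℝ (u : Set Plane)).addHaar_frontier volume)
  filter_upwards [hn s, hn t] with x h1 h2 h3
  refine h0 x fun h4 => ?_
  rcases h4 with h4 | h4
  · exact h1 ⟨subset_closure h4, fun h5 => h3.2 (Or.inl h5)⟩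
  · exact h2 ⟨subset_closure h4, fun h5 => h3.2 (Or.inr h5)⟩

/-- The traces of an `H¹(Ω)` function from both sides of an edge shared by two triangles agree. Test
the weak gradient on `Ω` with `φ • d`, where `d` is normal to the edge and `φ` is supported near the
open edge, and integrate by parts on both triangles. -/
theorem Triangulation.hasTrace_ae_eq (hΩ : IsLipschitzDomain Ω) {s t e : Finset Plane}
    (hs : s ∈ 𝒯.cells) (ht : t ∈ 𝒯.cells) (hst : s ≠ t) {a b c d : Plane}
    (hsc : (s : Set Plane) = {a, b, c}) (htd : (t : Set Plane) = {a, b, d})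
    (he : (e : Set Plane) = {a, b}) {w g g' : Plane → ℝ} (hw : MemH1 Ω w)
    (hg : HasTrace s e w g) (hg' : HasTrace t e w g') : g =ᵐ[edgeMeasure e] g' := by
  have hD := 𝒯.cross_ne_zero hs hsc
  have hD' := 𝒯.cross_ne_zero ht htd
  have hneg := 𝒯.cross_mul_cross_neg hs ht hst hsc htd
  have hab := ne_of_cross_ne hD
  have hs' := 𝒯.interior_hull_subset hΩ hs
  have ht' := 𝒯.interior_hull_subset hΩ ht
  have hsub := 𝒯.edgeNhd_subset hs ht hst hsc htd
  have hsubΩ := 𝒯.edgeNhd_subset_domain hΩ hs ht hst hsc htd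
  have m1 := (memLp_edgeMeasure_iff hab he).1 hg.1
  have m2 := (memLp_edgeMeasure_iff hab he).1 hg'.1
  have hL : 0 < dist a b := dist_pos.2 hab
  have hfin : IsFiniteMeasure (edgeMeasure e) := by
    refine ⟨lt_top_iff_ne_top.2 fun h => hL.ne' ?_⟩
    rw [← edgeLength_eq hab he, edgeLength, measureReal_def, h, ENNReal.toReal_top]
  have hsm : MemLp (g - g') 2 (edgeMeasure e) := hg.1.sub hg'.1
  have key := (isOpen_edgeNhd a b c d).ae_eq_zero_of_integral_contDiff_smul_eq_zero
    (μ := edgeMeasure e) (f := g - g')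
    ((hsm.locallyIntegrable (by norm_num)).locallyIntegrableOn _) ?_
  · rw [ae_edgeMeasure_iff hab he] at key
    refine (ae_edgeMeasure_iff hab he).2 ?_
    have hne : ∀ᵐ r : ℝ ∂unitMeasure, r ≠ 1 :=
      ae_restrict_of_ae (Measure.ae_ne volume 1)
    filter_upwards [key, hne, ae_restrict_mem measurableSet_Ioc] with r h1 h2 h3
    exact sub_eq_zero.1 (h1 (lineMap_mem_edgeNhd hD hD' ⟨h3.1, lt_of_le_of_ne h3.2 h2⟩))
  intro φ hφ1 hφ2 hφ3
  have hφ : IsTest Ω φ := ⟨hφ1, hφ2, hφ3.trans hsubΩ⟩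
  have hz : ∀ x, x ∉ edgeNhd a b c d → φ x = 0 := fun x hx =>
    image_eq_zero_of_notMem_tsupport fun h => hx (hφ3 h)
  have hzg : ∀ x, x ∉ edgeNhd a b c d → gradient φ x = 0 := fun x hx =>
    image_eq_zero_of_notMem_tsupport fun h => hx (hφ3 (tsupport_gradient_subset φ h))
  have hseg : ∀ (f : Plane → ℝ), (∀ x y r, f (AffineMap.lineMap (k := ℝ) x y r) =
      (1 - r) * f x + r * f y) → ∀ p q, f p = 0 → f q = 0 → ∀ x ∈ segment ℝ p q, f x = 0 := by
    intro f hf p q hp hq x hx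
    rw [segment_eq_image_lineMap] at hx
    obtain ⟨r, -, rfl⟩ := hx
    rw [hf, hp, hq]; ring
  have hvan : ∀ u, u = c ∨ u = d →
      (∀ x ∈ segment ℝ b u, φ x = 0) ∧ ∀ x ∈ segment ℝ u a, φ x = 0 := by
    intro u hu
    constructor <;> intro x hx <;> refine hz x ?_
    · have h1 := hseg (bary a b u) (fun x y r => bary_lineMap x y r) b u bary_left bary_right x hx
      rintro ⟨⟨h2, -⟩, h3, -⟩
      rcases hu with rfl | rfl
      · exact absurd h1 (ne_of_gt h2)
      · exact absurd h1 (ne_of_gt h3)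
    · have h1 := hseg (bary b u a) (fun x y r => bary_lineMap x y r) u a bary_left bary_right x hx
      rintro ⟨⟨-, h2⟩, -, h3⟩
      rcases hu with rfl | rfl
      · exact absurd h1 (ne_of_gt h2)
      · exact absurd h1 (ne_of_gt h3)
  have I1 := hg.integral_mul_of_vanish hD hsc he (hw.mono hs') hφ1 (hvan c (Or.inl rfl)).1
    (hvan c (Or.inl rfl)).2
  have I2 := hg'.integral_mul_of_vanish hD' htd he (hw.mono ht') hφ1 (hvan d (Or.inr rfl)).1
    (hvan d (Or.inr rfl)).2
  have hG := hasWeakGrad_weakGrad hw.2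
  have hgr : MemLp (gradient φ) 2 (volume.restrict Ω) :=
    (continuous_gradient hφ1).memLp_of_hasCompactSupport
      (hφ2.of_isClosed_subset (isClosed_tsupport _) (tsupport_gradient_subset φ))
  have n1 : MemLp (fun x => φ x • rot (b - a)) 2 (volume.restrict Ω) :=
    (hφ1.continuous.smul continuous_const).memLp_of_hasCompactSupport hφ2.smul_right
  have n2 : MemLp (fun x => inner ℝ (gradient φ x) (rot (b - a))) 2 (volume.restrict Ω) :=
    hgr.inner_const _
  have i1 : IntegrableOn (fun x => inner ℝ (weakGrad Ω w x) (φ x • rot (b - a))) Ω :=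
    integrable_inner hG.1 n1
  have i2 : IntegrableOn (fun x => inner ℝ (w x) (inner ℝ (gradient φ x) (rot (b - a)))) Ω :=
    integrable_inner hw.1 n2
  have I3 := hG.integral_inner_add hw.1 hφ (rot (b - a))
  have i3 : IntegrableOn (fun x => inner ℝ (weakGrad Ω w x) (φ x • rot (b - a)) +
      inner ℝ (w x) (inner ℝ (gradient φ x) (rot (b - a)))) Ω := i1.add i2
  rw [𝒯.setIntegral_eq_add hs ht hst hΩ i3] at I3
  swap
  · intro x hx
    have hx' : x ∉ edgeNhd a b c d := fun h => hx (hsub h)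
    simp [hz x hx', hzg x hx']
  have hcell : ∀ u : Finset Plane, interior (hull u) ⊆ Ω →
      ∫ x in interior (hull u), (inner ℝ (weakGrad Ω w x) (φ x • rot (b - a)) +
        inner ℝ (w x) (inner ℝ (gradient φ x) (rot (b - a)))) =
      (∫ x in interior (hull u), inner ℝ (weakGrad (interior (hull u)) w x) (φ x • rot (b - a))) +
        ∫ x in interior (hull u), inner ℝ (w x) (inner ℝ (gradient φ x) (rot (b - a))) := by
    intro u hu
    rw [integral_add (i1.mono_set hu) (i2.mono_set hu)]
    congr 1
    refine integral_congr_ae ?_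
    filter_upwards [weakGrad_ae_eq isOpen_interior hu hw] with x hx
    rw [hx]
  rw [hcell s hs', hcell t ht', I1, I2] at I3
  have hba : ‖b - a‖ ^ 2 ≠ 0 := pow_ne_zero 2 (norm_ne_zero_iff.2 (sub_ne_zero.2 hab.symm))
  have hI : (∫ r in (0 : ℝ)..1, g (AffineMap.lineMap a b r) * φ (AffineMap.lineMap a b r)) =
      ∫ r in (0 : ℝ)..1, g' (AffineMap.lineMap a b r) * φ (AffineMap.lineMap a b r) := by
    rcases mul_neg_iff.1 hneg with ⟨h1, h2⟩ | ⟨h1, h2⟩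
    · rw [sign_pos h1, sign_neg h2] at I3
      refine mul_left_cancel₀ hba ?_
      simp at I3
      linarith
    · rw [sign_neg h1, sign_pos h2] at I3
      refine mul_left_cancel₀ hba ?_
      simp at I3
      linarith
  rw [integral_edgeMeasure hab he]
  have hl : MemLp (fun r : ℝ => φ (AffineMap.lineMap a b r)) 2 unitMeasure :=
    memLp_unit (hφ1.continuous.comp AffineMap.lineMap_continuous)
  have hint : ∀ {f : ℝ → ℝ}, MemLp f 2 unitMeasure → IntervalIntegrable
      (fun r => f r * φ (AffineMap.lineMap a b r)) volume 0 1 := fun hf =>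
    (intervalIntegrable_iff_integrableOn_Ioc_of_le zero_le_one).2 (hf.integrable_mul hl)
  have e1 : ∀ r : ℝ, φ (AffineMap.lineMap a b r) • (g - g') (AffineMap.lineMap a b r) =
      g (AffineMap.lineMap a b r) * φ (AffineMap.lineMap a b r) -
        g' (AffineMap.lineMap a b r) * φ (AffineMap.lineMap a b r) := fun r => by
    simp only [Pi.sub_apply, smul_eq_mul]; ring
  simp only [e1]
  rw [intervalIntegral.integral_sub (hint m1) (hint m2), hI, sub_self, mul_zero]

/-! ### Shape regularity -/

theorem sin_angle_mul (u v : Plane) :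
    Real.sin (InnerProductGeometry.angle u v) * (‖u‖ * ‖v‖) = |cross u v| := by
  rw [InnerProductGeometry.sin_angle_mul_norm_mul_norm, ← Real.sqrt_sq_eq_abs]
  congr 1
  simp only [PiLp.inner_apply, Fin.sum_univ_two, RCLike.inner_apply, conj_trivial, cross]
  ring

namespace Triangulation

variable {Ω : Set Plane} {𝒯 : Triangulation Ω}

theorem vertices_ne {s : Finset Plane} (hs : s ∈ 𝒯.cells) {a b c : Plane}
    (h : (s : Set Plane) = {a, b, c}) : a ≠ b ∧ b ≠ c ∧ a ≠ c := by
  have hD := 𝒯.cross_ne_zero hs h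
  have hD₂ : cross (c - b) (a - b) ≠ 0 := by rwa [cross_rotate a b c]
  have hD₃ : cross (a - c) (b - c) ≠ 0 := by rwa [cross_rotate b c a]
  exact ⟨ne_of_cross_ne hD, ne_of_cross_ne hD₂, (ne_of_cross_ne hD₃).symm⟩

theorem AnglesGE.angle_mem {α : ℝ} (hA : 𝒯.AnglesGE α) {s : Finset Plane} (hs : s ∈ 𝒯.cells)
    {a b c : Plane} (h : (s : Set Plane) = {a, b, c}) :
    α ≤ InnerProductGeometry.angle (b - a) (c - a) ∧
      InnerProductGeometry.angle (b - a) (c - a) ≤ Real.pi - 2 * α := by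
  obtain ⟨hab, hbc, hac⟩ := vertices_ne hs h
  have ha : a ∈ s := by rw [← Finset.mem_coe, h]; simp
  have hb : b ∈ s := by rw [← Finset.mem_coe, h]; simp
  have hc : c ∈ s := by rw [← Finset.mem_coe, h]; simp
  have h1 := hA s hs b hb a ha c hc hab.symm hac hbc
  have h2 := hA s hs c hc b hb a ha hbc.symm hab.symm hac.symm
  have h3 := hA s hs a ha c hc b hb hac hbc.symm hab
  have h4 := EuclideanGeometry.angle_add_angle_add_angle_eq_pi (p₁ := a) (p₂ := b) c hab.symm
  have e1 : InnerProductGeometry.angle (b - a) (c - a) = EuclideanGeometry.angle b a c := rfl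
  rw [EuclideanGeometry.angle_comm a b c, EuclideanGeometry.angle_comm b c a,
    EuclideanGeometry.angle_comm c a b] at h4
  rw [e1]
  constructor <;> linarith

theorem AnglesGE.sin_le {α : ℝ} (hα : 0 < α) (hA : 𝒯.AnglesGE α) {s : Finset Plane}
    (hs : s ∈ 𝒯.cells) {a b c : Plane} (h : (s : Set Plane) = {a, b, c}) :
    Real.sin α * (‖b - a‖ * ‖c - a‖) ≤ |cross (b - a) (c - a)| := by
  rw [← sin_angle_mul]
  refine mul_le_mul_of_nonneg_right ?_ (by positivity)
  obtain ⟨h1, h2⟩ := hA.angle_mem hs h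
  rcases le_total (InnerProductGeometry.angle (b - a) (c - a)) (Real.pi / 2) with h3 | h3
  · exact Real.sin_le_sin_of_le_of_le_pi_div_two (by linarith) h3 h1
  · rw [← Real.sin_pi_sub (InnerProductGeometry.angle (b - a) (c - a))]
    exact Real.sin_le_sin_of_le_of_le_pi_div_two (by linarith) (by linarith) (by linarith)

/-- All edges of a shape regular triangle are controlled by its area. -/
theorem AnglesGE.norm_sq_le {α : ℝ} (hα : 0 < α) (hα' : α ≤ Real.pi / 3) (hA : 𝒯.AnglesGE α)
    {s : Finset Plane} (hs : s ∈ 𝒯.cells) {a b c : Plane} (h : (s : Set Plane) = {a, b, c}) :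
    Real.sin α ^ 2 * ‖b - a‖ ^ 2 ≤ |cross (b - a) (c - a)| := by
  have hκ : 0 < Real.sin α := Real.sin_pos_of_pos_of_lt_pi hα (by linarith [Real.pi_pos])
  have h' : (s : Set Plane) = {c, a, b} := by rw [h, triple_rotate, triple_rotate]
  have h1 := hA.sin_le hα hs h
  have h2 := hA.sin_le hα hs h'
  have h3 : |cross (a - c) (b - c)| ≤ ‖c - a‖ * ‖b - c‖ := by
    rw [← sin_angle_mul, norm_sub_rev c a]
    exact mul_le_of_le_one_left (by positivity) (Real.sin_le_one _)
  rw [cross_rotate b c a, cross_rotate a b c] at h3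
  have h4 := hA.sin_le hα hs (h.trans (triple_rotate a b c))
  have hbc : 0 < ‖b - c‖ := norm_pos_iff.2 (sub_ne_zero.2 (vertices_ne hs h).2.1)
  rw [cross_rotate a b c, norm_sub_rev c b, norm_sub_rev a b] at h4
  have h5 : Real.sin α * ‖b - a‖ ≤ ‖c - a‖ := by
    refine le_of_mul_le_mul_right ?_ hbc
    linarith
  calc Real.sin α ^ 2 * ‖b - a‖ ^ 2 = (Real.sin α * ‖b - a‖) * (Real.sin α * ‖b - a‖) := by ring
    _ ≤ (Real.sin α * ‖b - a‖) * ‖c - a‖ := mul_le_mul_of_nonneg_left h5 (by positivity)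
    _ = Real.sin α * (‖b - a‖ * ‖c - a‖) := by ring
    _ ≤ _ := h1

theorem exists_vertices_of_mem {s : Finset Plane} (hs : s ∈ 𝒯.cells) {z : Plane} (hz : z ∈ s) :
    ∃ b c, (s : Set Plane) = {z, b, c} := by
  obtain ⟨p, q, r, h, -⟩ := 𝒯.exists_vertices hs
  have h' : (s : Set Plane) = {p, q, r} := by rw [h]; simp
  rw [← Finset.mem_coe, h'] at hz
  rcases hz with rfl | rfl | rfl
  · exact ⟨_, _, h'⟩
  · exact ⟨_, _, h'.trans (triple_rotate _ _ _)⟩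
  · exact ⟨_, _, h'.trans ((triple_rotate _ _ _).trans (triple_rotate _ _ _))⟩

theorem exists_vertices_of_pair {s : Finset Plane} (hs : s ∈ 𝒯.cells) {a b : Plane} (hab : a ≠ b)
    (ha : a ∈ s) (hb : b ∈ s) : ∃ c, (s : Set Plane) = {a, b, c} := by
  obtain ⟨p, q, h⟩ := exists_vertices_of_mem hs ha
  rw [← Finset.mem_coe, h] at hb
  rcases hb with rfl | rfl | rfl
  · exact absurd rfl hab
  · exact ⟨_, h⟩
  · exact ⟨p, by rw [h]; ext x; simp only [mem_insert_iff, mem_singleton_iff]; tauto⟩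

/-- The number of triangles of a shape regular triangulation that meet in a vertex is bounded:
homothetic copies of equal area around the vertex are disjoint and lie in a common disc. -/
theorem AnglesGE.card_le {α : ℝ} (hα : 0 < α) (hα' : α ≤ Real.pi / 3) (hA : 𝒯.AnglesGE α)
    (z : Plane) [DecidablePred fun s : Finset Plane => z ∈ s] :
    ((𝒯.cells.filter fun s => z ∈ s).card : ℝ) ≤
      2 / Real.sin α ^ 2 * volume.real (Metric.ball (0 : Plane) 1) := by
  have hκ : 0 < Real.sin α := Real.sin_pos_of_pos_of_lt_pi hα (by linarith [Real.pi_pos])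
  set S := 𝒯.cells.filter fun s => z ∈ s with hS
  rcases S.eq_empty_or_nonempty with h0 | hne
  · rw [h0]; simp only [Finset.card_empty, Nat.cast_zero]; positivity
  let A : Finset Plane → ℝ := fun s => volume.real (interior (hull s))
  obtain ⟨t, htS, ht⟩ := Finset.exists_min_image S A hne
  have hArea : ∀ s ∈ 𝒯.cells, 0 < A s := by
    intro s hs
    obtain ⟨a, b, c, h, hD⟩ := 𝒯.exists_vertices hs
    have h' : (s : Set Plane) = {a, b, c} := by rw [h]; simp
    simp only [A]
    rw [hull_triple h', volume_real_triangle hD]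
    positivity
  have hmem : ∀ s ∈ S, s ∈ 𝒯.cells ∧ z ∈ s := fun s hs => Finset.mem_filter.1 hs
  have hη : 0 < A t := hArea t (hmem t htS).1
  -- the ratio that shrinks `s` to the area of the smallest triangle
  let r : Finset Plane → ℝ := fun s => √(A t / A s)
  have hr0 : ∀ s ∈ S, 0 < r s := fun s hs =>
    Real.sqrt_pos.2 (div_pos hη (hArea s (hmem s hs).1))
  have hr1 : ∀ s ∈ S, r s ≤ 1 := fun s hs => by
    rw [← Real.sqrt_one]
    exact Real.sqrt_le_sqrt ((div_le_one (hArea s (hmem s hs).1)).2 (ht s hs))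
  let B : Finset Plane → Set Plane := fun s => AffineMap.homothety z (r s) '' interior (hull s)
  have hB : ∀ s, B s = (fun x => z + r s • (x - z)) '' interior (hull s) := by
    intro s; refine image_congr' fun x => ?_
    simp [AffineMap.homothety_apply, add_comm]
  have hBi : ∀ s ∈ S, B s ⊆ interior (hull s) := by
    intro s hs
    rw [hB]
    rintro _ ⟨x, hx, rfl⟩
    exact (convex_convexHull ℝ (s : Set Plane)).add_smul_sub_mem_interior
      (subset_convexHull ℝ _ (hmem s hs).2) hx ⟨hr0 s hs, hr1 s hs⟩
  have hBb : ∀ s ∈ S, B s ⊆ Metric.closedBall z (√(2 * A t) / Real.sin α) := by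
    intro s hs
    obtain ⟨b, c, h⟩ := exists_vertices_of_mem (hmem s hs).1 (hmem s hs).2
    have hD := 𝒯.cross_ne_zero (hmem s hs).1 h
    have hAs : 2 * A s = |cross (b - z) (c - z)| := by
      simp only [A]
      rw [hull_triple h, volume_real_triangle hD]; ring
    have key : ∀ u, Real.sin α ^ 2 * ‖u - z‖ ^ 2 ≤ 2 * A s →
        u ∈ Metric.closedBall z (√(2 * A s) / Real.sin α) := by
      intro u hu
      rw [Metric.mem_closedBall, dist_eq_norm, le_div_iff₀ hκ]
      refine Real.le_sqrt_of_sq_le ?_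
      linarith [mul_pow ‖u - z‖ (Real.sin α) 2]
    have hsub : hull s ⊆ Metric.closedBall z (√(2 * A s) / Real.sin α) := by
      rw [hull_triple h]
      refine convexHull_min ?_ (convex_closedBall _ _)
      rintro u (rfl | rfl | rfl)
      · exact Metric.mem_closedBall_self (by positivity)
      · exact key _ (by rw [hAs]; exact hA.norm_sq_le hα hα' (hmem s hs).1 h)
      · refine key _ ?_
        have h2 : (s : Set Plane) = {z, u, b} := by
          rw [h]; ext x; simp only [mem_insert_iff, mem_singleton_iff]; tauto
        rw [hAs, cross_swap, abs_neg]
        exact hA.norm_sq_le hα hα' (hmem s hs).1 h2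
    rw [hB]
    rintro _ ⟨x, hx, rfl⟩
    have h3 := hsub (interior_subset hx)
    rw [Metric.mem_closedBall, dist_eq_norm] at h3 ⊢
    rw [add_sub_cancel_left, norm_smul, Real.norm_of_nonneg (hr0 s hs).le]
    refine (mul_le_mul_of_nonneg_left h3 (hr0 s hs).le).trans (le_of_eq ?_)
    rw [← mul_div_assoc]
    simp only [r]
    rw [← Real.sqrt_mul (div_pos hη (hArea s (hmem s hs).1)).le]
    congr 2
    field_simp [(hArea s (hmem s hs).1).ne']
  have hvol : ∀ s ∈ S, volume.real (B s) = A t := by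
    intro s hs
    rw [measureReal_def, Measure.addHaar_image_homothety, ENNReal.toReal_mul,
      finrank_euclideanSpace_fin, abs_of_nonneg (by positivity),
      ENNReal.toReal_ofReal (by positivity)]
    change r s ^ 2 * A s = A t
    rw [Real.sq_sqrt (div_pos hη (hArea s (hmem s hs).1)).le]
    field_simp [(hArea s (hmem s hs).1).ne']
  have hnull : ∀ s, NullMeasurableSet (B s) volume := fun s =>
    (((convex_convexHull ℝ (s : Set Plane)).interior).affine_image _).nullMeasurableSet volume
  have hdisj : Set.Pairwise (S : Set (Finset Plane)) (Function.onFun (AEDisjoint volume) B) := by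
    intro s hs u hu hsu
    exact ((𝒯.disjoint_interior_hull (hmem s hs).1 (hmem u hu).1 hsu).mono (hBi s hs)
      (hBi u hu)).aedisjoint
  have hfin : ∀ s ∈ S, volume (B s) ≠ ⊤ := fun s hs =>
    ((measure_mono (hBb s hs)).trans_lt measure_closedBall_lt_top).ne
  have h1 : volume.real (⋃ s ∈ S, B s) = S.card * A t := by
    rw [measureReal_biUnion_finset₀ hdisj (fun s _ => hnull s) hfin, Finset.sum_congr rfl hvol,
      Finset.sum_const, nsmul_eq_mul]
  have h2 : volume.real (⋃ s ∈ S, B s) ≤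
      volume.real (Metric.closedBall z (√(2 * A t) / Real.sin α)) :=
    measureReal_mono (iUnion₂_subset hBb) measure_closedBall_lt_top.ne
  rw [h1, Measure.addHaar_real_closedBall _ _ (by positivity), finrank_euclideanSpace_fin,
    div_pow, Real.sq_sqrt (by positivity)] at h2
  refine le_of_mul_le_mul_right (h2.trans (le_of_eq ?_)) hη
  ring

end Triangulation

/-! ### Polynomials on an edge -/

/-- The polynomial with coefficients `y`. -/
noncomputable def powerSum {n : ℕ} (y : Fin n → ℝ) (s : ℝ) : ℝ := ∑ i, y i * s ^ (i : ℕ)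

/-- The polynomial with boundary values `x.1`, `x.2.1` and the bubble with coefficients `x.2.2`. -/
noncomputable def splitPoly {n : ℕ} (x : ℝ × ℝ × (Fin n → ℝ)) (s : ℝ) : ℝ :=
  (1 - s) * x.1 + s * x.2.1 + (1 - s) * s * powerSum x.2.2 s

theorem contDiff_powerSum {n : ℕ} (y : Fin n → ℝ) : ContDiff ℝ ∞ (powerSum y) := by
  unfold powerSum; fun_prop

theorem hasDerivAt_powerSum {n : ℕ} (y : Fin n → ℝ) (s : ℝ) :
    HasDerivAt (powerSum y) (∑ i, y i * ((i : ℕ) * s ^ ((i : ℕ) - 1))) s := by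
  unfold powerSum
  exact HasDerivAt.fun_sum fun i _ => (hasDerivAt_pow (i : ℕ) s).const_mul (y i)

theorem abs_powerSum_le {n : ℕ} (y : Fin n → ℝ) {s : ℝ} (hs : s ∈ Icc (0 : ℝ) 1) :
    |powerSum y s| ≤ n * ‖y‖ := by
  refine (Finset.abs_sum_le_sum_abs _ _).trans ?_
  have : ∀ i ∈ Finset.univ, |y i * s ^ (i : ℕ)| ≤ ‖y‖ := by
    intro i _
    rw [abs_mul, abs_pow, abs_of_nonneg hs.1]
    exact (mul_le_of_le_one_right (abs_nonneg _) (pow_le_one₀ hs.1 hs.2)).trans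
      (norm_le_pi_norm y i)
  refine (Finset.sum_le_sum this).trans ?_
  simp

theorem abs_deriv_powerSum_le {n : ℕ} (y : Fin n → ℝ) {s : ℝ} (hs : s ∈ Icc (0 : ℝ) 1) :
    |deriv (powerSum y) s| ≤ n * n * ‖y‖ := by
  rw [(hasDerivAt_powerSum y s).deriv]
  refine (Finset.abs_sum_le_sum_abs _ _).trans ?_
  have : ∀ i ∈ Finset.univ, |y i * ((i : ℕ) * s ^ ((i : ℕ) - 1))| ≤ n * ‖y‖ := by
    intro i _
    rw [abs_mul, abs_mul, abs_pow, abs_of_nonneg hs.1, Nat.abs_cast, mul_comm]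
    refine mul_le_mul ?_ (norm_le_pi_norm y i) (abs_nonneg _) (by positivity)
    refine (mul_le_of_le_one_right (by positivity) (pow_le_one₀ hs.1 hs.2)).trans ?_
    exact_mod_cast i.2.le
  refine (Finset.sum_le_sum this).trans ?_
  simp [mul_assoc]

theorem powerSum_eq_zero {n : ℕ} {y : Fin n → ℝ} (h : ∀ s ∈ Ioo (0 : ℝ) 1, powerSum y s = 0) :
    y = 0 := by
  let P : Polynomial ℝ := ∑ i : Fin n, Polynomial.C (y i) * Polynomial.X ^ (i : ℕ)
  have hP : ∀ s, P.eval s = powerSum y s := by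
    intro s; simp [P, powerSum, Polynomial.eval_finsetSum]
  have h0 : P = 0 := by
    refine Polynomial.eq_zero_of_infinite_isRoot P ((Ioo_infinite (zero_lt_one' ℝ)).mono ?_)
    intro s hs
    exact (hP s).trans (h s hs)
  ext i
  have h1 : P.coeff i = y i := by
    simp [P, Polynomial.coeff_X_pow, Fin.val_inj]
  rw [← h1, h0]; simp

theorem continuous_splitPoly {n : ℕ} :
    Continuous fun p : (ℝ × ℝ × (Fin n → ℝ)) × ℝ => splitPoly p.1 p.2 := by
  unfold splitPoly powerSum; fun_prop

/-- On the finite-dimensional space of polynomials all norms are equivalent. -/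
theorem exists_splitPoly_coercive (n : ℕ) : ∃ c : ℝ, 0 < c ∧ ∀ x : ℝ × ℝ × (Fin n → ℝ),
    c * ‖x‖ ^ 2 ≤ ∫ s in (0 : ℝ)..1, splitPoly x s ^ 2 := by
  let F : ℝ × ℝ × (Fin n → ℝ) → ℝ := fun x => ∫ s in (0 : ℝ)..1, splitPoly x s ^ 2
  have hF : Continuous F :=
    intervalIntegral.continuous_parametric_intervalIntegral_of_continuous'
      (continuous_splitPoly.pow 2) 0 1
  have hpos : ∀ x, x ≠ 0 → 0 < F x := by
    intro x hx
    have hc : Continuous fun s => splitPoly x s ^ 2 :=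
      (continuous_splitPoly.comp (Continuous.prodMk_right x)).pow 2
    refine intervalIntegral.integral_pos zero_lt_one hc.continuousOn (fun s _ => sq_nonneg _) ?_
    by_contra! hcon
    have h0 : ∀ s ∈ Icc (0 : ℝ) 1, splitPoly x s = 0 := fun s hs =>
      pow_eq_zero_iff two_ne_zero |>.1 (le_antisymm (hcon s hs) (sq_nonneg _))
    have h1 : x.1 = 0 := by simpa [splitPoly] using h0 0 (by simp)
    have h2 : x.2.1 = 0 := by simpa [splitPoly] using h0 1 (by simp)
    have h3 : x.2.2 = 0 := powerSum_eq_zero fun s hs => by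
      have h4 := h0 s ⟨hs.1.le, hs.2.le⟩
      rw [splitPoly, h1, h2, mul_zero, mul_zero, add_zero, zero_add] at h4
      exact (mul_eq_zero.1 h4).resolve_left (mul_pos (by linarith [hs.2]) hs.1).ne'
    exact hx (Prod.ext h1 (Prod.ext h2 h3))
  have hhom : ∀ (t : ℝ) x, F (t • x) = t ^ 2 * F x := by
    intro t x
    simp only [F]
    rw [← intervalIntegral.integral_const_mul]
    refine intervalIntegral.integral_congr fun s _ => ?_
    have : splitPoly (t • x) s = t * splitPoly x s := by
      simp only [splitPoly, powerSum, Prod.smul_fst, Prod.smul_snd, Pi.smul_apply, smul_eq_mul,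
        mul_assoc, ← Finset.mul_sum]
      ring
    simp only [this]; ring
  -- minimize the quadratic form over the unit sphere
  obtain ⟨x₀, hx₀, hmin⟩ := (isCompact_sphere (0 : ℝ × ℝ × (Fin n → ℝ)) 1).exists_isMinOn
    (NormedSpace.sphere_nonempty.2 zero_le_one) hF.continuousOn
  have hx₀' : x₀ ≠ 0 := by
    rintro rfl; simp at hx₀
  refine ⟨F x₀, hpos x₀ hx₀', fun x => ?_⟩
  by_cases hx : x = 0
  · rw [hx, norm_zero, zero_pow two_ne_zero, mul_zero]
    exact intervalIntegral.integral_nonneg zero_le_one fun s _ => sq_nonneg _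
  · have hxn : 0 < ‖x‖ := norm_pos_iff.2 hx
    have h1 : ‖x‖⁻¹ • x ∈ Metric.sphere (0 : ℝ × ℝ × (Fin n → ℝ)) 1 := by
      rw [mem_sphere_zero_iff_norm, norm_smul, norm_inv, norm_norm, inv_mul_cancel₀ hxn.ne']
    have h2 : F x₀ ≤ F (‖x‖⁻¹ • x) := hmin h1
    rw [hhom, inv_pow, inv_mul_eq_div, le_div_iff₀ (by positivity)] at h2
    exact h2

/-- Every polynomial splits into an affine part and a bubble. -/
theorem exists_splitPoly {m : ℕ} {Q : Polynomial ℝ} (hQ : Q.natDegree ≤ m + 1) :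
    ∃ x : ℝ × ℝ × (Fin (m + 2) → ℝ), ∀ s, Q.eval s = splitPoly x s := by
  let R : Polynomial ℝ := Q - (Polynomial.C (Q.eval 0) * (1 - Polynomial.X) +
    Polynomial.C (Q.eval 1) * Polynomial.X)
  have hR : R.natDegree ≤ m + 1 := by
    refine (Polynomial.natDegree_sub_le_of_le hQ (n := m + 1) ?_).trans (by simp)
    refine (Polynomial.natDegree_add_le_of_degree_le (n := 1) ?_ ?_).trans (by omega)
    · refine (Polynomial.natDegree_C_mul_le _ _).trans ?_
      refine (Polynomial.natDegree_sub_le _ _).trans (by simp)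
    · exact (Polynomial.natDegree_C_mul_le _ _).trans (by simp)
  have h0 : R.eval 0 = 0 := by simp [R]
  have h1 : R.eval 1 = 0 := by simp [R]
  obtain ⟨R₁, hR₁⟩ := Polynomial.dvd_iff_isRoot.2 h0
  have h2 : R₁.eval 1 = 0 := by
    rw [hR₁] at h1; simpa using h1
  obtain ⟨R₂, hR₂⟩ := Polynomial.dvd_iff_isRoot.2 h2
  have hdeg : R₂.natDegree < m + 2 := by
    by_cases hz : R₂ = 0
    · rw [hz]; simp
    · have h3 : R.natDegree = 1 + (1 + R₂.natDegree) := by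
        rw [hR₁, hR₂, Polynomial.natDegree_mul (Polynomial.X_sub_C_ne_zero _)
          (mul_ne_zero (Polynomial.X_sub_C_ne_zero _) hz),
          Polynomial.natDegree_mul (Polynomial.X_sub_C_ne_zero _) hz,
          Polynomial.natDegree_X_sub_C, Polynomial.natDegree_X_sub_C]
      omega
  refine ⟨(Q.eval 0, Q.eval 1, fun i => -R₂.coeff i), fun s => ?_⟩
  have h4 : Q.eval s = R.eval s + (Q.eval 0 * (1 - s) + Q.eval 1 * s) := by simp [R]
  have h5 : powerSum (fun i : Fin (m + 2) => -R₂.coeff i) s = -R₂.eval s := by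
    rw [Polynomial.eval_eq_sum_range' hdeg, Finset.sum_range, powerSum, ← Finset.sum_neg_distrib]
    exact Finset.sum_congr rfl fun i _ => by ring
  rw [h4, hR₁, hR₂, splitPoly, h5]
  simp only [Polynomial.eval_mul, Polynomial.eval_sub, Polynomial.eval_X, Polynomial.eval_C]
  ring

/-- A polynomial in two variables as a function on the plane. -/
noncomputable def polyFun (p : MvPolynomial (Fin 2) ℝ) (x : Plane) : ℝ :=
  MvPolynomial.eval (fun i => x i) p

theorem contDiff_polyFun (p : MvPolynomial (Fin 2) ℝ) : ContDiff ℝ ∞ (polyFun p) := by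
  unfold polyFun
  induction p using MvPolynomial.induction_on with
  | C r => simpa using contDiff_const
  | add p q hp hq => simpa using hp.add hq
  | mul_X p i hp =>
    simp only [map_mul, MvPolynomial.eval_X]
    exact hp.mul (by fun_prop)

theorem exists_splitPoly_polyFun {m : ℕ} {p : MvPolynomial (Fin 2) ℝ}
    (hp : p.totalDegree ≤ m + 1) (a b : Plane) : ∃ x : ℝ × ℝ × (Fin (m + 2) → ℝ),
      ∀ s, polyFun p (AffineMap.lineMap a b s) = splitPoly x s := by
  let f : Fin 2 → Polynomial ℝ := fun i =>
    Polynomial.C (a i) + Polynomial.X * Polynomial.C (b i - a i)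
  have hf : ∀ i, (f i).natDegree ≤ 1 := by
    intro i
    refine (Polynomial.natDegree_add_le _ _).trans (max_le (by simp) ?_)
    exact (Polynomial.natDegree_mul_C_le _ _).trans (by simp)
  have hdeg : (MvPolynomial.aeval f p).natDegree ≤ m + 1 := by
    have := MvPolynomial.aeval_natDegree_le p hp f hf
    simpa using this
  obtain ⟨x, hx⟩ := exists_splitPoly hdeg
  refine ⟨x, fun s => ?_⟩
  rw [← hx s, polyFun, MvPolynomial.aeval_def, ← Polynomial.coe_evalRingHom,
    MvPolynomial.hom_eval₂, MvPolynomial.eval, MvPolynomial.coe_eval₂Hom]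
  congr 1
  · ext r; simp
  · ext i; simp [f, AffineMap.lineMap_apply]; ring

/-! ### Estimates on a single triangle -/

/-- The norm of the weak gradient of `w` on the triangle `s`. -/
noncomputable def cellNorm (s : Finset Plane) (w : Plane → ℝ) : ℝ :=
  (eLpNorm (weakGrad (interior (hull s)) w) 2 (volume.restrict (interior (hull s)))).toReal

theorem cellNorm_nonneg (s : Finset Plane) (w : Plane → ℝ) : 0 ≤ cellNorm s w :=
  ENNReal.toReal_nonneg

theorem abs_cross_le (u v : Plane) : |cross u v| ≤ ‖u‖ * ‖v‖ := by
  rw [← sin_angle_mul]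
  exact mul_le_of_le_one_left (by positivity) (Real.sin_le_one _)

theorem norm_gradient_le {h : Plane → ℝ} {x : Plane} {B : ℝ} (hB : 0 ≤ B)
    (h' : ∀ d, |fderiv ℝ h x d| ≤ B * ‖d‖) : ‖gradient h x‖ ≤ B := by
  rw [gradient, LinearIsometryEquiv.norm_map]
  exact ContinuousLinearMap.opNorm_le_bound _ hB h'

section

variable {a b c : Plane} (hD : cross (b - a) (c - a) ≠ 0)
include hD

theorem abs_integral_inner_rot_gradient_le {s : Finset Plane} (hs : (s : Set Plane) = {a, b, c})
    {w h : Plane → ℝ} (hw : MemH1 (interior (hull s)) w) (hh : ContDiff ℝ ∞ h) {B : ℝ}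
    (hB : 0 ≤ B) (hB' : ∀ x ∈ interior (hull s), ‖gradient h x‖ ≤ B) :
    |∫ x in interior (hull s), inner ℝ (weakGrad (interior (hull s)) w x) (rot (gradient h x))| ≤
      cellNorm s w * (B * √(|cross (b - a) (c - a)| / 2)) := by
  have hT : interior (hull s) = interior (convexHull ℝ {a, b, c}) := by rw [hull_triple hs]
  have m0 : MemLp (gradient h) 2 (volume.restrict (interior (hull s))) := by
    rw [hT]; exact memLp_triangle (continuous_gradient hh)
  have m1 : MemLp (fun x => rot (gradient h x)) 2 (volume.restrict (interior (hull s))) :=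
    memLp_rot m0
  have m2 : MemLp (weakGrad (interior (hull s)) w) 2 (volume.restrict (interior (hull s))) :=
    (hasWeakGrad_weakGrad hw.2).1
  refine (abs_integral_inner_le m2 m1).trans ?_
  refine mul_le_mul_of_nonneg_left ?_ (cellNorm_nonneg s w)
  refine abs_le_of_sq_le_sq' ?_ (by positivity) |>.2
  rw [eLpNorm_two_sq_toReal m1, mul_pow, Real.sq_sqrt (by positivity), ← volume_real_triangle hD,
    ← hT]
  have hfin : volume (interior (hull s)) < ⊤ := by
    rw [hT]
    exact (((isBounded_convexHull).2 (Set.toFinite {a, b, c}).isBounded).subset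
      interior_subset).measure_lt_top
  have := norm_setIntegral_le_of_norm_le_const (f := fun x => ‖rot (gradient h x)‖ ^ 2) hfin
    (C := B ^ 2) fun x hx => by
      rw [norm_rot, Real.norm_of_nonneg (by positivity)]
      exact pow_le_pow_left₀ (norm_nonneg _) (hB' x hx) 2
  exact (le_abs_self _).trans this

/-- The gradient of a barycentric coordinate is at most the reciprocal of the square root of the
area, up to the shape regularity constant `κ`. -/
theorem abs_fderiv_bary_le {κ : ℝ} (hκ : 0 < κ)
    (h : κ ^ 2 * ‖b - c‖ ^ 2 ≤ |cross (b - a) (c - a)|) (x d : Plane) :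
    |fderiv ℝ (bary a b c) x d| ≤ (κ * √|cross (b - a) (c - a)|)⁻¹ * ‖d‖ := by
  have hD' : 0 < |cross (b - a) (c - a)| := abs_pos.2 hD
  have hr : 0 < √|cross (b - a) (c - a)| := Real.sqrt_pos.2 hD'
  rw [fderiv_bary, abs_div, div_le_iff₀ hD']
  have h1 : κ * ‖b - c‖ ≤ √|cross (b - a) (c - a)| := Real.le_sqrt_of_sq_le (by rwa [mul_pow])
  calc |cross d (b - c)| ≤ ‖d‖ * ‖b - c‖ := abs_cross_le _ _
    _ ≤ ‖d‖ * (√|cross (b - a) (c - a)| / κ) :=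
      mul_le_mul_of_nonneg_left ((le_div_iff₀ hκ).2 (by linarith)) (norm_nonneg d)
    _ = _ := by
      nth_rewrite 3 [← Real.mul_self_sqrt hD'.le]
      field_simp

/-- The averages of the traces of an `H¹` function over two edges of a triangle differ by at most the
energy: Green's formula with a barycentric coordinate gives the difference of the averages. -/
theorem HasTrace.abs_integral_sub_le {κ : ℝ} (hκ : 0 < κ)
    (hbc : κ ^ 2 * ‖b - c‖ ^ 2 ≤ |cross (b - a) (c - a)|) {s e₁ e₃ : Finset Plane}
    (hs : (s : Set Plane) = {a, b, c}) (he₁ : (e₁ : Set Plane) = {a, b})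
    (he₃ : (e₃ : Set Plane) = {c, a}) {w g₁ g₃ : Plane → ℝ} (hw : MemH1 (interior (hull s)) w)
    (h₁ : HasTrace s e₁ w g₁) (h₃ : HasTrace s e₃ w g₃) :
    |(∫ r in (0 : ℝ)..1, g₁ (AffineMap.lineMap a b r)) -
      ∫ r in (0 : ℝ)..1, g₃ (AffineMap.lineMap c a r)| ≤ κ⁻¹ * cellNorm s w := by
  classical
  have hD₂ : cross (c - b) (a - b) ≠ 0 := by rwa [cross_rotate a b c]
  obtain ⟨g₂, h₂⟩ := exists_hasTrace hD₂ (hs.trans (triple_rotate a b c))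
    (e := {b, c}) (by simp) hw
  have hG := h₁.green hD hs he₁ (e₂ := {b, c}) (by simp) he₃ hw h₂ h₃ (contDiff_bary a b c)
  have hl : ∀ (p q : Plane) (g : Plane → ℝ), lineInt p q g (bary a b c) =
      cross (q - p) (b - c) / cross (b - a) (c - a) *
        ∫ r in (0 : ℝ)..1, g (AffineMap.lineMap p q r) := by
    intro p q g
    simp only [lineInt, fderiv_bary]
    rw [intervalIntegral.integral_mul_const, mul_comm]
  have e1 : cross (b - a) (b - c) = -cross (b - a) (c - a) := by simp [cross]; ring
  have e2 : cross (c - b) (b - c) = 0 := by simp [cross]; ring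
  have e3 : cross (a - c) (b - c) = cross (b - a) (c - a) := by simp [cross]; ring
  rw [hl, hl, hl, e1, e2, e3, neg_div, div_self hD, zero_div] at hG
  have hr : 0 < √|cross (b - a) (c - a)| := Real.sqrt_pos.2 (abs_pos.2 hD)
  have hle := abs_integral_inner_rot_gradient_le hD hs hw (contDiff_bary a b c)
    (B := (κ * √|cross (b - a) (c - a)|)⁻¹) (by positivity)
    fun x _ => norm_gradient_le (by positivity) (abs_fderiv_bary_le hD hκ hbc x)
  rw [hG] at hle
  have hsgn : |(SignType.sign (cross (b - a) (c - a)) : ℝ)| = 1 := by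
    rcases lt_or_gt_of_ne hD with h | h
    · rw [sign_neg h]; simp
    · rw [sign_pos h]; simp
  rw [abs_mul, abs_neg, hsgn, one_mul] at hle
  calc _ = |-1 * (∫ r in (0 : ℝ)..1, g₁ (AffineMap.lineMap a b r)) +
        0 * (∫ r in (0 : ℝ)..1, g₂ (AffineMap.lineMap b c r)) +
        1 * ∫ r in (0 : ℝ)..1, g₃ (AffineMap.lineMap c a r)| := by
        rw [← abs_neg]; congr 1; ring
    _ ≤ _ := hle
    _ ≤ _ := by
      rw [mul_comm κ⁻¹]
      refine mul_le_mul_of_nonneg_left ?_ (cellNorm_nonneg s w)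
      rw [mul_inv, mul_assoc]
      refine mul_le_of_le_one_right (by positivity) ?_
      rw [inv_mul_le_iff₀ hr, mul_one]
      exact Real.sqrt_le_sqrt (by linarith [abs_nonneg (cross (b - a) (c - a))])

/-- A bubble function on an edge extends to the triangle with controlled gradient. -/
theorem HasTrace.abs_lineInt_bubble_le {κ : ℝ} (hκ : 0 < κ)
    (hbc : κ ^ 2 * ‖b - c‖ ^ 2 ≤ |cross (b - a) (c - a)|)
    (hca : κ ^ 2 * ‖c - a‖ ^ 2 ≤ |cross (b - a) (c - a)|) {s e : Finset Plane}
    (hs : (s : Set Plane) = {a, b, c}) (he : (e : Set Plane) = {a, b})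
    {w g : Plane → ℝ} (hw : MemH1 (interior (hull s)) w)
    (hg : HasTrace s e w g) {M : ℝ → ℝ} (hM : ContDiff ℝ ∞ M) {K : ℝ} (hK : 0 ≤ K)
    (hM0 : ∀ r ∈ Icc (0 : ℝ) 1, |M r| ≤ K) (hM1 : ∀ r ∈ Icc (0 : ℝ) 1, |deriv M r| ≤ K) :
    |lineInt a b g fun x => bary a b c x * bary b c a x * M (bary b c a x)| ≤
      3 * κ⁻¹ * K * cellNorm s w := by
  classical
  have hD₂ : cross (c - b) (a - b) ≠ 0 := by rwa [cross_rotate a b c]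
  have hD₃ : cross (a - c) (b - c) ≠ 0 := by rwa [cross_rotate b c a]
  obtain ⟨g₂, h₂⟩ := exists_hasTrace hD₂ (hs.trans (triple_rotate a b c))
    (e := {b, c}) (by simp) hw
  obtain ⟨g₃, h₃⟩ := exists_hasTrace hD₃
    (hs.trans ((triple_rotate a b c).trans (triple_rotate b c a))) (e := {c, a}) (by simp) hw
  set R : Plane → ℝ := fun x => bary a b c x * bary b c a x * M (bary b c a x) with hR
  have hRc : ContDiff ℝ ∞ R :=
    ((contDiff_bary a b c).mul (contDiff_bary b c a)).mul (hM.comp (contDiff_bary b c a))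
  -- `R` vanishes on the other two edges, so that only the given edge contributes
  have hG := hg.green hD hs he (e₂ := {b, c}) (by simp) (e₃ := {c, a}) (by simp) hw h₂ h₃ hRc
  have hz : ∀ p q : Plane, (∀ r : ℝ, R (AffineMap.lineMap p q r) = 0) → ∀ f, lineInt p q f R = 0 := by
    intro p q hpq f
    refine (intervalIntegral.integral_congr fun r _ => ?_).trans intervalIntegral.integral_zero
    have h1 := hasDerivAt_lineMap hRc p q r
    simp only [hpq] at h1
    simp only [h1.unique (hasDerivAt_const r 0), mul_zero]
  rw [hz b c (fun r => by simp [hR, bary_lineMap]), hz c a (fun r => by simp [hR, bary_lineMap]),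
    add_zero, add_zero] at hG
  have hr : 0 < √|cross (b - a) (c - a)| := Real.sqrt_pos.2 (abs_pos.2 hD)
  set β := (κ * √|cross (b - a) (c - a)|)⁻¹ with hβ
  have hβ0 : 0 ≤ β := by positivity
  have hgrad : ∀ x ∈ interior (hull s), ‖gradient R x‖ ≤ 3 * K * β := by
    intro x hx
    rw [hull_triple hs, interior_triangle hD] at hx
    obtain ⟨p1, p2, p3⟩ := hx
    have hsum := bary_sum hD x
    set u := bary a b c x
    set v := bary b c a x
    have hv : v ∈ Icc (0 : ℝ) 1 := ⟨p2.le, by linarith⟩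
    refine norm_gradient_le (by positivity) fun d => ?_
    have d1 : HasFDerivAt (bary a b c) (fderiv ℝ (bary a b c) x) x :=
      ((contDiff_bary a b c).differentiable (by simp) x).hasFDerivAt
    have d2 : HasFDerivAt (bary b c a) (fderiv ℝ (bary b c a) x) x :=
      ((contDiff_bary b c a).differentiable (by simp) x).hasFDerivAt
    have d3 : HasDerivAt M (deriv M v) v := (hM.differentiable (by simp) v).hasDerivAt
    have d4 := (d1.mul d2).mul (d3.comp_hasFDerivAt x d2)
    have d5 : fderiv ℝ R x d = u * v * (deriv M v * fderiv ℝ (bary b c a) x d) +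
        M v * (u * fderiv ℝ (bary b c a) x d + v * fderiv ℝ (bary a b c) x d) := by
      refine (congrArg (fun L : Plane →L[ℝ] ℝ => L d) d4.fderiv).trans ?_
      simp [u, v]
      ring
    have b1 := abs_fderiv_bary_le hD hκ hbc x d
    have b2 := abs_fderiv_bary_le hD₂ hκ (by rwa [cross_rotate a b c]) x d
    rw [cross_rotate a b c] at b2
    have k0 := hM0 v hv
    have k1 := hM1 v hv
    have u1 : |u| ≤ 1 := by rw [abs_of_pos p1]; linarith
    have v1 : |v| ≤ 1 := by rw [abs_of_pos p2]; linarith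
    have hd : 0 ≤ β * ‖d‖ := by positivity
    rw [d5]
    calc _ ≤ |u| * |v| * (|deriv M v| * |fderiv ℝ (bary b c a) x d|) +
          |M v| * (|u| * |fderiv ℝ (bary b c a) x d| + |v| * |fderiv ℝ (bary a b c) x d|) := by
          refine (abs_add_le _ _).trans ?_
          rw [abs_mul, abs_mul, abs_mul, abs_mul (M v)]
          gcongr
          refine (abs_add_le _ _).trans ?_
          rw [abs_mul, abs_mul]
      _ ≤ 1 * 1 * (K * (β * ‖d‖)) + K * (1 * (β * ‖d‖) + 1 * (β * ‖d‖)) := by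
          gcongr
      _ = 3 * K * β * ‖d‖ := by ring
  have hle := abs_integral_inner_rot_gradient_le hD hs hw hRc (by positivity) hgrad
  have hsgn : |(SignType.sign (cross (b - a) (c - a)) : ℝ)| = 1 := by
    rcases lt_or_gt_of_ne hD with h | h
    · rw [sign_neg h]; simp
    · rw [sign_pos h]; simp
  rw [hG, abs_mul, abs_neg, hsgn, one_mul] at hle
  refine hle.trans ?_
  have h1 : β * √(|cross (b - a) (c - a)| / 2) ≤ κ⁻¹ := by
    rw [hβ, mul_inv, mul_assoc]
    refine mul_le_of_le_one_right (by positivity) ?_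
    rw [inv_mul_le_iff₀ hr, mul_one]
    exact Real.sqrt_le_sqrt (by linarith [abs_nonneg (cross (b - a) (c - a))])
  calc cellNorm s w * (3 * K * β * √(|cross (b - a) (c - a)| / 2))
      = cellNorm s w * (3 * K) * (β * √(|cross (b - a) (c - a)| / 2)) := by ring
    _ ≤ cellNorm s w * (3 * K) * κ⁻¹ :=
      mul_le_mul_of_nonneg_left h1 (mul_nonneg (cellNorm_nonneg s w) (by positivity))
    _ = _ := by ring

end

/-- The `L²` norm of `q` on the unit parametrization of the segment from `a` to `b`. -/
noncomputable def segNorm (a b : Plane) (q : Plane → ℝ) : ℝ :=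
  √(∫ r in (0 : ℝ)..1, q (AffineMap.lineMap a b r) ^ 2)

/-- The tangential derivative of a polynomial `q` on an edge acts on the trace `g` of an `H¹`
function like the difference of the end point values times the average of `g`, up to terms
controlled by the norm of `q` and the energy on an adjacent triangle; the end point values are
also controlled by the norm of `q`. -/
theorem exists_edge_estimate (m : ℕ) {κ : ℝ} (hκ : 0 < κ) : ∃ C : ℝ, 0 < C ∧
    ∀ p : MvPolynomial (Fin 2) ℝ, p.totalDegree ≤ m + 1 → ∀ a b : Plane,
      |polyFun p a| ≤ C * segNorm a b (polyFun p) ∧ |polyFun p b| ≤ C * segNorm a b (polyFun p) ∧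
      ∀ c, cross (b - a) (c - a) ≠ 0 → κ ^ 2 * ‖b - c‖ ^ 2 ≤ |cross (b - a) (c - a)| →
        κ ^ 2 * ‖c - a‖ ^ 2 ≤ |cross (b - a) (c - a)| → ∀ s e : Finset Plane,
        (s : Set Plane) = {a, b, c} → (e : Set Plane) = {a, b} → ∀ w g : Plane → ℝ,
        MemH1 (interior (hull s)) w → HasTrace s e w g →
        |lineInt a b g (polyFun p) - (polyFun p b - polyFun p a) *
          ∫ r in (0 : ℝ)..1, g (AffineMap.lineMap a b r)| ≤
            C * segNorm a b (polyFun p) * cellNorm s w := by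
  obtain ⟨c₀, hc₀, hco⟩ := exists_splitPoly_coercive (m + 2)
  let n : ℝ := (m + 2 : ℕ)
  have hn : 1 ≤ n := by simp only [n]; push_cast; linarith [(Nat.cast_nonneg m : (0 : ℝ) ≤ m)]
  let C₁ : ℝ := (√c₀)⁻¹
  have hc₁ : 0 < √c₀ := Real.sqrt_pos.2 hc₀
  have hC₁ : 0 < C₁ := inv_pos.2 hc₁
  refine ⟨C₁ + 3 * κ⁻¹ * (n * n * C₁), by positivity, fun p hp a b => ?_⟩
  obtain ⟨x, hx⟩ := exists_splitPoly_polyFun hp a b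
  have hseg : ‖x‖ ≤ C₁ * segNorm a b (polyFun p) := by
    rw [← div_eq_inv_mul, le_div_iff₀ hc₁]
    refine Real.le_sqrt_of_sq_le ?_
    rw [mul_pow, Real.sq_sqrt hc₀.le]
    simp only [hx]
    linarith [hco x]
  have hs0 : 0 ≤ segNorm a b (polyFun p) := Real.sqrt_nonneg _
  have hle : C₁ * segNorm a b (polyFun p) ≤
      (C₁ + 3 * κ⁻¹ * (n * n * C₁)) * segNorm a b (polyFun p) := by
    refine mul_le_mul_of_nonneg_right ?_ hs0
    have : 0 ≤ 3 * κ⁻¹ * (n * n * C₁) := by positivity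
    linarith
  have ha : polyFun p a = x.1 := by simpa [splitPoly] using hx 0
  have hb : polyFun p b = x.2.1 := by simpa [splitPoly] using hx 1
  refine ⟨?_, ?_, ?_⟩
  · rw [ha]; exact (norm_fst_le x).trans (hseg.trans hle)
  · rw [hb]; exact ((norm_fst_le x.2).trans (norm_snd_le x)).trans (hseg.trans hle)
  intro c hD hbc hca s e hs he w g hw hg
  have hab := ne_of_cross_ne hD
  have hD₂ : cross (c - b) (a - b) ≠ 0 := by rwa [cross_rotate a b c]
  have hy : ‖x.2.2‖ ≤ C₁ * segNorm a b (polyFun p) :=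
    ((norm_snd_le x.2).trans (norm_snd_le x)).trans hseg
  have hK : 0 ≤ n * n * ‖x.2.2‖ := by positivity
  have hbub := hg.abs_lineInt_bubble_le hD hκ hbc hca hs he hw (contDiff_powerSum x.2.2) hK
    (fun r hr => (abs_powerSum_le x.2.2 hr).trans (mul_le_mul_of_nonneg_right
      (le_mul_of_one_le_left (by positivity) hn) (norm_nonneg _)))
    (fun r hr => abs_deriv_powerSum_le x.2.2 hr)
  set R : Plane → ℝ := fun x' => bary a b c x' * bary b c a x' * powerSum x.2.2 (bary b c a x')
    with hR
  have hRc : ContDiff ℝ ∞ R := ((contDiff_bary a b c).mul (contDiff_bary b c a)).mul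
    ((contDiff_powerSum x.2.2).comp (contDiff_bary b c a))
  have hRs : ∀ r : ℝ, polyFun p (AffineMap.lineMap a b r) =
      (1 - r) * x.1 + r * x.2.1 + R (AffineMap.lineMap a b r) := by
    intro r
    rw [hx, splitPoly]
    simp only [hR, bary_lineMap, bary_self hD, bary_self hD₂, bary_left, bary_right]
    simp
  have hder : ∀ r : ℝ, fderiv ℝ (polyFun p) (AffineMap.lineMap a b r) (b - a) =
      (x.2.1 - x.1) + fderiv ℝ R (AffineMap.lineMap a b r) (b - a) := by
    intro r
    have h1 := hasDerivAt_lineMap (contDiff_polyFun p) a b r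
    have h2 := hasDerivAt_lineMap hRc a b r
    have h3 : HasDerivAt (fun r : ℝ => (1 - r) * x.1 + r * x.2.1) (x.2.1 - x.1) r := by
      have := (((hasDerivAt_id r).const_sub 1).mul_const x.1).add
        ((hasDerivAt_id r).mul_const x.2.1)
      refine this.congr_deriv ?_
      ring
    refine h1.unique ((h3.add h2).congr_of_eventuallyEq (Eventually.of_forall fun r => ?_))
    exact hRs r
  have m1 := (memLp_edgeMeasure_iff hab he).1 hg.1
  have i1 : IntervalIntegrable (fun r => g (AffineMap.lineMap a b r)) volume 0 1 :=
    (intervalIntegrable_iff_integrableOn_Ioc_of_le zero_le_one).2 (m1.integrable (by norm_num))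
  have i2 : IntervalIntegrable (fun r => g (AffineMap.lineMap a b r) *
      fderiv ℝ R (AffineMap.lineMap a b r) (b - a)) volume 0 1 :=
    (intervalIntegrable_iff_integrableOn_Ioc_of_le zero_le_one).2
      (m1.integrable_mul (memLp_unit (continuous_fderiv_lineMap hRc a b)))
  have hsplit : lineInt a b g (polyFun p) = (polyFun p b - polyFun p a) *
      (∫ r in (0 : ℝ)..1, g (AffineMap.lineMap a b r)) + lineInt a b g R := by
    rw [lineInt, lineInt, ha, hb, ← intervalIntegral.integral_const_mul,
      ← intervalIntegral.integral_add (i1.const_mul _) i2]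
    refine intervalIntegral.integral_congr fun r _ => ?_
    simp only [hder]
    ring
  rw [hsplit, add_sub_cancel_left]
  refine hbub.trans ?_
  refine mul_le_mul_of_nonneg_right ?_ (cellNorm_nonneg s w)
  calc 3 * κ⁻¹ * (n * n * ‖x.2.2‖)
      ≤ 3 * κ⁻¹ * (n * n * (C₁ * segNorm a b (polyFun p))) := by gcongr
    _ = (3 * κ⁻¹ * (n * n * C₁)) * segNorm a b (polyFun p) := by ring
    _ ≤ _ := mul_le_mul_of_nonneg_right (by linarith) hs0

/-! ### Flows on finite graphs -/

/-- Let `J` be the divergence of a flow `c` on a finite multigraph with links `a i — b i`, and let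
`m` be a potential that vanishes on `N` and whose jump along the link `i` is at most `G i`.  Then
`∑ J * m` is controlled by the divergence outside of `N` and the jumps: subtracting from `m` a
function that is constant on each component does not change the sum, since the total divergence in
a component vanishes. -/
theorem abs_sum_divergence_mul_le {V ι : Type*} [Fintype V] [DecidableEq V] (S : Finset ι)
    (a b : ι → V) (c G : ι → ℝ) (m : V → ℝ) (hG : ∀ i ∈ S, |m (a i) - m (b i)| ≤ G i)
    (N : Set V) [DecidablePred (· ∈ N)] (hN : ∀ e ∈ N, m e = 0) (J : V → ℝ)
    (hJ : ∀ e, J e = ∑ i ∈ S, ((if a i = e then c i else 0) - if b i = e then c i else 0)) :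
    |∑ e, J e * m e| ≤
      (∑ e with e ∉ N, |J e|) * (Fintype.card V * ∑ i ∈ S, G i) := by
  classical
  have hG0 : ∀ i ∈ S, 0 ≤ G i := fun i hi => (abs_nonneg _).trans (hG i hi)
  have hsum0 : 0 ≤ ∑ i ∈ S, G i := Finset.sum_nonneg hG0
  let Γ : SimpleGraph V := SimpleGraph.fromRel fun e f => ∃ i ∈ S, a i = e ∧ b i = f
  have hstep : ∀ e f, Γ.Adj e f → |m e - m f| ≤ ∑ i ∈ S, G i := by
    intro e f h
    rw [SimpleGraph.fromRel_adj] at h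
    rcases h.2 with ⟨i, hi, rfl, rfl⟩ | ⟨i, hi, rfl, rfl⟩
    · exact (hG i hi).trans (Finset.single_le_sum hG0 hi)
    · rw [abs_sub_comm]; exact (hG i hi).trans (Finset.single_le_sum hG0 hi)
  have hwalk : ∀ {e f : V} (p : Γ.Walk e f), |m e - m f| ≤ p.length * ∑ i ∈ S, G i := by
    intro e f p
    induction p with
    | nil => simp
    | @cons u v w h p ih =>
      rw [SimpleGraph.Walk.length_cons, Nat.cast_add, Nat.cast_one, add_mul, one_mul]
      have := abs_sub_le (m u) (m v) (m w)
      linarith [hstep u v h]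
  have hreach : ∀ {e f : V}, Γ.Reachable e f →
      |m e - m f| ≤ Fintype.card V * ∑ i ∈ S, G i := by
    intro e f h
    obtain ⟨p, hp⟩ := h.exists_isPath
    refine (hwalk p).trans (mul_le_mul_of_nonneg_right ?_ hsum0)
    exact_mod_cast hp.length_lt.le
  -- a representative in every component, if possible in `N`
  have hrep : ∀ k : Γ.ConnectedComponent, ∃ r, Γ.connectedComponentMk r = k ∧
      ∀ e ∈ N, Γ.connectedComponentMk e = k → r ∈ N := by
    intro k
    by_cases h : ∃ e ∈ N, Γ.connectedComponentMk e = k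
    · obtain ⟨e, he, hk⟩ := h
      exact ⟨e, hk, fun _ _ _ => he⟩
    · obtain ⟨e, he⟩ := k.exists_rep
      exact ⟨e, he, fun f hf hk => absurd ⟨f, hf, hk⟩ h⟩
  choose r hr hrN using hrep
  -- the function that is constant on components
  let h : V → ℝ := fun e => m (r (Γ.connectedComponentMk e))
  have hJh : ∑ e, J e * h e = 0 := by
    have h1 : ∀ e, J e * h e = ∑ i ∈ S, ((if a i = e then c i * h e else 0) -
        if b i = e then c i * h e else 0) := by
      intro e
      rw [hJ, Finset.sum_mul]
      refine Finset.sum_congr rfl fun i _ => ?_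
      split_ifs <;> ring
    simp only [h1]
    rw [Finset.sum_comm]
    refine Finset.sum_eq_zero fun i hi => ?_
    rw [Finset.sum_sub_distrib, Finset.sum_ite_eq, Finset.sum_ite_eq, if_pos (Finset.mem_univ _),
      if_pos (Finset.mem_univ _), sub_eq_zero]
    suffices heq : h (a i) = h (b i) by rw [heq]
    by_cases hab : a i = b i
    · rw [hab]
    · have hadj : Γ.Adj (a i) (b i) :=
        (SimpleGraph.fromRel_adj _ _ _).2 ⟨hab, Or.inl ⟨i, hi, rfl, rfl⟩⟩
      simp only [h, SimpleGraph.ConnectedComponent.sound hadj.reachable]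
  have h2 : ∑ e, J e * m e = ∑ e, J e * (m e - h e) := by
    simp only [mul_sub, Finset.sum_sub_distrib, hJh, sub_zero]
  have h3 : ∀ e, e ∈ N → J e * (m e - h e) = 0 := by
    intro e he
    have : h e = 0 := hN _ (hrN _ e he rfl)
    rw [hN e he, this, sub_zero, mul_zero]
  rw [h2, ← Finset.sum_filter_add_sum_filter_not Finset.univ (· ∈ N),
    Finset.sum_eq_zero fun e he => h3 e (Finset.mem_filter.1 he).2, zero_add, Finset.sum_mul]
  refine (Finset.abs_sum_le_sum_abs _ _).trans (Finset.sum_le_sum fun e _ => ?_)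
  rw [abs_mul]
  refine mul_le_mul_of_nonneg_left (hreach ?_) (abs_nonneg _)
  exact SimpleGraph.ConnectedComponent.exact (hr _).symm

/-! ### Summation around the vertices -/

/-- The side of the oriented line from `a` to `b` on which the triangle `s` with edge `a b` lies. -/
noncomputable def side (s : Finset Plane) (a b : Plane) : ℝ :=
  SignType.sign (∑ z ∈ s, cross (b - a) (z - a))

theorem sum_triple {s : Finset Plane} {a b c : Plane} (hs : (s : Set Plane) = {a, b, c})
    (hab : a ≠ b) (hbc : b ≠ c) (hac : a ≠ c) (f : Plane → ℝ) :
    ∑ z ∈ s, f z = f a + f b + f c := by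
  classical
  have : s = {a, b, c} := by apply Finset.coe_injective; rw [hs]; simp
  rw [this, Finset.sum_insert (by simp [hab, hac]), Finset.sum_insert (by simp [hbc]),
    Finset.sum_singleton, add_assoc]

namespace Triangulation

variable {Ω : Set Plane} {𝒯 : Triangulation Ω}

theorem side_eq {s : Finset Plane} (hs : s ∈ 𝒯.cells) {a b c : Plane}
    (h : (s : Set Plane) = {a, b, c}) : side s a b = SignType.sign (cross (b - a) (c - a)) := by
  obtain ⟨hab, hbc, hac⟩ := vertices_ne hs h
  have e : cross (b - a) (a - a) + cross (b - a) (b - a) + cross (b - a) (c - a) =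
      cross (b - a) (c - a) := by simp [cross]; ring
  rw [side, sum_triple h hab hbc hac, e]

theorem side_swap {s : Finset Plane} (hs : s ∈ 𝒯.cells) {a b c : Plane}
    (h : (s : Set Plane) = {a, b, c}) : side s b a = -side s a b := by
  have h' : (s : Set Plane) = {b, a, c} := by rw [h, Set.insert_comm]
  have e : cross (a - b) (c - b) = -cross (b - a) (c - a) := cross_reverse a b c
  rw [side_eq hs h, side_eq hs h', e, Left.sign_neg]
  simp

theorem side_left_swap {s : Finset Plane} (hs : s ∈ 𝒯.cells) {a b c : Plane}
    (h : (s : Set Plane) = {a, b, c}) : side s a c = -side s a b := by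
  have h' : (s : Set Plane) = {a, c, b} := by rw [h, Set.pair_comm]
  rw [side_eq hs h, side_eq hs h', cross_swap, Left.sign_neg]
  simp

theorem mem_adj {e s : Finset Plane} : s ∈ 𝒯.adj e ↔ s ∈ 𝒯.cells ∧ e ⊆ s := by
  simp [adj]

theorem mem_edges {e : Finset Plane} : e ∈ 𝒯.edges ↔ ∃ s ∈ 𝒯.cells, e ⊆ s ∧ e.card = 2 := by
  simp [edges, Finset.mem_powersetCard]

end Triangulation

namespace Triangulation

variable {Ω : Set Plane} {𝒯 : Triangulation Ω}

open scoped Classical in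
/-- The edges of the triangulation with end point `z`. -/
noncomputable def edgesAt (𝒯 : Triangulation Ω) (z : Plane) : Finset (Finset Plane) :=
  𝒯.edges.filter fun e => z ∈ e

open scoped Classical in
/-- The triangles with vertex `z`. -/
noncomputable def cellsAt (𝒯 : Triangulation Ω) (z : Plane) : Finset (Finset Plane) :=
  𝒯.cells.filter fun s => z ∈ s

open scoped Classical in
/-- The vertices of the triangulation. -/
noncomputable def vertices (𝒯 : Triangulation Ω) : Finset Plane := 𝒯.cells.biUnion id

theorem mem_edgesAt {z : Plane} {e : Finset Plane} : e ∈ 𝒯.edgesAt z ↔ e ∈ 𝒯.edges ∧ z ∈ e := by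
  simp [edgesAt]

theorem mem_cellsAt {z : Plane} {s : Finset Plane} : s ∈ 𝒯.cellsAt z ↔ s ∈ 𝒯.cells ∧ z ∈ s := by
  simp [cellsAt]

theorem mem_vertices_of_mem {z : Plane} {e : Finset Plane} (he : e ∈ 𝒯.edges) (hz : z ∈ e) :
    z ∈ 𝒯.vertices := by
  obtain ⟨s, hs, hes, -⟩ := mem_edges.1 he
  exact Finset.mem_biUnion.2 ⟨s, hs, hes hz⟩

/-- An orientation of the edges by a choice of a first and a second end point. -/
structure EdgeEnds (𝒯 : Triangulation Ω) (x y : Finset Plane → Plane) : Prop where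
  ne : ∀ e ∈ 𝒯.edges, x e ≠ y e
  eq : ∀ e ∈ 𝒯.edges, (e : Set Plane) = {x e, y e}

theorem exists_edgeEnds (𝒯 : Triangulation Ω) : ∃ x y, 𝒯.EdgeEnds x y := by
  classical
  have : ∀ e : Finset Plane, ∃ p : Plane × Plane, e ∈ 𝒯.edges →
      p.1 ≠ p.2 ∧ (e : Set Plane) = {p.1, p.2} := by
    intro e
    by_cases he : e ∈ 𝒯.edges
    · obtain ⟨s, -, -, hc⟩ := mem_edges.1 he
      obtain ⟨a, b, hab, rfl⟩ := Finset.card_eq_two.1 hc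
      exact ⟨(a, b), fun _ => ⟨hab, by simp⟩⟩
    · exact ⟨0, fun h => absurd h he⟩
  choose p hp using this
  exact ⟨fun e => (p e).1, fun e => (p e).2, ⟨fun e he => (hp e he).1, fun e he => (hp e he).2⟩⟩

namespace EdgeEnds

variable {x y : Finset Plane → Plane} (hxy : 𝒯.EdgeEnds x y)
include hxy

theorem left_mem {e : Finset Plane} (he : e ∈ 𝒯.edges) : x e ∈ e := by
  rw [← Finset.mem_coe, hxy.eq e he]; simp

theorem right_mem {e : Finset Plane} (he : e ∈ 𝒯.edges) : y e ∈ e := by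
  rw [← Finset.mem_coe, hxy.eq e he]; simp

theorem mem_iff {e : Finset Plane} (he : e ∈ 𝒯.edges) {z : Plane} : z ∈ e ↔ z = x e ∨ z = y e := by
  rw [← Finset.mem_coe, hxy.eq e he]; simp

theorem eq_pair [DecidableEq Plane] {e : Finset Plane} (he : e ∈ 𝒯.edges) : e = {x e, y e} := by
  apply Finset.coe_injective; rw [hxy.eq e he]; simp

theorem exists_vertices {s e : Finset Plane} (he : e ∈ 𝒯.edges) (hs : s ∈ 𝒯.adj e) :
    ∃ c, (s : Set Plane) = {x e, y e, c} := by
  obtain ⟨hs', hes⟩ := mem_adj.1 hs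
  exact exists_vertices_of_pair hs' (hxy.ne e he) (hes (hxy.left_mem he)) (hes (hxy.right_mem he))

end EdgeEnds

open scoped Classical in
/-- The boundary coefficient of the oriented edge `e` at its end point `z`. -/
noncomputable def endSign (y : Finset Plane → Plane) (e : Finset Plane) (z : Plane) : ℝ :=
  if z = y e then 1 else -1

theorem EdgeEnds.endSign_mul_side {x y : Finset Plane → Plane} (hxy : 𝒯.EdgeEnds x y)
    {s e : Finset Plane} (he : e ∈ 𝒯.edges) (hs : s ∈ 𝒯.adj e) {z u : Plane}
    (h : (e : Set Plane) = {z, u}) : endSign y e z * side s (x e) (y e) = -side s z u := by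
  obtain ⟨c, hc⟩ := hxy.exists_vertices he hs
  have hs' := (mem_adj.1 hs).1
  have hz : z ∈ e := by rw [← Finset.mem_coe, h]; simp
  have hne := hxy.ne e he
  have hE := h.symm.trans (hxy.eq e he)
  have hu : ∀ {p q : Plane}, p ≠ q → ({p, u} : Set Plane) = {p, q} → u = q := by
    intro p q hpq h'
    have : q ∈ ({p, u} : Set Plane) := by rw [h']; simp
    rcases this with h1 | h1
    · exact absurd h1.symm hpq
    · exact h1.symm
  rcases (hxy.mem_iff he).1 hz with rfl | rfl
  · rw [endSign, if_neg hne, hu hne hE, neg_one_mul]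
  · rw [Set.pair_comm (x e)] at hE
    rw [endSign, if_pos rfl, hu hne.symm hE, side_swap hs' hc, one_mul, neg_neg]

/-- The contribution of one vertex `z`: a triangle with corner value `P` at `z` contributes `± P` to
its two edges at `z`, so that the jumps `q` form the divergence of a flow on the graph of edges at
`z`. -/
theorem EdgeEnds.abs_sum_edgesAt_le {x y : Finset Plane → Plane} (hxy : 𝒯.EdgeEnds x y)
    {F : Finset (Finset Plane)} (z : Plane) {P : Finset Plane → ℝ} {q m G : Finset Plane → ℝ}
    (hq : ∀ e ∈ 𝒯.edgesAt z, q e = ∑ s ∈ 𝒯.adj e, side s (x e) (y e) * P s)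
    (hm : ∀ e ∈ 𝒯.edges, e ∉ F → m e = 0)
    (hG : ∀ s ∈ 𝒯.cells, ∀ e ∈ 𝒯.edges, ∀ f ∈ 𝒯.edges, e ⊆ s → f ⊆ s → |m e - m f| ≤ G s) :
    |∑ e ∈ 𝒯.edgesAt z, endSign y e z * q e * m e| ≤
      (∑ e ∈ (𝒯.edgesAt z).filter (· ∈ F), |q e|) *
        ((𝒯.edgesAt z).card * ∑ s ∈ 𝒯.cellsAt z, G s) := by
  classical
  -- the two edges at `z` of every triangle with vertex `z`
  have hbc : ∀ s : Finset Plane, ∃ p : Plane × Plane, s ∈ 𝒯.cellsAt z →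
      (s : Set Plane) = {z, p.1, p.2} := by
    intro s
    by_cases hs : s ∈ 𝒯.cellsAt z
    · obtain ⟨b, c, h⟩ := exists_vertices_of_mem (mem_cellsAt.1 hs).1 (mem_cellsAt.1 hs).2
      exact ⟨(b, c), fun _ => h⟩
    · exact ⟨0, fun h => absurd h hs⟩
  choose p hp using hbc
  have hpe : ∀ s ∈ 𝒯.cellsAt z, ∀ u, u = (p s).1 ∨ u = (p s).2 →
      ({z, u} : Finset Plane) ∈ 𝒯.edgesAt z ∧ ({z, u} : Finset Plane) ⊆ s := by
    intro s hs u hu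
    have hs' := (mem_cellsAt.1 hs).1
    obtain ⟨n1, n2, n3⟩ := vertices_ne hs' (hp s hs)
    have hzu : z ≠ u := by rcases hu with rfl | rfl <;> assumption
    have hsub : ({z, u} : Finset Plane) ⊆ s := by
      rw [← Finset.coe_subset, hp s hs]
      rcases hu with rfl | rfl <;> (intro v hv; simp at hv ⊢; tauto)
    exact ⟨mem_edgesAt.2 ⟨mem_edges.2 ⟨s, hs', hsub, Finset.card_pair hzu⟩, by simp⟩, hsub⟩
  rcases (𝒯.edgesAt z).eq_empty_or_nonempty with h0 | ⟨e₀, he₀⟩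
  · simp [h0]
  let V := {e // e ∈ 𝒯.edgesAt z}
  let A : Finset Plane → V := fun s => if hs : s ∈ 𝒯.cellsAt z then
    ⟨{z, (p s).1}, (hpe s hs _ (Or.inl rfl)).1⟩ else ⟨e₀, he₀⟩
  let B : Finset Plane → V := fun s => if hs : s ∈ 𝒯.cellsAt z then
    ⟨{z, (p s).2}, (hpe s hs _ (Or.inr rfl)).1⟩ else ⟨e₀, he₀⟩
  have hA : ∀ s ∈ 𝒯.cellsAt z, (A s : Finset Plane) = {z, (p s).1} := fun s hs => by
    simp only [A, dif_pos hs]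
  have hB : ∀ s ∈ 𝒯.cellsAt z, (B s : Finset Plane) = {z, (p s).2} := fun s hs => by
    simp only [B, dif_pos hs]
  -- the edges at `z` are the nodes, the triangles at `z` are the links, the corner values the flow
  have key := abs_sum_divergence_mul_le (V := V) (𝒯.cellsAt z) A B
    (fun s => -side s z (p s).1 * P s) G (fun e => m e) ?_ {e : V | (e : Finset Plane) ∉ F} ?_
    (fun e => endSign y e z * q e) ?_
  · rw [Fintype.card_coe] at key
    have e1 : ∑ e : V, endSign y e z * q e * m e =
        ∑ e ∈ 𝒯.edgesAt z, endSign y e z * q e * m e :=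
      Finset.sum_coe_sort (𝒯.edgesAt z) fun e => endSign y e z * q e * m e
    have e2 : ∑ e : V with e ∉ {e : V | (e : Finset Plane) ∉ F}, |endSign y e z * q e| =
        ∑ e ∈ (𝒯.edgesAt z).filter (· ∈ F), |q e| := by
      rw [Finset.sum_filter, Finset.sum_filter,
        ← Finset.sum_coe_sort (𝒯.edgesAt z) fun e => if e ∈ F then |q e| else 0]
      refine Finset.sum_congr rfl fun e _ => ?_
      have : |endSign y e z| = 1 := by
        unfold endSign; split_ifs <;> simp
      simp [abs_mul, this]
    rw [e1, e2] at key
    exact key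
  · intro s hs
    refine hG s (mem_cellsAt.1 hs).1 _ (mem_edgesAt.1 (A s).2).1 _ (mem_edgesAt.1 (B s).2).1 ?_ ?_
    · rw [hA s hs]; exact (hpe s hs _ (Or.inl rfl)).2
    · rw [hB s hs]; exact (hpe s hs _ (Or.inr rfl)).2
  · intro e he
    exact hm e (mem_edgesAt.1 e.2).1 he
  · rintro ⟨e, he⟩
    obtain ⟨he1, hze⟩ := mem_edgesAt.1 he
    have hsub : 𝒯.adj e ⊆ 𝒯.cellsAt z := fun s hs =>
      mem_cellsAt.2 ⟨(mem_adj.1 hs).1, (mem_adj.1 hs).2 hze⟩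
    simp only
    rw [hq e he, Finset.mul_sum]
    refine (Finset.sum_subset_zero_on_sdiff hsub ?_ ?_)
    · intro s hs
      obtain ⟨hs1, hs2⟩ := Finset.mem_sdiff.1 hs
      have hne : ∀ f : V, (f : Finset Plane) ⊆ s → f ≠ ⟨e, he⟩ := by
        rintro f hf rfl
        exact hs2 (mem_adj.2 ⟨(mem_cellsAt.1 hs1).1, hf⟩)
      rw [if_neg (hne (A s) (by rw [hA s hs1]; exact (hpe s hs1 _ (Or.inl rfl)).2)),
        if_neg (hne (B s) (by rw [hB s hs1]; exact (hpe s hs1 _ (Or.inr rfl)).2)), sub_zero]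
    · intro s hs
      have hs1 := hsub hs
      obtain ⟨hs2, hes⟩ := mem_adj.1 hs
      obtain ⟨n1, n2, n3⟩ := vertices_ne hs2 (hp s hs1)
      -- the other end point of `e`
      obtain ⟨u, hu⟩ : ∃ u, (e : Set Plane) = {z, u} := by
        rcases (hxy.mem_iff he1).1 hze with h | h
        · exact ⟨y e, by rw [h]; exact hxy.eq e he1⟩
        · exact ⟨x e, by rw [h, Set.pair_comm]; exact hxy.eq e he1⟩
      have hu' : e = {z, u} := by apply Finset.coe_injective; rw [hu]; simp
      have huz : u ≠ z := by
        rintro rfl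
        obtain ⟨t, -, -, hc⟩ := mem_edges.1 he1
        rw [hu'] at hc; simp at hc
      have hus : u ∈ (s : Set Plane) := hes (by rw [hu']; simp)
      rw [hp s hs1] at hus
      have hpair : ∀ v w : Plane, v ≠ w → v ≠ z → ({z, v} : Finset Plane) ≠ {z, w} := by
        intro v w hvw hvz h
        have : v ∈ ({z, w} : Finset Plane) := by rw [← h]; simp
        simp only [Finset.mem_insert, Finset.mem_singleton] at this
        tauto
      rw [← mul_assoc, hxy.endSign_mul_side he1 hs hu]
      rcases hus with h | h | h
      · exact absurd h huz
      · have hAe : A s = ⟨e, he⟩ := Subtype.ext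
          ((hA s hs1).trans (by rw [← h]; exact hu'.symm))
        have hBe : B s ≠ ⟨e, he⟩ := fun h' =>
          hpair _ _ n2.symm n3.symm
            ((hB s hs1).symm.trans ((congrArg Subtype.val h').trans (hu'.trans (by rw [h]))))
        rw [if_pos hAe, if_neg hBe, sub_zero, h]
      · rw [Set.mem_singleton_iff] at h
        have hBe : B s = ⟨e, he⟩ := Subtype.ext
          ((hB s hs1).trans (by rw [← h]; exact hu'.symm))
        have hAe : A s ≠ ⟨e, he⟩ := fun h' =>
          hpair _ _ n2 n1.symm
            ((hA s hs1).symm.trans ((congrArg Subtype.val h').trans (hu'.trans (by rw [h]))))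
        rw [if_pos hBe, if_neg hAe, h, side_left_swap hs2 (hp s hs1)]
        ring

theorem card_edgesAt_le (z : Plane) : (𝒯.edgesAt z).card ≤ 2 * (𝒯.cellsAt z).card := by
  classical
  have hsub : 𝒯.edgesAt z ⊆
      (𝒯.cellsAt z).biUnion fun s => (s.powersetCard 2).filter fun e => z ∈ e := by
    intro e he
    obtain ⟨he1, hz⟩ := mem_edgesAt.1 he
    obtain ⟨s, hs, hes, hc⟩ := mem_edges.1 he1
    exact Finset.mem_biUnion.2 ⟨s, mem_cellsAt.2 ⟨hs, hes hz⟩,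
      Finset.mem_filter.2 ⟨Finset.mem_powersetCard.2 ⟨hes, hc⟩, hz⟩⟩
  refine (Finset.card_le_card hsub).trans ?_
  rw [mul_comm]
  refine Finset.card_biUnion_le_card_mul _ _ _ fun s hs => ?_
  obtain ⟨hs1, hz⟩ := mem_cellsAt.1 hs
  have hsub2 : ((s.powersetCard 2).filter fun e => z ∈ e) ⊆
      (s.erase z).image fun u => ({z, u} : Finset Plane) := by
    intro e he
    obtain ⟨he1, hze⟩ := Finset.mem_filter.1 he
    obtain ⟨hes, hc⟩ := Finset.mem_powersetCard.1 he1
    obtain ⟨a, b, hab, rfl⟩ := Finset.card_eq_two.1 hc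
    simp only [Finset.mem_insert, Finset.mem_singleton] at hze
    rcases hze with rfl | rfl
    · exact Finset.mem_image.2 ⟨b, Finset.mem_erase.2 ⟨hab.symm, hes (by simp)⟩, rfl⟩
    · exact Finset.mem_image.2 ⟨a, Finset.mem_erase.2 ⟨hab, hes (by simp)⟩, Finset.pair_comm _ _⟩
  refine (Finset.card_le_card hsub2).trans (Finset.card_image_le.trans ?_)
  rw [Finset.card_erase_of_mem hz, 𝒯.card_eq s hs1]

/-- The end point values of the jumps, tested with edge averages: the corner values `P` of a
triangle cancel around every vertex up to the jumps `q`. -/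
theorem EdgeEnds.abs_sum_le {x y : Finset Plane → Plane} (hxy : 𝒯.EdgeEnds x y)
    {F : Finset (Finset Plane)} (hF : F ⊆ 𝒯.edges) {P q : Finset Plane → Plane → ℝ}
    {m G Y : Finset Plane → ℝ} {N : ℝ} (hN : ∀ z, ((𝒯.cellsAt z).card : ℝ) ≤ N)
    (hq : ∀ e ∈ 𝒯.edges, ∀ z ∈ e, q e z = ∑ s ∈ 𝒯.adj e, side s (x e) (y e) * P s z)
    (hm : ∀ e ∈ 𝒯.edges, e ∉ F → m e = 0)
    (hG : ∀ s ∈ 𝒯.cells, ∀ e ∈ 𝒯.edges, ∀ f ∈ 𝒯.edges, e ⊆ s → f ⊆ s → |m e - m f| ≤ G s)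
    (hG0 : ∀ s, 0 ≤ G s) (hY : ∀ e ∈ F, ∀ z ∈ e, |q e z| ≤ Y e) :
    |∑ e ∈ F, (q e (y e) - q e (x e)) * m e| ≤
      2 * N * (√(4 * N) * √(3 * N)) * (√(∑ e ∈ F, Y e ^ 2) * √(∑ s ∈ 𝒯.cells, G s ^ 2)) := by
  classical
  have hN0 : 0 ≤ N := (Nat.cast_nonneg _).trans (hN 0)
  have h1 : ∑ e ∈ F, (q e (y e) - q e (x e)) * m e =
      ∑ z ∈ 𝒯.vertices, ∑ e ∈ 𝒯.edgesAt z, endSign y e z * q e z * m e := by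
    rw [Finset.sum_subset hF fun e he heF => by rw [hm e he heF, mul_zero]]
    have h2 : ∀ e ∈ 𝒯.edges, (q e (y e) - q e (x e)) * m e =
        ∑ z ∈ e, endSign y e z * q e z * m e := by
      intro e he
      have hs : ∑ z ∈ e, endSign y e z * q e z * m e =
          ∑ z ∈ ({x e, y e} : Finset Plane), endSign y e z * q e z * m e :=
        Finset.sum_congr (hxy.eq_pair he) fun _ _ => rfl
      rw [hs, Finset.sum_pair (hxy.ne e he), endSign, endSign, if_neg (hxy.ne e he), if_pos rfl]
      ring
    rw [Finset.sum_congr rfl h2]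
    refine Finset.sum_comm' fun e z => ?_
    rw [mem_edgesAt]
    exact ⟨fun h => ⟨h, mem_vertices_of_mem h.1 h.2⟩, fun h => h.1⟩
  let A : Plane → ℝ := fun z => ∑ e ∈ (𝒯.edgesAt z).filter (· ∈ F), Y e
  let B : Plane → ℝ := fun z => ∑ s ∈ 𝒯.cellsAt z, G s
  have hB0 : ∀ z, 0 ≤ B z := fun z => Finset.sum_nonneg fun s _ => hG0 s
  have hcard : ∀ z, ((𝒯.edgesAt z).card : ℝ) ≤ 2 * N := fun z => by
    have : ((𝒯.edgesAt z).card : ℝ) ≤ 2 * (𝒯.cellsAt z).card := by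
      exact_mod_cast card_edgesAt_le z
    linarith [hN z]
  have hA0 : ∀ z, 0 ≤ A z := fun z => Finset.sum_nonneg fun e he =>
    (abs_nonneg _).trans (hY e (Finset.mem_filter.1 he).2 z
      (mem_edgesAt.1 (Finset.mem_filter.1 he).1).2)
  have h3 : ∀ z, |∑ e ∈ 𝒯.edgesAt z, endSign y e z * q e z * m e| ≤ 2 * N * (A z * B z) := by
    intro z
    refine (hxy.abs_sum_edgesAt_le (F := F) z (P := fun s => P s z) (q := fun e => q e z)
      (fun e he => hq e (mem_edgesAt.1 he).1 z (mem_edgesAt.1 he).2) hm hG).trans ?_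
    have h4 : ∑ e ∈ (𝒯.edgesAt z).filter (· ∈ F), |q e z| ≤ A z :=
      Finset.sum_le_sum fun e he => hY e (Finset.mem_filter.1 he).2 z
        (mem_edgesAt.1 (Finset.mem_filter.1 he).1).2
    calc _ ≤ A z * (2 * N * B z) := by
          refine mul_le_mul h4 (mul_le_mul_of_nonneg_right (hcard z) (hB0 z)) ?_ (hA0 z)
          exact mul_nonneg (Nat.cast_nonneg _) (hB0 z)
      _ = _ := by ring
  have hAsum : ∑ z ∈ 𝒯.vertices, A z ^ 2 ≤ 4 * N * ∑ e ∈ F, Y e ^ 2 := by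
    have h5 : ∀ z ∈ 𝒯.vertices, A z ^ 2 ≤
        2 * N * ∑ e ∈ (𝒯.edgesAt z).filter (· ∈ F), Y e ^ 2 := fun z _ => by
      refine sq_sum_le_card_mul_sum_sq.trans ?_
      refine mul_le_mul_of_nonneg_right ?_ (Finset.sum_nonneg fun e _ => sq_nonneg _)
      refine le_trans ?_ (hcard z)
      exact_mod_cast Finset.card_filter_le _ _
    refine (Finset.sum_le_sum h5).trans (le_of_eq ?_)
    rw [← Finset.mul_sum]
    have h6 : ∑ z ∈ 𝒯.vertices, ∑ e ∈ (𝒯.edgesAt z).filter (· ∈ F), Y e ^ 2 =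
        ∑ e ∈ F, ∑ z ∈ e, Y e ^ 2 := by
      refine Finset.sum_comm' fun z e => ?_
      rw [Finset.mem_filter, mem_edgesAt]
      exact ⟨fun h => ⟨h.2.1.2, h.2.2⟩, fun h =>
        ⟨mem_vertices_of_mem (hF h.2) h.1, ⟨hF h.2, h.1⟩, h.2⟩⟩
    have h7 : ∀ e ∈ F, ∑ z ∈ e, Y e ^ 2 = 2 * Y e ^ 2 := fun e he => by
      obtain ⟨s, -, -, hc⟩ := mem_edges.1 (hF he)
      rw [Finset.sum_const, hc]; simp
    rw [h6, Finset.sum_congr rfl h7, ← Finset.mul_sum]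
    ring
  have hBsum : ∑ z ∈ 𝒯.vertices, B z ^ 2 ≤ 3 * N * ∑ s ∈ 𝒯.cells, G s ^ 2 := by
    have h5 : ∀ z ∈ 𝒯.vertices, B z ^ 2 ≤ N * ∑ s ∈ 𝒯.cellsAt z, G s ^ 2 := fun z _ =>
      sq_sum_le_card_mul_sum_sq.trans
        (mul_le_mul_of_nonneg_right (hN z) (Finset.sum_nonneg fun e _ => sq_nonneg _))
    refine (Finset.sum_le_sum h5).trans (le_of_eq ?_)
    rw [← Finset.mul_sum]
    have h6 : ∑ z ∈ 𝒯.vertices, ∑ s ∈ 𝒯.cellsAt z, G s ^ 2 =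
        ∑ s ∈ 𝒯.cells, ∑ z ∈ s, G s ^ 2 := by
      refine Finset.sum_comm' fun z s => ?_
      rw [mem_cellsAt]
      exact ⟨fun h => ⟨h.2.2, h.2.1⟩, fun h =>
        ⟨Finset.mem_biUnion.2 ⟨s, h.2, h.1⟩, h.2, h.1⟩⟩
    have h7 : ∀ s ∈ 𝒯.cells, ∑ z ∈ s, G s ^ 2 = 3 * G s ^ 2 := fun s hs => by
      rw [Finset.sum_const, 𝒯.card_eq s hs]; simp
    rw [h6, Finset.sum_congr rfl h7, ← Finset.mul_sum]
    ring
  rw [h1]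
  calc _ ≤ ∑ z ∈ 𝒯.vertices, 2 * N * (A z * B z) :=
        (Finset.abs_sum_le_sum_abs _ _).trans (Finset.sum_le_sum fun z _ => h3 z)
    _ = 2 * N * ∑ z ∈ 𝒯.vertices, A z * B z := (Finset.mul_sum _ _ _).symm
    _ ≤ 2 * N * (√(∑ z ∈ 𝒯.vertices, A z ^ 2) * √(∑ z ∈ 𝒯.vertices, B z ^ 2)) :=
        mul_le_mul_of_nonneg_left (Real.sum_mul_le_sqrt_mul_sqrt _ _ _) (by positivity)
    _ ≤ 2 * N * (√(4 * N * ∑ e ∈ F, Y e ^ 2) * √(3 * N * ∑ s ∈ 𝒯.cells, G s ^ 2)) := by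
        gcongr
    _ = _ := by
        rw [Real.sqrt_mul (by positivity : 0 ≤ 4 * N), Real.sqrt_mul (by positivity : 0 ≤ 3 * N)]
        ring

end Triangulation

/-! ### The tangential trace of a piecewise gradient -/

theorem HasTrace.congr {s e : Finset Plane} {v g g' : Plane → ℝ} (h : HasTrace s e v g)
    (hg : g =ᵐ[edgeMeasure e] g') : HasTrace s e v g' := by
  obtain ⟨h1, φ, h2, h3, h4, h5⟩ := h
  refine ⟨h1.ae_eq hg, φ, h2, h3, h4, h5.congr fun m => eLpNorm_congr_ae ?_⟩
  filter_upwards [hg] with x hx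
  rw [hx]

/-- Gradients are free of curl. -/
theorem integral_inner_weakGrad_rot_test {a b c : Plane} (hD : cross (b - a) (c - a) ≠ 0)
    {s : Finset Plane} (hs : (s : Set Plane) = {a, b, c}) {v φ : Plane → ℝ}
    (hv : MemH1 (interior (hull s)) v) (hφ : IsTest (interior (hull s)) φ) :
    ∫ x in interior (hull s), inner ℝ (weakGrad (interior (hull s)) v x) (rot (gradient φ x)) =
      0 := by
  classical
  have hD₂ : cross (c - b) (a - b) ≠ 0 := by rwa [cross_rotate a b c]
  have hD₃ : cross (a - c) (b - c) ≠ 0 := by rwa [cross_rotate b c a]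
  have hs₂ : (s : Set Plane) = {b, c, a} := by rw [hs, triple_rotate]
  have hs₃ : (s : Set Plane) = {c, a, b} := by rw [hs₂, triple_rotate]
  obtain ⟨g₁, h₁⟩ := exists_hasTrace hD hs (e := {a, b}) (by simp) hv
  obtain ⟨g₂, h₂⟩ := exists_hasTrace hD₂ hs₂ (e := {b, c}) (by simp) hv
  obtain ⟨g₃, h₃⟩ := exists_hasTrace hD₃ hs₃ (e := {c, a}) (by simp) hv
  have hz : ∀ {p q r : Plane}, cross (q - p) (r - p) ≠ 0 → (s : Set Plane) = {p, q, r} →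
      ∀ g, lineInt p q g φ = 0 := by
    intro p q r hpq hs' g
    refine (intervalIntegral.integral_congr fun t _ => ?_).trans intervalIntegral.integral_zero
    have h0 : ∀ t : ℝ, φ (AffineMap.lineMap p q t) = 0 := fun t => by
      refine image_eq_zero_of_notMem_tsupport fun hmem => ?_
      have hx := hφ.2.2 hmem
      rw [hull_triple hs', interior_triangle hpq] at hx
      have h3 : bary r p q (AffineMap.lineMap p q t) = 0 := by simp [bary_lineMap]
      exact hx.2.2.ne' h3
    have h1 := hasDerivAt_lineMap hφ.1 p q t
    simp only [h0] at h1
    simp only [h1.unique (hasDerivAt_const t 0), mul_zero]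
  rw [h₁.green hD hs (by simp) (by simp) (by simp) hv h₂ h₃ hφ.1, hz hD hs, hz hD₂ hs₂, hz hD₃ hs₃]
  simp

namespace Triangulation

variable {Ω : Set Plane} {𝒯 : Triangulation Ω}

theorem pwGrad_eq (𝒯 : Triangulation Ω) (v : Plane → ℝ) {s : Finset Plane} (hs : s ∈ 𝒯.cells)
    {x : Plane} (hx : x ∈ interior (hull s)) :
    𝒯.pwGrad v x = weakGrad (interior (hull s)) v x := by
  rw [pwGrad, Finset.sum_eq_single_of_mem s hs, indicator_of_mem hx]
  intro t ht hts
  exact indicator_of_notMem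
    (fun hxt => Set.disjoint_left.1 (𝒯.disjoint_interior_hull ht hs hts) hxt hx) _

/-- The weak curl of a gradient vanishes, so that only the second integral of the pairing is left. -/
theorem tangentialPairing_eq {s : Finset Plane} (hs : s ∈ 𝒯.cells) {v w : Plane → ℝ}
    (hv : MemH1 (interior (hull s)) v) : tangentialPairing s (𝒯.pwGrad v) w =
      ∫ x in interior (hull s), inner ℝ (weakGrad (interior (hull s)) v x)
        (rot (weakGrad (interior (hull s)) w x)) := by
  obtain ⟨a, b, c, h, hD⟩ := 𝒯.exists_vertices hs
  have h' : (s : Set Plane) = {a, b, c} := by rw [h]; simp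
  have hgrad : ∀ F : Plane → Plane,
      ∫ x in interior (hull s), inner ℝ (𝒯.pwGrad v x) (F x) =
        ∫ x in interior (hull s), inner ℝ (weakGrad (interior (hull s)) v x) (F x) := fun F =>
    setIntegral_congr_fun isOpen_interior.measurableSet fun x hx => by
      simp only [𝒯.pwGrad_eq v hs hx]
  have hex : ∃ k, HasWeakCurl (interior (hull s)) (𝒯.pwGrad v) k := by
    refine ⟨0, MemLp.zero, fun φ hφ => ?_⟩
    rw [hgrad, integral_inner_weakGrad_rot_test hD h' hv hφ]
    simp
  have hk : HasWeakCurl (interior (hull s)) (𝒯.pwGrad v)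
      (weakCurl (interior (hull s)) (𝒯.pwGrad v)) := by
    rw [weakCurl, dif_pos hex]; exact hex.choose_spec
  have h0 := ae_eq_zero_of_forall_test isOpen_interior hk.1 fun φ hφ => by
    have := hk.2 φ hφ
    rw [hgrad, integral_inner_weakGrad_rot_test hD h' hv hφ, neg_zero] at this
    rw [← this]
    exact integral_congr_ae (ae_of_all _ fun x => by simp [mul_comm])
  have h1 : ∫ x in interior (hull s), weakCurl (interior (hull s)) (𝒯.pwGrad v) x * w x = 0 := by
    refine integral_eq_zero_of_ae ?_
    filter_upwards [h0] with x hx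
    rw [hx]; simp
  rw [tangentialPairing, h1, zero_add, hgrad]

theorem EdgeEnds.side_mul_lineInt {x y : Finset Plane → Plane} (hxy : 𝒯.EdgeEnds x y)
    {s e : Finset Plane} (he : e ∈ 𝒯.edges) (hs : s ∈ 𝒯.adj e) {a b : Plane}
    (hab : (e : Set Plane) = {a, b}) (f h : Plane → ℝ) :
    side s (x e) (y e) * lineInt (x e) (y e) f h = side s a b * lineInt a b f h := by
  obtain ⟨c, hc⟩ := hxy.exists_vertices he hs
  have hs' := (mem_adj.1 hs).1
  have hne := hxy.ne e he
  have hE := hab.symm.trans (hxy.eq e he)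
  have ha : a ∈ ({x e, y e} : Set Plane) := by rw [← hE]; simp
  have hx : x e ∈ ({a, b} : Set Plane) := by rw [hE]; simp
  have hy : y e ∈ ({a, b} : Set Plane) := by rw [hE]; simp
  rcases ha with rfl | ha
  · rcases hy with h1 | h1
    · exact absurd h1.symm hne
    · rw [Set.mem_singleton_iff] at h1; rw [h1]
  · rw [Set.mem_singleton_iff] at ha
    subst ha
    rcases hx with h1 | h1
    · exact absurd h1 hne
    · rw [Set.mem_singleton_iff] at h1
      rw [← h1, lineInt_swap (x e) (y e), side_swap hs' hc, neg_mul_neg]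

/-- The pairing with the tangential trace, summed over the edges of a triangle. -/
theorem EdgeEnds.tangentialPairing_eq_sum {x y : Finset Plane → Plane} (hxy : 𝒯.EdgeEnds x y)
    {s : Finset Plane} (hs : s ∈ 𝒯.cells) {v w : Plane → ℝ}
    (hv : MemH1 (interior (hull s)) v) (hw : MemH1 (interior (hull s)) w)
    {p g : Finset Plane → Plane → ℝ} (hp : ∀ e ∈ s.powersetCard 2, HasTrace s e v (p e))
    (hpc : ∀ e ∈ s.powersetCard 2, ContDiff ℝ ∞ (p e))
    (hg : ∀ e ∈ s.powersetCard 2, HasTrace s e w (g e)) :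
    tangentialPairing s (𝒯.pwGrad v) w =
      ∑ e ∈ s.powersetCard 2, side s (x e) (y e) * lineInt (x e) (y e) (g e) (p e) := by
  classical
  obtain ⟨a, b, c, h, hD⟩ := 𝒯.exists_vertices hs
  have h' : (s : Set Plane) = {a, b, c} := by rw [h]; simp
  obtain ⟨hab, hbc, hac⟩ := vertices_ne hs h'
  have hs₂ : (s : Set Plane) = {b, c, a} := by rw [h', triple_rotate]
  have hs₃ : (s : Set Plane) = {c, a, b} := by rw [hs₂, triple_rotate]
  have hpc2 : s.powersetCard 2 = {{a, b}, {b, c}, {c, a}} := by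
    ext e
    rw [Finset.mem_powersetCard]
    constructor
    · rintro ⟨h1, h2⟩
      obtain ⟨u, u', huu, rfl⟩ := Finset.card_eq_two.1 h2
      have m1 : u ∈ (s : Set Plane) := h1 (by simp)
      have m2 : u' ∈ (s : Set Plane) := h1 (by simp)
      rw [h'] at m1 m2
      rcases m1 with rfl | rfl | rfl <;> rcases m2 with rfl | rfl | rfl <;>
        first
        | exact absurd rfl huu
        | simp [Finset.pair_comm]
    · intro he
      simp only [Finset.mem_insert, Finset.mem_singleton] at he
      rcases he with rfl | rfl | rfl <;>
        refine ⟨by rw [← Finset.coe_subset, h']; intro u hu; simp at hu ⊢; tauto,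
          Finset.card_pair ?_⟩
      · exact hab
      · exact hbc
      · exact hac.symm
  have hmem : ∀ e, e = {a, b} ∨ e = {b, c} ∨ e = {c, a} → e ∈ s.powersetCard 2 := by
    intro e he; rw [hpc2]; simpa using he
  have hedge : ∀ e ∈ s.powersetCard 2, e ∈ 𝒯.edges ∧ s ∈ 𝒯.adj e := by
    intro e he
    obtain ⟨h1, h2⟩ := Finset.mem_powersetCard.1 he
    exact ⟨mem_edges.2 ⟨s, hs, h1, h2⟩, mem_adj.2 ⟨hs, h1⟩⟩
  have hterm : ∀ (e : Finset Plane) (u u' : Plane), e ∈ s.powersetCard 2 →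
      (e : Set Plane) = {u, u'} → side s (x e) (y e) * lineInt (x e) (y e) (g e) (p e) =
        side s u u' * lineInt u u' (g e) (p e) := fun e u u' he heu =>
    hxy.side_mul_lineInt (hedge e he).1 (hedge e he).2 heu _ _
  have n1 : ({a, b} : Finset Plane) ≠ {b, c} := fun hh => by
    have : a ∈ ({b, c} : Finset Plane) := by rw [← hh]; simp
    simp [hab, hac] at this
  have n2 : ({a, b} : Finset Plane) ≠ {c, a} := fun hh => by
    have : b ∈ ({c, a} : Finset Plane) := by rw [← hh]; simp
    simp [hbc, hab.symm] at this
  have n3 : ({b, c} : Finset Plane) ≠ {c, a} := fun hh => by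
    have : b ∈ ({c, a} : Finset Plane) := by rw [← hh]; simp
    simp [hbc, hab.symm] at this
  have k1 := hmem {a, b} (by simp)
  have k2 := hmem {b, c} (by simp)
  have k3 := hmem {c, a} (by simp)
  have hsum : ∑ e ∈ s.powersetCard 2, side s (x e) (y e) * lineInt (x e) (y e) (g e) (p e) =
      ∑ e ∈ ({{a, b}, {b, c}, {c, a}} : Finset (Finset Plane)),
        side s (x e) (y e) * lineInt (x e) (y e) (g e) (p e) :=
    Finset.sum_congr hpc2 fun _ _ => rfl
  rw [tangentialPairing_eq hs hv, hsum, Finset.sum_insert (by simp [n1, n2]),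
    Finset.sum_pair n3, hterm _ a b k1 (by simp), hterm _ b c k2 (by simp),
    hterm _ c a k3 (by simp), side_eq hs h', side_eq hs hs₂, side_eq hs hs₃, cross_rotate b c a,
    cross_rotate a b c,
    HasTrace.green_weakGrad hD h' (by simp) (by simp) (by simp) hv hw (hp _ k1) (hp _ k2) (hp _ k3)
      (hpc _ k1) (hpc _ k2) (hpc _ k3) (hg _ k1) (hg _ k2) (hg _ k3)]
  ring

/-- The smooth traces on two edges of a triangle agree at the common vertex. -/
theorem trace_eq_at_vertex {s : Finset Plane} (hs : s ∈ 𝒯.cells) {v : Plane → ℝ}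
    (hv : MemH1 (interior (hull s)) v) {p : Finset Plane → Plane → ℝ}
    (hp : ∀ e ∈ s.powersetCard 2, HasTrace s e v (p e))
    (hpc : ∀ e ∈ s.powersetCard 2, ContDiff ℝ ∞ (p e)) {e f : Finset Plane}
    (he : e ∈ s.powersetCard 2) (hf : f ∈ s.powersetCard 2) {z : Plane} (hze : z ∈ e)
    (hzf : z ∈ f) : p e z = p f z := by
  classical
  have hpair : ∀ {e : Finset Plane}, e ∈ s.powersetCard 2 → z ∈ e →
      ∃ u, u ≠ z ∧ u ∈ s ∧ e = {u, z} := by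
    intro e he hze
    obtain ⟨h1, h2⟩ := Finset.mem_powersetCard.1 he
    obtain ⟨a, b, hab, rfl⟩ := Finset.card_eq_two.1 h2
    simp only [Finset.mem_insert, Finset.mem_singleton] at hze
    rcases hze with rfl | rfl
    · exact ⟨b, hab.symm, h1 (by simp), Finset.pair_comm _ _⟩
    · exact ⟨a, hab, h1 (by simp), rfl⟩
  obtain ⟨u, huz, hus, rfl⟩ := hpair he hze
  obtain ⟨u', huz', hus', rfl⟩ := hpair hf hzf
  by_cases huu : u = u'
  · rw [huu]
  have hzs : z ∈ s := (Finset.mem_powersetCard.1 he).1 hze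
  obtain ⟨c, hc⟩ := exists_vertices_of_pair hs huz hus hzs
  have : u' ∈ (s : Set Plane) := hus'
  rw [hc] at this
  rcases this with h | h | h
  · exact absurd h.symm huu
  · exact absurd h huz'
  rw [Set.mem_singleton_iff] at h
  subst h
  have h3 : ({u', u} : Finset Plane) ∈ s.powersetCard 2 := by
    refine Finset.mem_powersetCard.2 ⟨?_, Finset.card_pair (Ne.symm huu)⟩
    intro t ht
    simp only [Finset.mem_insert, Finset.mem_singleton] at ht
    rcases ht with rfl | rfl <;> assumption
  exact HasTrace.vertex_eq (𝒯.cross_ne_zero hs hc) hc (e₁ := {u, z}) (e₂ := {u', z})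
    (e₃ := {u', u}) (by simp) (by simp [Set.pair_comm]) (by simp) hv (hp _ he) (hp _ hf) (hp _ h3)
    (hpc _ he) (hpc _ hf) (hpc _ h3)

/-- A function in `H¹(Ω)` has traces on the edges that do not depend on the adjacent triangle. -/
theorem EdgeEnds.exists_traces {x y : Finset Plane → Plane} (hxy : 𝒯.EdgeEnds x y)
    (hΩ : IsLipschitzDomain Ω) {ΓD : Set Plane} {w : Plane → ℝ} (hw : 𝒯.MemH1N ΓD w) :
    ∃ g : Finset Plane → Plane → ℝ, (∀ e ∈ 𝒯.edges, ∀ s ∈ 𝒯.adj e, HasTrace s e w (g e)) ∧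
      ∀ e, 𝒯.IsNeumannEdge ΓD e → g e = 0 := by
  classical
  have : ∀ e, ∃ g : Plane → ℝ, (e ∈ 𝒯.edges → ∀ s ∈ 𝒯.adj e, HasTrace s e w g) ∧
      (𝒯.IsNeumannEdge ΓD e → g = 0) := by
    intro e
    by_cases hN : 𝒯.IsNeumannEdge ΓD e
    · exact ⟨0, fun _ => hw.2.1 e hN, fun _ => rfl⟩
    by_cases he : e ∈ 𝒯.edges
    swap
    · exact ⟨0, fun h => absurd h he, fun _ => rfl⟩
    have hmem : ∀ {s}, s ∈ 𝒯.adj e → MemH1 (interior (hull s)) w := fun hs =>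
      hw.1.mono (𝒯.interior_hull_subset hΩ (mem_adj.1 hs).1)
    obtain ⟨s, hs, hes, -⟩ := mem_edges.1 he
    have hsa : s ∈ 𝒯.adj e := mem_adj.2 ⟨hs, hes⟩
    obtain ⟨c, hc⟩ := hxy.exists_vertices he hsa
    obtain ⟨g, hg⟩ := exists_hasTrace (𝒯.cross_ne_zero hs hc) hc (hxy.eq e he) (hmem hsa)
    refine ⟨g, fun _ t ht => ?_, fun h => absurd h hN⟩
    by_cases hst : s = t
    · rw [← hst]; exact hg
    obtain ⟨d, hd⟩ := hxy.exists_vertices he ht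
    have ht' := (mem_adj.1 ht).1
    obtain ⟨g', hg'⟩ := exists_hasTrace (𝒯.cross_ne_zero ht' hd) hd (hxy.eq e he) (hmem ht)
    exact hg'.congr (𝒯.hasTrace_ae_eq hΩ hs ht' hst hc hd (hxy.eq e he) hw.1 hg hg').symm
  choose g hg using this
  exact ⟨g, fun e => (hg e).1, fun e => (hg e).2⟩

/-! ### Jumps -/

/-- The outer normal of a triangle points away from a second triangle at the same edge. -/
theorem EdgeEnds.not_isOuterNormal {x y : Finset Plane → Plane} (hxy : 𝒯.EdgeEnds x y)
    {s t e : Finset Plane} (he : e ∈ 𝒯.edges) (hs : s ∈ 𝒯.adj e) (ht : t ∈ 𝒯.adj e) (hst : s ≠ t)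
    {n : Plane} (hn : IsOuterNormal n e s) : ¬IsOuterNormal n e t := by
  intro hn'
  obtain ⟨c, hc⟩ := hxy.exists_vertices he hs
  obtain ⟨d, hd⟩ := hxy.exists_vertices he ht
  have hneg := 𝒯.cross_mul_cross_neg (mem_adj.1 hs).1 (mem_adj.1 ht).1 hst hc hd
  have hxs : x e ∈ s := (mem_adj.1 hs).2 (hxy.left_mem he)
  have hys : y e ∈ s := (mem_adj.1 hs).2 (hxy.right_mem he)
  have hcs : c ∈ s := by rw [← Finset.mem_coe, hc]; simp
  have hdt : d ∈ t := by rw [← Finset.mem_coe, hd]; simp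
  have i1 := hn.2 _ hxs _ (hxy.right_mem he)
  have i2 := hn.2 _ hys _ (hxy.left_mem he)
  have i3 := hn.2 _ hcs _ (hxy.left_mem he)
  have i4 := hn'.2 _ hdt _ (hxy.left_mem he)
  have hn1 := hn.1
  set a := x e
  set b := y e
  have i5 : inner ℝ n (b - a) = 0 := by
    refine le_antisymm i2 ?_
    rw [← neg_sub, inner_neg_right] at i1
    linarith
  have hexp : ∀ u v : Plane, inner ℝ u v = u 0 * v 0 + u 1 * v 1 := fun u v => by
    simp [PiLp.inner_apply, Fin.sum_univ_two, mul_comm]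
  -- `n` is orthogonal to the edge, so the normal component is proportional to the cross product
  have key : ∀ u : Plane, ‖b - a‖ ^ 2 * inner ℝ n u = cross (b - a) u * cross (b - a) n := by
    intro u
    rw [← real_inner_self_eq_norm_sq]
    rw [hexp] at i5 ⊢
    rw [hexp]
    simp only [cross]
    linear_combination ((b - a) 0 * u 0 + (b - a) 1 * u 1) * i5
  have hlen : cross (b - a) n ^ 2 = ‖b - a‖ ^ 2 := by
    have h1 : ‖b - a‖ ^ 2 * ‖n‖ ^ 2 = inner ℝ n (b - a) ^ 2 + cross (b - a) n ^ 2 := by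
      rw [← real_inner_self_eq_norm_sq, ← real_inner_self_eq_norm_sq, hexp, hexp, hexp]
      simp only [cross]; ring
    rw [i5, hn1] at h1
    linarith
  have hpos : 0 < ‖b - a‖ ^ 2 :=
    pow_pos (norm_pos_iff.2 (sub_ne_zero.2 (hxy.ne e he).symm)) 2
  have h3 := key (c - a)
  have h4 := key (d - a)
  have h5 : 0 ≤ (‖b - a‖ ^ 2 * inner ℝ n (c - a)) * (‖b - a‖ ^ 2 * inner ℝ n (d - a)) :=
    mul_nonneg_of_nonpos_of_nonpos (mul_nonpos_of_nonneg_of_nonpos hpos.le i3)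
      (mul_nonpos_of_nonneg_of_nonpos hpos.le i4)
  rw [h3, h4] at h5
  have h6 : cross (b - a) (c - a) * cross (b - a) n * (cross (b - a) (d - a) * cross (b - a) n) =
      cross (b - a) (c - a) * cross (b - a) (d - a) * ‖b - a‖ ^ 2 := by rw [← hlen]; ring
  rw [h6] at h5
  exact absurd h5 (not_le.2 (mul_neg_of_neg_of_pos hneg hpos))

theorem EdgeEnds.side_mul_side {x y : Finset Plane → Plane} (hxy : 𝒯.EdgeEnds x y)
    {s t e : Finset Plane} (he : e ∈ 𝒯.edges) (hs : s ∈ 𝒯.adj e) (ht : t ∈ 𝒯.adj e) :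
    side s (x e) (y e) * side t (x e) (y e) = if s = t then 1 else -1 := by
  obtain ⟨c, hc⟩ := hxy.exists_vertices he hs
  obtain ⟨d, hd⟩ := hxy.exists_vertices he ht
  have hs' := (mem_adj.1 hs).1
  have ht' := (mem_adj.1 ht).1
  split_ifs with hst
  · subst hst
    have h0 := 𝒯.cross_ne_zero hs' hc
    rw [side_eq hs' hc]
    rcases lt_or_gt_of_ne h0 with h | h
    · rw [sign_neg h]; simp
    · rw [sign_pos h]; simp
  · have hneg := 𝒯.cross_mul_cross_neg hs' ht' hst hc hd
    rw [side_eq hs' hc, side_eq ht' hd]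
    rcases mul_neg_iff.1 hneg with ⟨h1, h2⟩ | ⟨h1, h2⟩
    · rw [sign_pos h1, sign_neg h2]; simp
    · rw [sign_neg h1, sign_pos h2]; simp

/-- The scaled norm of the jump, in terms of the traces weighted by the side of the triangle. -/
theorem EdgeEnds.jump_norm_eq {x y : Finset Plane → Plane} (hxy : 𝒯.EdgeEnds x y)
    {n : Finset Plane → Plane} (hn : 𝒯.IsOrientation n) {v : Plane → ℝ} (hv : 𝒯.MemPwH1 v)
    {e : Finset Plane} (he : e ∈ 𝒯.edges) {p : Finset Plane → Plane → ℝ}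
    (hp : ∀ s ∈ 𝒯.adj e, HasTrace s e v (p s)) {q : Plane → ℝ} (hqc : Continuous q)
    (hq : ∀ z, q z = ∑ s ∈ 𝒯.adj e, side s (x e) (y e) * p s z) :
    ENNReal.ofReal (edgeLength e)⁻¹ * eLpNorm (𝒯.jump n v e) 2 (edgeMeasure e) ^ 2 =
      ENNReal.ofReal (segNorm (x e) (y e) q ^ 2) := by
  classical
  obtain ⟨s₀, hs₀, hns₀⟩ := hn e he
  have hne := hxy.ne e he
  have hE := hxy.eq e he
  have hd : 0 < dist (x e) (y e) := dist_pos.2 hne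
  have hae : ∀ s ∈ 𝒯.adj e, edgeTrace s e v =ᵐ[edgeMeasure e] p s := by
    intro s hs
    obtain ⟨c, hc⟩ := hxy.exists_vertices he hs
    have hs' := (mem_adj.1 hs).1
    exact edgeTrace_ae_eq (𝒯.cross_ne_zero hs' hc) hc hE (hv.2 s hs') (hp s hs)
  have hjump : 𝒯.jump n v e =ᵐ[edgeMeasure e] fun z => side s₀ (x e) (y e) * q z := by
    have hall : ∀ᵐ z ∂edgeMeasure e, ∀ s ∈ 𝒯.adj e, edgeTrace s e v z = p s z :=
      (Finset.eventually_all _).2 hae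
    filter_upwards [hall] with z hz
    rw [jump, hq, Finset.mul_sum]
    refine Finset.sum_congr rfl fun s hs => ?_
    rw [hz s hs, ← mul_assoc, hxy.side_mul_side he hs₀ hs]
    congr 1
    by_cases hss : s₀ = s
    · rw [if_pos hss, if_pos (hss ▸ hns₀)]
    · rw [if_neg hss, if_neg (hxy.not_isOuterNormal he hs₀ hs hss hns₀)]
  have hside : |side s₀ (x e) (y e)| = 1 := by
    have := hxy.side_mul_side he hs₀ hs₀
    rw [if_pos rfl] at this
    rw [abs_eq zero_le_one]
    exact mul_self_eq_one_iff.1 this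
  have hnorm : eLpNorm (𝒯.jump n v e) 2 (edgeMeasure e) = eLpNorm q 2 (edgeMeasure e) := by
    rw [eLpNorm_congr_ae hjump]
    refine eLpNorm_congr_norm_ae (ae_of_all _ fun z => ?_)
    rw [norm_mul, Real.norm_eq_abs (side _ _ _), hside, one_mul]
  have hm : MemLp (fun r : ℝ => q (AffineMap.lineMap (x e) (y e) r)) 2 unitMeasure :=
    memLp_unit (hqc.comp AffineMap.lineMap_continuous)
  have h1 : eLpNorm (fun r : ℝ => q (AffineMap.lineMap (x e) (y e) r)) 2 unitMeasure ^ 2 =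
      ENNReal.ofReal (segNorm (x e) (y e) q ^ 2) := by
    have h2 := eLpNorm_two_sq_toReal hm
    rw [segNorm, Real.sq_sqrt (intervalIntegral.integral_nonneg zero_le_one fun _ _ => sq_nonneg _),
      intervalIntegral.integral_of_le zero_le_one]
    simp only [Real.norm_eq_abs, sq_abs] at h2
    rw [← h2, ← ENNReal.toReal_pow, ENNReal.ofReal_toReal (ENNReal.pow_ne_top hm.2.ne)]
  rw [hnorm, eLpNorm_edgeMeasure hne hE, mul_pow, h1, edgeLength_eq hne hE, ← mul_assoc,
    ← ENNReal.rpow_natCast, ← ENNReal.rpow_mul]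
  norm_num
  rw [← ENNReal.ofReal_mul (by positivity), inv_mul_cancel₀ hd.ne', ENNReal.ofReal_one, one_mul]

end Triangulation

/-! ### The estimate of the tangential pairing -/

theorem integral_lineMap_swap (g : Plane → ℝ) (a b : Plane) :
    ∫ r in (0 : ℝ)..1, g (AffineMap.lineMap b a r) =
      ∫ r in (0 : ℝ)..1, g (AffineMap.lineMap a b r) := by
  have := intervalIntegral.integral_comp_sub_left (a := 0) (b := 1)
    (fun s : ℝ => g (AffineMap.lineMap a b s)) 1
  simp only [sub_self, sub_zero, AffineMap.lineMap_apply_one_sub] at this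
  exact this

namespace Triangulation

variable {Ω : Set Plane} {𝒯 : Triangulation Ω}

theorem isNeumannEdge_of_not {ΓD : Set Plane} (hΓ : 𝒯.IsDirichletPart ΓD) {e : Finset Plane}
    (he : e ∈ 𝒯.edges) (h : ¬(𝒯.IsInteriorEdge e ∨ 𝒯.IsDirichletEdge ΓD e)) :
    𝒯.IsNeumannEdge ΓD e := by
  rw [not_or] at h
  have hb : 𝒯.IsBoundaryEdge e := by
    by_contra hb; exact h.1 ⟨he, hb⟩
  rcases hΓ.partition e hb with h1 | h1
  · exact absurd h1.1 h.2
  · exact h1.1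

/-- The averages of the traces over two edges of a triangle are close. -/
theorem EdgeEnds.abs_average_sub_le {x y : Finset Plane → Plane} (hxy : 𝒯.EdgeEnds x y)
    {α : ℝ} (hα : 0 < α) (hα' : α ≤ Real.pi / 3) (hA : 𝒯.AnglesGE α) {w : Plane → ℝ}
    {s : Finset Plane} (hs : s ∈ 𝒯.cells) (hw : MemH1 (interior (hull s)) w)
    {g : Finset Plane → Plane → ℝ}
    (hg : ∀ e ∈ 𝒯.edges, ∀ s ∈ 𝒯.adj e, HasTrace s e w (g e)) {e f : Finset Plane}
    (he : e ∈ 𝒯.edges) (hf : f ∈ 𝒯.edges) (hes : e ⊆ s) (hfs : f ⊆ s) :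
    |(∫ r in (0 : ℝ)..1, g e (AffineMap.lineMap (x e) (y e) r)) -
      ∫ r in (0 : ℝ)..1, g f (AffineMap.lineMap (x f) (y f) r)| ≤
        (Real.sin α)⁻¹ * cellNorm s w := by
  classical
  have hκ : 0 < Real.sin α := Real.sin_pos_of_pos_of_lt_pi hα (by linarith [Real.pi_pos])
  by_cases hef : e = f
  · subst hef
    rw [sub_self, abs_zero]
    exact mul_nonneg (inv_nonneg.2 hκ.le) (cellNorm_nonneg s w)
  have hse : s ∈ 𝒯.adj e := mem_adj.2 ⟨hs, hes⟩
  have hsf : s ∈ 𝒯.adj f := mem_adj.2 ⟨hs, hfs⟩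
  obtain ⟨c, hc⟩ := hxy.exists_vertices he hse
  -- the average does not depend on the orientation of the edge
  have hswap : ∀ {e : Finset Plane} {a b : Plane}, e ∈ 𝒯.edges → (e : Set Plane) = {a, b} →
      ∫ r in (0 : ℝ)..1, g e (AffineMap.lineMap (x e) (y e) r) =
        ∫ r in (0 : ℝ)..1, g e (AffineMap.lineMap a b r) := by
    intro e a b he hab
    have hne := hxy.ne e he
    have hE := hab.symm.trans (hxy.eq e he)
    rcases Set.pair_eq_pair_iff.1 hE with ⟨rfl, rfl⟩ | ⟨rfl, rfl⟩
    · rfl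
    · exact integral_lineMap_swap _ _ _
  have main : ∀ {a b : Plane}, (s : Set Plane) = {a, b, c} → (e : Set Plane) = {a, b} →
      (f : Set Plane) = {c, a} →
      |(∫ r in (0 : ℝ)..1, g e (AffineMap.lineMap (x e) (y e) r)) -
        ∫ r in (0 : ℝ)..1, g f (AffineMap.lineMap (x f) (y f) r)| ≤
        (Real.sin α)⁻¹ * cellNorm s w := by
    intro a b hsab hea hfa
    rw [hswap he hea, hswap hf hfa]
    refine HasTrace.abs_integral_sub_le (𝒯.cross_ne_zero hs hsab) hκ ?_ hsab hea hfa hw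
      (hg e he s hse) (hg f hf s hsf)
    have := hA.norm_sq_le hα hα' hs (hsab.trans (triple_rotate a b c))
    rwa [norm_sub_rev, cross_rotate a b c] at this
  obtain ⟨u, u', huu, hf'⟩ : ∃ u u', u ≠ u' ∧ (f : Set Plane) = {u, u'} :=
    ⟨x f, y f, hxy.ne f hf, hxy.eq f hf⟩
  have hu : u ∈ (s : Set Plane) := hfs (by rw [← Finset.mem_coe, hf']; simp)
  have hu' : u' ∈ (s : Set Plane) := hfs (by rw [← Finset.mem_coe, hf']; simp)
  have hE := hxy.eq e he
  have hef' : (e : Set Plane) ≠ f := fun h => hef (Finset.coe_injective h)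
  have hc' : (s : Set Plane) = {y e, x e, c} := by rw [hc, Set.insert_comm]
  have hE' : (e : Set Plane) = {y e, x e} := by rw [hE, Set.pair_comm]
  rw [hc] at hu hu'
  rcases hu with h1 | h1 | h1 <;> rcases hu' with h2 | h2 | h2
  · exact absurd (h1.trans h2.symm) huu
  · exact absurd (by rw [hE, hf', h1, h2]) hef'
  · rw [Set.mem_singleton_iff] at h2
    exact main hc hE (by rw [hf', h1, h2, Set.pair_comm])
  · exact absurd (by rw [hE, hf', h1, h2, Set.pair_comm]) hef'
  · exact absurd (h1.trans h2.symm) huu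
  · rw [Set.mem_singleton_iff] at h2
    exact main hc' hE' (by rw [hf', h1, h2, Set.pair_comm])
  · rw [Set.mem_singleton_iff] at h1
    exact main hc hE (by rw [hf', h1, h2])
  · rw [Set.mem_singleton_iff] at h1
    exact main hc' hE' (by rw [hf', h1, h2])
  · rw [Set.mem_singleton_iff] at h1 h2
    exact absurd (h1.trans h2.symm) huu

theorem sum_cellNorm_sq_le (hΩ : IsLipschitzDomain Ω) {w : Plane → ℝ} (hw : MemH1 Ω w) :
    ∑ s ∈ 𝒯.cells, cellNorm s w ^ 2 ≤
      (eLpNorm (weakGrad Ω w) 2 (volume.restrict Ω)).toReal ^ 2 := by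
  have hG := (hasWeakGrad_weakGrad hw.2).1
  have hi : IntegrableOn (fun x => ‖weakGrad Ω w x‖ ^ 2) Ω :=
    (memLp_two_iff_integrable_sq_norm hG.1).1 hG
  have h1 : ∀ s ∈ 𝒯.cells, cellNorm s w ^ 2 =
      ∫ x in interior (hull s), ‖weakGrad Ω w x‖ ^ 2 := by
    intro s hs
    have hsub := 𝒯.interior_hull_subset hΩ hs
    have hae := weakGrad_ae_eq isOpen_interior hsub hw
    rw [cellNorm, eLpNorm_congr_ae hae,
      eLpNorm_two_sq_toReal (hG.mono_measure (Measure.restrict_mono hsub le_rfl))]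
  rw [eLpNorm_two_sq_toReal hG, Finset.sum_congr rfl h1,
    ← integral_biUnion_finset 𝒯.cells (fun s _ => isOpen_interior.measurableSet)
      (fun s hs t ht hst => 𝒯.disjoint_interior_hull hs ht hst)
      (fun s hs => hi.mono_set (𝒯.interior_hull_subset hΩ hs))]
  refine setIntegral_mono_set hi (ae_of_all _ fun x => sq_nonneg _) (ae_of_all _ ?_)
  exact iUnion₂_subset fun s hs => 𝒯.interior_hull_subset hΩ hs

theorem sum_cells_eq_sum_edges (f : Finset Plane → Finset Plane → ℝ) :
    ∑ s ∈ 𝒯.cells, ∑ e ∈ s.powersetCard 2, f s e = ∑ e ∈ 𝒯.edges, ∑ s ∈ 𝒯.adj e, f s e := by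
  refine Finset.sum_comm' fun s e => ?_
  rw [mem_adj, mem_edges, Finset.mem_powersetCard]
  constructor
  · rintro ⟨hs, h1, h2⟩; exact ⟨⟨hs, h1⟩, s, hs, h1, h2⟩
  · rintro ⟨⟨hs, h1⟩, _, _, _, h2⟩; exact ⟨hs, h1, h2⟩

end Triangulation

theorem polyFun_sum {ι : Type*} (S : Finset ι) (c : ι → ℝ) (p : ι → MvPolynomial (Fin 2) ℝ)
    (z : Plane) : polyFun (∑ i ∈ S, MvPolynomial.C (c i) * p i) z =
      ∑ i ∈ S, c i * polyFun (p i) z := by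
  simp [polyFun, map_sum]

theorem lineInt_sum {ι : Type*} (S : Finset ι) (c : ι → ℝ) (p : ι → MvPolynomial (Fin 2) ℝ)
    {a b : Plane} {g : Plane → ℝ}
    (hg : MemLp (fun s : ℝ => g (AffineMap.lineMap a b s)) 2 unitMeasure) :
    lineInt a b g (polyFun (∑ i ∈ S, MvPolynomial.C (c i) * p i)) =
      ∑ i ∈ S, c i * lineInt a b g (polyFun (p i)) := by
  have hi : ∀ i ∈ S, IntervalIntegrable (fun r : ℝ => c i * (g (AffineMap.lineMap a b r) *
      fderiv ℝ (polyFun (p i)) (AffineMap.lineMap a b r) (b - a))) volume 0 1 := fun i _ =>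
    ((intervalIntegrable_iff_integrableOn_Ioc_of_le zero_le_one).2
      (hg.integrable_mul (memLp_unit
        (continuous_fderiv_lineMap (contDiff_polyFun (p i)) a b)))).const_mul _
  simp only [lineInt, ← intervalIntegral.integral_const_mul]
  rw [← intervalIntegral.integral_finsetSum hi]
  refine intervalIntegral.integral_congr fun r _ => ?_
  have h1 : polyFun (∑ i ∈ S, MvPolynomial.C (c i) * p i) =
      fun z => ∑ i ∈ S, c i * polyFun (p i) z := funext fun z => polyFun_sum S c p z
  have h2 : HasFDerivAt (fun z => ∑ i ∈ S, c i * polyFun (p i) z)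
      (∑ i ∈ S, c i • fderiv ℝ (polyFun (p i)) (AffineMap.lineMap a b r))
      (AffineMap.lineMap a b r) :=
    HasFDerivAt.fun_sum fun i _ =>
      ((contDiff_polyFun (p i)).differentiable (by simp) _).hasFDerivAt.const_mul (c i)
  rw [h1, h2.fderiv]
  simp only [_root_.sum_apply, _root_.smul_apply, smul_eq_mul,
    Finset.mul_sum]
  exact Finset.sum_congr rfl fun i _ => by ring

theorem totalDegree_sum_C_mul_le {ι : Type*} (S : Finset ι) (c : ι → ℝ)
    {p : ι → MvPolynomial (Fin 2) ℝ} {m : ℕ} (hp : ∀ i ∈ S, (p i).totalDegree ≤ m) :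
    (∑ i ∈ S, MvPolynomial.C (c i) * p i).totalDegree ≤ m := by
  refine MvPolynomial.totalDegree_finsetSum_le fun i hi => ?_
  refine (MvPolynomial.totalDegree_mul _ _).trans ?_
  rw [MvPolynomial.totalDegree_C, zero_add]
  exact hp i hi

open scoped Classical in
/-- The main estimate: the pairing of the tangential traces of the piecewise gradient with a test
function is controlled by the jumps and the energy of the test function. -/
theorem exists_abs_sum_tangentialPairing_le (k : ℕ) {α : ℝ} (hα : 0 < α)
    (hα' : α ≤ Real.pi / 3) : ∃ C : ℝ, 0 < C ∧
      ∀ (Ω : Set Plane) (_ : IsLipschitzDomain Ω) (𝒯 : Triangulation Ω) (_ : 𝒯.AnglesGE α)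
        (ΓD : Set Plane) (_ : 𝒯.IsDirichletPart ΓD) (n : Finset Plane → Plane)
        (_ : 𝒯.IsOrientation n) (v : Plane → ℝ) (_ : 𝒯.MemPolyTrace (k + 1) v),
        ∃ J : ℝ, 0 ≤ J ∧ 𝒯.jSq ΓD n v = ENNReal.ofReal J ∧
          ∀ w, 𝒯.MemH1N ΓD w → |∑ s ∈ 𝒯.cells, tangentialPairing s (𝒯.pwGrad v) w| ≤
            C * √J * (eLpNorm (weakGrad Ω w) 2 (volume.restrict Ω)).toReal := by
  have hκ : 0 < Real.sin α := Real.sin_pos_of_pos_of_lt_pi hα (by linarith [Real.pi_pos])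
  obtain ⟨C₀, hC₀, hedge⟩ := exists_edge_estimate k hκ
  set N : ℝ := 2 / Real.sin α ^ 2 * volume.real (Metric.ball (0 : Plane) 1) with hNdef
  have hN0 : 0 ≤ N := by positivity
  set C₂ : ℝ := 2 * N * (√(4 * N) * √(3 * N)) with hC₂
  have hC₂0 : 0 ≤ C₂ := by positivity
  refine ⟨C₀ * √3 + C₂ * (C₀ * (Real.sin α)⁻¹), by positivity, ?_⟩
  intro Ω hΩ 𝒯 hA ΓD hΓ n hn v hv
  obtain ⟨x, y, hxy⟩ := 𝒯.exists_edgeEnds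
  -- the polynomial traces of `v`
  have hpex : ∀ s e : Finset Plane, ∃ p : MvPolynomial (Fin 2) ℝ, s ∈ 𝒯.cells →
      e ∈ s.powersetCard 2 → p.totalDegree ≤ k + 1 ∧ HasTrace s e v (polyFun p) := by
    intro s e
    by_cases h : s ∈ 𝒯.cells ∧ e ∈ s.powersetCard 2
    · obtain ⟨p, h1, h2⟩ := hv.2 s h.1 e h.2
      exact ⟨p, fun _ _ => ⟨h1, h2⟩⟩
    · exact ⟨0, fun h1 h2 => absurd ⟨h1, h2⟩ h⟩
  choose p hp using hpex
  have hcard : ∀ e ∈ 𝒯.edges, ∀ s ∈ 𝒯.adj e, s ∈ 𝒯.cells ∧ e ∈ s.powersetCard 2 := by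
    intro e he s hs
    obtain ⟨t, -, -, hc⟩ := Triangulation.mem_edges.1 he
    obtain ⟨h1, h2⟩ := Triangulation.mem_adj.1 hs
    exact ⟨h1, Finset.mem_powersetCard.2 ⟨h2, hc⟩⟩
  have hedges : ∀ s ∈ 𝒯.cells, ∀ e ∈ s.powersetCard 2, e ∈ 𝒯.edges ∧ s ∈ 𝒯.adj e := by
    intro s hs e he
    obtain ⟨h1, h2⟩ := Finset.mem_powersetCard.1 he
    exact ⟨Triangulation.mem_edges.2 ⟨s, hs, h1, h2⟩, Triangulation.mem_adj.2 ⟨hs, h1⟩⟩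
  -- the jumps, up to a sign
  let q : Finset Plane → MvPolynomial (Fin 2) ℝ := fun e =>
    ∑ s ∈ 𝒯.adj e, MvPolynomial.C (side s (x e) (y e)) * p s e
  have hqd : ∀ e ∈ 𝒯.edges, (q e).totalDegree ≤ k + 1 := fun e he =>
    totalDegree_sum_C_mul_le _ _ fun s hs =>
      (hp s e (hcard e he s hs).1 (hcard e he s hs).2).1
  let Y : Finset Plane → ℝ := fun e => segNorm (x e) (y e) (polyFun (q e))
  have hY0 : ∀ e, 0 ≤ Y e := fun e => Real.sqrt_nonneg _
  set F := 𝒯.edges.filter fun e => 𝒯.IsInteriorEdge e ∨ 𝒯.IsDirichletEdge ΓD e with hF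
  have hFe : F ⊆ 𝒯.edges := Finset.filter_subset _ _
  refine ⟨∑ e ∈ F, Y e ^ 2, Finset.sum_nonneg fun e _ => sq_nonneg _, ?_, ?_⟩
  · rw [Triangulation.jSq, ENNReal.ofReal_sum_of_nonneg fun e _ => sq_nonneg _]
    refine Finset.sum_congr rfl fun e he => ?_
    exact hxy.jump_norm_eq hn hv.1 (hFe he)
      (fun s hs => (hp s e (hcard e (hFe he) s hs).1 (hcard e (hFe he) s hs).2).2)
      (contDiff_polyFun _).continuous fun z => polyFun_sum _ _ _ z
  intro w hw
  have hwT : ∀ s ∈ 𝒯.cells, MemH1 (interior (hull s)) w := fun s hs =>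
    hw.1.mono (𝒯.interior_hull_subset hΩ hs)
  obtain ⟨g, hg, hgN⟩ := hxy.exists_traces hΩ hw
  let m : Finset Plane → ℝ := fun e => ∫ r in (0 : ℝ)..1, g e (AffineMap.lineMap (x e) (y e) r)
  have hgF : ∀ e ∈ 𝒯.edges, e ∉ F → g e = 0 := fun e he heF =>
    hgN e (Triangulation.isNeumannEdge_of_not hΓ he fun h => heF (Finset.mem_filter.2 ⟨he, h⟩))
  have hgm : ∀ e ∈ 𝒯.edges,
      MemLp (fun r : ℝ => g e (AffineMap.lineMap (x e) (y e) r)) 2 unitMeasure := by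
    intro e he
    obtain ⟨s, hs, hes, -⟩ := Triangulation.mem_edges.1 he
    exact (memLp_edgeMeasure_iff (hxy.ne e he) (hxy.eq e he)).1
      (hg e he s (Triangulation.mem_adj.2 ⟨hs, hes⟩)).1
  -- rearrange the sum over the triangles into a sum over the edges
  have hsum : ∑ s ∈ 𝒯.cells, tangentialPairing s (𝒯.pwGrad v) w =
      ∑ e ∈ F, lineInt (x e) (y e) (g e) (polyFun (q e)) := by
    have h1 : ∀ s ∈ 𝒯.cells, tangentialPairing s (𝒯.pwGrad v) w = ∑ e ∈ s.powersetCard 2,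
        side s (x e) (y e) * lineInt (x e) (y e) (g e) (polyFun (p s e)) := fun s hs =>
      hxy.tangentialPairing_eq_sum hs (hv.1.2 s hs) (hwT s hs)
        (p := fun e => polyFun (p s e)) (fun e he => (hp s e hs he).2)
        (fun e _ => contDiff_polyFun _)
        (fun e he => hg e (hedges s hs e he).1 s (hedges s hs e he).2)
    rw [Finset.sum_congr rfl h1, Triangulation.sum_cells_eq_sum_edges,
      Finset.sum_subset hFe fun e he heF => by simp [lineInt, hgF e he heF]]
    exact Finset.sum_congr rfl fun e he => (lineInt_sum _ _ _ (hgm e he)).symm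
  set G := (eLpNorm (weakGrad Ω w) 2 (volume.restrict Ω)).toReal with hGdef
  have hG0 : 0 ≤ G := ENNReal.toReal_nonneg
  have hcells : √(∑ s ∈ 𝒯.cells, cellNorm s w ^ 2) ≤ G :=
    Real.sqrt_le_iff.2 ⟨hG0, Triangulation.sum_cellNorm_sq_le hΩ hw.1⟩
  set J := ∑ e ∈ F, Y e ^ 2 with hJ
  have hJ0 : 0 ≤ J := Finset.sum_nonneg fun e _ => sq_nonneg _
  -- a triangle at every edge
  have hcell : ∀ e : Finset Plane, ∃ s, e ∈ 𝒯.edges → s ∈ 𝒯.adj e := by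
    intro e
    by_cases he : e ∈ 𝒯.edges
    · obtain ⟨s, hs, hes, -⟩ := Triangulation.mem_edges.1 he
      exact ⟨s, fun _ => Triangulation.mem_adj.2 ⟨hs, hes⟩⟩
    · exact ⟨∅, fun h => absurd h he⟩
  choose σ hσ using hcell
  have hest : ∀ e ∈ F, |lineInt (x e) (y e) (g e) (polyFun (q e)) -
      (polyFun (q e) (y e) - polyFun (q e) (x e)) * m e| ≤ C₀ * (Y e * cellNorm (σ e) w) := by
    intro e heF
    have he := hFe heF
    have hs := hσ e he
    have hs' := (Triangulation.mem_adj.1 hs).1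
    obtain ⟨c, hc⟩ := hxy.exists_vertices he hs
    have r1 := hA.norm_sq_le hα hα' hs' (hc.trans (triple_rotate _ _ _))
    have r2 := hA.norm_sq_le hα hα' hs'
      (hc.trans ((triple_rotate _ _ _).trans (triple_rotate _ _ _)))
    rw [norm_sub_rev, cross_rotate] at r1
    rw [norm_sub_rev, cross_rotate, cross_rotate] at r2
    rw [← mul_assoc]
    exact (hedge (q e) (hqd e he) (x e) (y e)).2.2 c (𝒯.cross_ne_zero hs' hc) r1 r2 (σ e) e hc
      (hxy.eq e he) w (g e) (hwT _ hs') (hg e he _ hs)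
  have hfirst : ∑ e ∈ F, C₀ * (Y e * cellNorm (σ e) w) ≤ C₀ * √3 * √J * G := by
    rw [← Finset.mul_sum]
    have h2 : ∑ e ∈ F, cellNorm (σ e) w ^ 2 ≤ 3 * ∑ s ∈ 𝒯.cells, cellNorm s w ^ 2 := by
      calc ∑ e ∈ F, cellNorm (σ e) w ^ 2 ≤ ∑ e ∈ 𝒯.edges, cellNorm (σ e) w ^ 2 :=
            Finset.sum_le_sum_of_subset_of_nonneg hFe fun _ _ _ => sq_nonneg _
        _ ≤ ∑ e ∈ 𝒯.edges, ∑ s ∈ 𝒯.adj e, cellNorm s w ^ 2 :=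
            Finset.sum_le_sum fun e he =>
              Finset.single_le_sum (f := fun s => cellNorm s w ^ 2)
                (fun _ _ => sq_nonneg _) (hσ e he)
        _ = ∑ s ∈ 𝒯.cells, ∑ e ∈ s.powersetCard 2, cellNorm s w ^ 2 :=
            (Triangulation.sum_cells_eq_sum_edges _).symm
        _ = 3 * ∑ s ∈ 𝒯.cells, cellNorm s w ^ 2 := by
            rw [Finset.mul_sum]
            refine Finset.sum_congr rfl fun s hs => ?_
            rw [Finset.sum_const, Finset.card_powersetCard, 𝒯.card_eq s hs]
            simp [Nat.choose]
    calc C₀ * ∑ e ∈ F, Y e * cellNorm (σ e) w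
        ≤ C₀ * (√J * √(∑ e ∈ F, cellNorm (σ e) w ^ 2)) :=
          mul_le_mul_of_nonneg_left (Real.sum_mul_le_sqrt_mul_sqrt _ _ _) hC₀.le
      _ ≤ C₀ * (√J * (√3 * G)) := by
          refine mul_le_mul_of_nonneg_left (mul_le_mul_of_nonneg_left ?_ (Real.sqrt_nonneg _)) hC₀.le
          refine (Real.sqrt_le_sqrt h2).trans ?_
          rw [Real.sqrt_mul (by norm_num)]
          exact mul_le_mul_of_nonneg_left hcells (Real.sqrt_nonneg _)
      _ = _ := by ring
  -- the corner values of `v`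
  let P : Finset Plane → Plane → ℝ := fun s z =>
    if h : ∃ e ∈ s.powersetCard 2, z ∈ e then polyFun (p s h.choose) z else 0
  have hP : ∀ s ∈ 𝒯.cells, ∀ e ∈ s.powersetCard 2, ∀ z ∈ e, P s z = polyFun (p s e) z := by
    intro s hs e he z hz
    have h : ∃ e ∈ s.powersetCard 2, z ∈ e := ⟨e, he, hz⟩
    simp only [P]
    rw [dif_pos h]
    exact Triangulation.trace_eq_at_vertex hs (hv.1.2 s hs) (p := fun e => polyFun (p s e))
      (fun e he => (hp s e hs he).2) (fun e _ => contDiff_polyFun _) h.choose_spec.1 he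
      h.choose_spec.2 hz
  have hsecond := hxy.abs_sum_le hFe (P := P) (q := fun e => polyFun (q e)) (m := m)
    (G := fun s => (Real.sin α)⁻¹ * cellNorm s w) (Y := fun e => C₀ * Y e) (N := N)
    (fun z => hA.card_le hα hα' z) ?_ ?_ ?_ ?_ ?_
  rotate_left
  · intro e he z hz
    refine (polyFun_sum _ _ _ z).trans (Finset.sum_congr rfl fun s hs => ?_)
    rw [hP s (hcard e he s hs).1 e (hcard e he s hs).2 z hz]
  · intro e he heF
    simp [m, hgF e he heF]
  · intro s hs e he f hf hes hfs
    exact hxy.abs_average_sub_le hα hα' hA hs (hwT s hs) hg he hf hes hfs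
  · intro s
    exact mul_nonneg (inv_nonneg.2 hκ.le) (cellNorm_nonneg s w)
  · intro e heF z hz
    have he := hFe heF
    obtain ⟨h1, h2, -⟩ := hedge (q e) (hqd e he) (x e) (y e)
    rcases (hxy.mem_iff he).1 hz with rfl | rfl
    · exact h1
    · exact h2
  have hscale : ∀ {ι : Type} (S : Finset ι) (c : ℝ) (f : ι → ℝ), 0 ≤ c →
      √(∑ i ∈ S, (c * f i) ^ 2) = c * √(∑ i ∈ S, f i ^ 2) := by
    intro ι S c f hc
    simp only [mul_pow, ← Finset.mul_sum]
    rw [Real.sqrt_mul (sq_nonneg c), Real.sqrt_sq hc]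
  rw [hscale _ _ _ hC₀.le, hscale _ _ _ (inv_nonneg.2 hκ.le)] at hsecond
  have hsecond' : |∑ e ∈ F, (polyFun (q e) (y e) - polyFun (q e) (x e)) * m e| ≤
      C₂ * (C₀ * (Real.sin α)⁻¹) * √J * G := by
    refine hsecond.trans ?_
    calc _ = C₂ * (C₀ * (Real.sin α)⁻¹) * √J * √(∑ s ∈ 𝒯.cells, cellNorm s w ^ 2) := by ring
      _ ≤ _ := mul_le_mul_of_nonneg_left hcells (by positivity)
  rw [hsum]
  have hdecomp : ∑ e ∈ F, lineInt (x e) (y e) (g e) (polyFun (q e)) =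
      ∑ e ∈ F, (lineInt (x e) (y e) (g e) (polyFun (q e)) -
        (polyFun (q e) (y e) - polyFun (q e) (x e)) * m e) +
      ∑ e ∈ F, (polyFun (q e) (y e) - polyFun (q e) (x e)) * m e := by
    rw [← Finset.sum_add_distrib]
    exact Finset.sum_congr rfl fun e _ => by ring
  rw [hdecomp]
  refine (abs_add_le _ _).trans ?_
  have h3 := (Finset.abs_sum_le_sum_abs (fun e => lineInt (x e) (y e) (g e) (polyFun (q e)) -
        (polyFun (q e) (y e) - polyFun (q e) (x e)) * m e) F).trans (Finset.sum_le_sum hest)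
  calc _ ≤ C₀ * √3 * √J * G + C₂ * (C₀ * (Real.sin α)⁻¹) * √J * G :=
        add_le_add (h3.trans hfirst) hsecond'
    _ = _ := by ring

end DLSFEM


theorem lemma4p4 (k : ℕ) (α : ℝ) (hα : 0 < α) :
    ∃ C : ℝ≥0, 0 < C ∧
      ∀ (Ω : Set DLSFEM.Plane) (_ : DLSFEM.IsLipschitzDomain Ω) (𝒯 : DLSFEM.Triangulation Ω)
        (_ : 𝒯.AnglesGE α) (ΓD : Set DLSFEM.Plane) (_ : 𝒯.IsDirichletPart ΓD)
        (n : Finset DLSFEM.Plane → DLSFEM.Plane) (_ : 𝒯.IsOrientation n)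
        (v : DLSFEM.Plane → ℝ) (_ : 𝒯.MemPolyTrace (k + 1) v),
        𝒯.jSq ΓD n v + 𝒯.st ΓD (𝒯.pwGrad v) ^ 2 ≤ C * 𝒯.jSq ΓD n v ∧
        𝒯.jSq ΓD n v ≤ C * (𝒯.jSq ΓD n v + 𝒯.st ΓD (𝒯.pwGrad v) ^ 2) := by
  have hβ : 0 < min α (Real.pi / 3) := lt_min hα (by linarith [Real.pi_pos])
  obtain ⟨C, hC, h⟩ := DLSFEM.exists_abs_sum_tangentialPairing_le k hβ (min_le_right _ _)
  refine ⟨1 + (C ^ 2).toNNReal, by positivity, ?_⟩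
  intro Ω hΩ 𝒯 hA ΓD hΓ n hn v hv
  have hA' : 𝒯.AnglesGE (min α (Real.pi / 3)) := fun s hs a ha b hb c hc h1 h2 h3 =>
    (min_le_left _ _).trans (hA s hs a ha b hb c hc h1 h2 h3)
  obtain ⟨J, hJ0, hJ, hw⟩ := h Ω hΩ 𝒯 hA' ΓD hΓ n hn v hv
  have hst : 𝒯.st ΓD (𝒯.pwGrad v) ≤ ENNReal.ofReal (C * √J) := by
    refine iSup₂_le fun w hw' => ENNReal.ofReal_le_ofReal ?_
    rw [← Finset.sum_div]
    have h1 := (le_abs_self _).trans (hw w hw'.1)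
    exact div_le_of_le_mul₀ ENNReal.toReal_nonneg (by positivity) h1
  have hst2 : 𝒯.st ΓD (𝒯.pwGrad v) ^ 2 ≤ ENNReal.ofReal (C ^ 2) * 𝒯.jSq ΓD n v := by
    refine (ENNReal.pow_le_pow_left hst).trans (le_of_eq ?_)
    rw [hJ, ← ENNReal.ofReal_pow (by positivity), mul_pow, Real.sq_sqrt hJ0,
      ENNReal.ofReal_mul (sq_nonneg C)]
  have hcoe : ((1 + (C ^ 2).toNNReal : ℝ≥0) : ℝ≥0∞) = 1 + ENNReal.ofReal (C ^ 2) := by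
    rw [ENNReal.coe_add, ENNReal.coe_one, ENNReal.ofReal]
  rw [hcoe]
  constructor
  · rw [add_mul, one_mul]
    exact add_le_add le_rfl hst2
  · refine le_self_add.trans (le_mul_of_one_le_left' ?_)
    exact le_self_add
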